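/- **Setting.** Let $\mathbb T^d=(\mathbb R/2\pi\mathbb Z)^d$, identify $(\mathbb R^d)^*$ with $\mathbb R^d$, and let $H\in C^\infty(\mathbb R^d;\mathbb R)$. Let $\Lambda\subset\mathbb Z^d$ be a primitive submodule, i.e. $\langle\Lambda\rangle\cap\mathbb Z^d=\Lambda$ where $\langle\Lambda\rangle$ is the real span of $\Lambda$; let $\mathbb S\langle\Lambda\rangle$ be the unit sphere of $\langle\Lambda\rangle$ and $\overline{\langle\Lambda\rangle}$ the compactification of $\langle\Lambda\rangle$ obtained by adding $\mathbb S\langle\Lambda\rangle$ as a sphere at infinity. Put $I_\Lambda=\{\xi: dH(\xi)\cdot k=0\ \forall k\in\Lambda\}$, $\Lambda_\xi=\{k\in\mathbb Z^d: k\cdot dH(\xi)=0\}$ and $R_\Lambda=\{\xi\in I_\Lambda:\operatorname{rk}\Lambda_\xi=\operatorname{rk}\Lambda\}$. Fix $\xi_0\in R_\Lambda$ and $0<r\le\varepsilon$ such that $d^2H(\xi)$ is (positive or negative) definite for all $\xi\in B(\xi_0,\varepsilon)$ and every $\xi\in B(\xi_0,r)$ can be written in a unique way as $\xi=\sigma(\xi)+\eta(\xi)$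 with $\sigma(\xi)\in I_\Lambda\cap B(\xi_0,\varepsilon)$ and $\eta(\xi)\in\langle\Lambda\rangle$. Let $\mathcal S^1_\Lambda$ be the space of smooth functions $a(x,\xi,\eta)$ on $T^*\mathbb T^d\times\langle\Lambda\rangle$ such that: (i) $a$ vanishes for $\xi$ outside a compact subset of $B(\xi_0,r)$; (ii) there are $R_0>0$ and a smooth function $a_{\rm hom}$ on $T^*\mathbb T^d\times\mathbb S\langle\Lambda\rangle$ with $a(x,\xi,\eta)=a_{\rm hom}(x,\xi,\eta/|\eta|)$ for $|\eta|>R_0$; (iii) $a$ has only $x$-Fourier modes in $\Lambda$. Each such $a$ extends continuously to $T^*\mathbb T^d\times\overline{\langle\Lambda\rangle}$, by $a_{\rm hom}$ at infinity. Let $(\mathcal S^1_\Lambda)'$ be the space of linear forms on $\mathcal S^1_\Lambda$ bounded by finitely many of the seminorms $\sum_{|\alpha|\le N}\|\partial^\alpha_{x,\xi,\eta}a\|_{L^\infty}$. Let $h_n\to0^+$, let $\tau_n>0$ with $\tau_n\to+\infty$ and $(h_n\tau_n)$ bounded, and let $(u_n)$ be a bounded sequence in $L^2(\mathbb T^d)$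 with $\widehat{u_n}(k)=0$ whenever $h_nk\notin B(\xi_0,r)$. Let $S_h^t=e^{-i\frac th H(hD_x)}$ and let $\operatorname{Op}_h$ be the Weyl quantization on $\mathbb T^d$. Let $\chi\in C_c^\infty(\langle\Lambda\rangle)$ be nonnegative and equal to $1$ near $0$, and put $$\langle w_{n,R,\delta}(t),a\rangle=\Big\langle S_{h_n}^{\tau_nt}u_n,\ \operatorname{Op}_{h_n}(b_{n,R,\delta})\,S_{h_n}^{\tau_nt}u_n\Big\rangle_{L^2(\mathbb T^d)},$$ $$b_{n,R,\delta}(x,\xi)=a(x,\xi,\tau_n\eta(\xi))\Big(1-\chi\Big(\frac{\tau_n\eta(\xi)}R\Big)\Big)\chi\Big(\frac{\eta(\xi)}\delta\Big).$$ Suppose that $\tilde\mu^\Lambda\in L^\infty(\mathbb R;(\mathcal S^1_\Lambda)')$ (bounded in the weak-$*$ sense) is a two-microlocal limit of $(u_n)$: for some sequences $R_m\to+\infty$ with $R_m>1$ and $\delta_l\to0^+$ with $\delta_l<1$, for all $\varphi\in L^1(\mathbb R)$ and all $a\in\mathcal S^1_\Lambda$, $$\int_{\mathbb R}\varphi(t)\langle\tilde\mu^\Lambda(t,\cdot),a\rangle\,dt=\lim_{l\to\infty}\lim_{m\to\infty}\lim_{n\to\infty}\int_{\mathbb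 R}\varphi(t)\langle w_{n,R_m,\delta_l}(t),a\rangle\,dt,$$ all the limits existing. **Theorem.** For almost every $t\in\mathbb R$, $\tilde\mu^\Lambda(t,\cdot)$ is a finite positive measure on $\mathbb T^d\times I_\Lambda\times\overline{\langle\Lambda\rangle}$, supported on the sphere at infinity $\mathbb S\langle\Lambda\rangle$ in the variable $\eta$: there is such a measure, concentrated on $\xi\in B(\xi_0,r)$ and with only $x$-Fourier modes in $\Lambda$ (i.e. invariant under $(x,\xi,\eta)\mapsto(x+v,\xi,\eta)$ for $v\in\Lambda^\perp$), whose integral against (the extension of) every $a\in\mathcal S^1_\Lambda$ is $\langle\tilde\mu^\Lambda(t,\cdot),a\rangle$. Moreover this measure satisfies $$(\phi^0_s)_*\tilde\mu^\Lambda(t,\cdot)=\tilde\mu^\Lambda(t,\cdot),\qquad(\phi^1_s)_*\tilde\mu^\Lambda(t,\cdot)=\tilde\mu^\Lambda(t,\cdot)\qquad\text{for all } s\in\mathbb R,$$ where $\phi^0_s(x,\xi,\eta)=(x+s\,dH(\xi),\xi,\eta)$ and $\phi^1_s(x,\xi,\eta)=\big(x+s\,d^2H(\sigma(\xi))\tfrac{\eta}{|\eta|},\xi,\eta\big)$,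 with $\eta/|\eta|$ replaced by $\omega$ at a point $\omega\in\mathbb S\langle\Lambda\rangle$ at infinity. -/

import Mathlib

open Filter Topology MeasureTheory
open scoped ContDiff

noncomputable section

namespace TwoMicrolocal

/-- Frequency space `(ℝ^d)^*`, identified with `ℝ^d` by the canonical basis, with its
Euclidean norm. -/
abbrev Freq (d : ℕ) : Type := EuclideanSpace ℝ (Fin d)

/-- The torus `𝕋^d = (ℝ / 2πℤ)^d`; its `volume` is Lebesgue measure, of total mass `(2π)^d`. -/
abbrev Torus (d : ℕ) : Type := Fin d → AddCircle (2 * Real.pi)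

instance factTwoPiPos : Fact (0 < 2 * Real.pi) := ⟨Real.two_pi_pos⟩

/-- The projection `ℝ^d → 𝕋^d`. -/
def proj {d : ℕ} (v : EuclideanSpace ℝ (Fin d)) : Torus d :=
  fun i => (v i : AddCircle (2 * Real.pi))

/-- The lattice point `k ∈ (ℤ^d)^*` as a vector. -/
def latticeVec {d : ℕ} (k : Fin d → ℤ) : Freq d := WithLp.toLp 2 (fun i => (k i : ℝ))

/-! ### Fourier coefficients, propagator, Wigner distributions -/

/-- `e^{i k·x} / (2π)^{d/2}`. -/
def character {d : ℕ} (k : Fin d → ℤ) (x : Torus d) : ℂ :=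
  (((2 * Real.pi) ^ (-(d : ℝ) / 2) : ℝ) : ℂ) * ∏ i, fourier (k i) (x i)

/-- `û(k) = ∫ u(x) e^{-i k·x} / (2π)^{d/2} dx`. -/
def fourierCoef {d : ℕ} (u : Torus d → ℂ) (k : Fin d → ℤ) : ℂ :=
  ∫ x, u x * (starRingEnd ℂ) (character k x)

/-- The Fourier coefficients of `S_h^t u = e^{-i (t/h) H(hD_x)} u`: the propagator is the
Fourier multiplier by `e^{-i (t/h) H(hk)}`. -/
def propagatedCoef {d : ℕ} (H : Freq d → ℝ) (h t : ℝ) (u : Torus d → ℂ) (k : Fin d → ℤ) : ℂ :=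
  Complex.exp (-(Complex.I * ((t / h * H (h • latticeVec k) : ℝ) : ℂ))) * fourierCoef u k

/-- The `j`-th Fourier coefficient of `Op_h(b) v` (Weyl quantization on the torus), where `c`
are the Fourier coefficients of `v`. -/
def weylCoef {d : ℕ} (h : ℝ) (b : Torus d × Freq d → ℂ) (c : (Fin d → ℤ) → ℂ)
    (j : Fin d → ℤ) : ℂ :=
  (((2 * Real.pi) ^ (-(d : ℝ) / 2) : ℝ) : ℂ) *
    ∑' k : Fin d → ℤ,
      fourierCoef (fun x => b (x, (h / 2) • latticeVec (k + j))) (j - k) * c k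

/-- The Wigner distribution `⟨v, Op_h(b) v⟩_{L²(𝕋^d)}` (by Parseval), where `c` are the Fourier
coefficients of `v`. -/
def wigner {d : ℕ} (h : ℝ) (c : (Fin d → ℤ) → ℂ) (b : Torus d × Freq d → ℂ) : ℂ :=
  ∑' j : Fin d → ℤ, (starRingEnd ℂ) (c j) * weylCoef h b c j

/-! ### Resonant geometry -/

/-- `⟨Λ⟩`, the real span of `Λ`. -/
def realSpan {d : ℕ} (Λ : Submodule ℤ (Fin d → ℤ)) : Submodule ℝ (Freq d) :=
  Submodule.span ℝ (latticeVec '' (Λ : Set (Fin d → ℤ)))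

/-- `Λ` is primitive: `⟨Λ⟩ ∩ ℤ^d = Λ`. -/
def IsPrimitive {d : ℕ} (Λ : Submodule ℤ (Fin d → ℤ)) : Prop :=
  ∀ k : Fin d → ℤ, latticeVec k ∈ realSpan Λ ↔ k ∈ Λ

/-- `v ∈ Λ^⊥`. -/
def IsOrthogonalTo {d : ℕ} (Λ : Submodule ℤ (Fin d → ℤ)) (v : EuclideanSpace ℝ (Fin d)) : Prop :=
  ∀ k ∈ Λ, inner ℝ (latticeVec k) v = 0

/-- `I_Λ = {ξ : dH(ξ)·k = 0 for all k ∈ Λ}`. -/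
def resonantSet {d : ℕ} (H : Freq d → ℝ) (Λ : Submodule ℤ (Fin d → ℤ)) : Set (Freq d) :=
  {ξ | IsOrthogonalTo Λ (gradient H ξ)}

/-- `Λ_ξ = {k : k·dH(ξ) = 0}`. -/
def resonanceModule {d : ℕ} (H : Freq d → ℝ) (ξ : Freq d) : Submodule ℤ (Fin d → ℤ) where
  carrier := {k | inner ℝ (latticeVec k) (gradient H ξ) = 0}
  zero_mem' := by
    have : latticeVec (0 : Fin d → ℤ) = 0 := by ext i; simp [latticeVec]
    simp [this]
  add_mem' := by
    intro a b ha hb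
    have : latticeVec (a + b) = latticeVec a + latticeVec b := by ext i; simp [latticeVec]
    simp only [Set.mem_ofPred_eq] at ha hb ⊢
    rw [this, inner_add_left, ha, hb, add_zero]
  smul_mem' := by
    intro c a ha
    have : latticeVec (c • a) = (c : ℝ) • latticeVec a := by ext i; simp [latticeVec]
    simp only [Set.mem_ofPred_eq] at ha ⊢
    rw [this, real_inner_smul_left, ha, mul_zero]

/-- `R_Λ`: the `ξ ∈ I_Λ` whose resonance module has the same rank as `Λ`. -/
def strictResonantSet {d : ℕ} (H : Freq d → ℝ) (Λ : Submodule ℤ (Fin d → ℤ)) : Set (Freq d) :=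
  {ξ | ξ ∈ resonantSet H Λ ∧ Module.finrank ℤ (resonanceModule H ξ) = Module.finrank ℤ Λ}

/-- The Hessian `d²H(ξ)` as an endomorphism of `ℝ^d`. -/
def hessian {d : ℕ} (H : Freq d → ℝ) (ξ : Freq d) : Freq d →L[ℝ] Freq d :=
  fderiv ℝ (gradient H) ξ

/-- `d²H(ξ)` is (positive or negative) definite. -/
def DefiniteHessianAt {d : ℕ} (H : Freq d → ℝ) (ξ : Freq d) : Prop :=
  (∀ v : Freq d, v ≠ 0 → 0 < inner ℝ (hessian H ξ v) v) ∨
    (∀ v : Freq d, v ≠ 0 → inner ℝ (hessian H ξ v) v < 0)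

/-- `σ` is the base point of a decomposition `ξ = σ + η`, with `σ ∈ I_Λ ∩ B(ξ₀, ε)` and
`η ∈ ⟨Λ⟩`. -/
def IsBasePoint {d : ℕ} (H : Freq d → ℝ) (Λ : Submodule ℤ (Fin d → ℤ)) (ξ₀ : Freq d) (ε : ℝ)
    (ξ σ : Freq d) : Prop :=
  σ ∈ resonantSet H Λ ∧ σ ∈ Metric.ball ξ₀ ε ∧ ξ - σ ∈ realSpan Λ

open Classical in
/-- The map `σ(ξ)`; its value is irrelevant at points without a decomposition. -/
def sigmaMap {d : ℕ} (H : Freq d → ℝ) (Λ : Submodule ℤ (Fin d → ℤ)) (ξ₀ : Freq d) (ε : ℝ)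
    (ξ : Freq d) : Freq d :=
  if hξ : ∃ σ, IsBasePoint H Λ ξ₀ ε ξ σ then hξ.choose else ξ

/-- The map `η(ξ) = ξ - σ(ξ) ∈ ⟨Λ⟩`. -/
def etaMap {d : ℕ} (H : Freq d → ℝ) (Λ : Submodule ℤ (Fin d → ℤ)) (ξ₀ : Freq d) (ε : ℝ)
    (ξ : Freq d) : realSpan Λ :=
  ⟨ξ - sigmaMap H Λ ξ₀ ε ξ, by
    unfold sigmaMap
    split_ifs with hξ
    · exact hξ.choose_spec.2.2
    · simp⟩

/-! ### Two-microlocal symbols -/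

/-- The lift to `ℝ^d × (ℝ^d)^* × ⟨Λ⟩` of a function on `T^*𝕋^d × ⟨Λ⟩`. -/
def symbolLift {d : ℕ} {Λ : Submodule ℤ (Fin d → ℤ)} (a : Torus d × Freq d × realSpan Λ → ℂ) :
    Freq d × Freq d × realSpan Λ → ℂ :=
  fun p => a (proj p.1, p.2.1, p.2.2)

/-- The symbols of class `S¹_Λ`, for the localization `ξ ∈ B(ξ₀, r)`. In `homogeneous`, the
smoothness of `ahom` on `T^*𝕋^d × 𝕊⟨Λ⟩` follows from that of `a`. -/
structure IsSymbol {d : ℕ} (Λ : Submodule ℤ (Fin d → ℤ)) (ξ₀ : Freq d) (r : ℝ)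
    (a : Torus d × Freq d × realSpan Λ → ℂ) : Prop where
  smooth : ContDiff ℝ ∞ (symbolLift a)
  compactSupport : ∃ K : Set (Freq d), IsCompact K ∧ K ⊆ Metric.ball ξ₀ r ∧
    ∀ x ξ η, ξ ∉ K → a (x, ξ, η) = 0
  homogeneous : ∃ R₀ : ℝ, 0 < R₀ ∧ ∃ ahom : Torus d × Freq d × realSpan Λ → ℂ,
    ∀ x ξ η, R₀ < ‖η‖ → a (x, ξ, η) = ahom (x, ξ, ‖η‖⁻¹ • η)
  modes : ∀ k : Fin d → ℤ, k ∉ Λ → ∀ ξ η, fourierCoef (fun x => a (x, ξ, η)) k = 0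

theorem isOpenQuotientMap_proj {d : ℕ} : IsOpenQuotientMap (proj : Freq d → Torus d) := by
  have h1 : IsOpenQuotientMap (Pi.map (fun (_ : Fin d) (t : ℝ) =>
      (t : AddCircle (2 * Real.pi)))) :=
    IsOpenQuotientMap.piMap (fun _ => QuotientAddGroup.isOpenQuotientMap_mk)
  exact h1.comp (EuclideanSpace.equiv (Fin d) ℝ).toHomeomorph.isOpenQuotientMap

theorem continuous_character {d : ℕ} (k : Fin d → ℤ) :
    Continuous (character k : Torus d → ℂ) := by
  unfold character
  fun_prop

theorem IsSymbol.continuous_slice {d : ℕ} {Λ : Submodule ℤ (Fin d → ℤ)} {ξ₀ : Freq d} {r : ℝ}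
    {a : Torus d × Freq d × realSpan Λ → ℂ} (ha : IsSymbol Λ ξ₀ r a) (ξ : Freq d)
    (η : realSpan Λ) : Continuous (fun x => a (x, ξ, η)) := by
  rw [isOpenQuotientMap_proj.isQuotientMap.continuous_iff]
  have h := ha.smooth.continuous
  exact h.comp (by fun_prop : Continuous (fun v : Freq d => (v, ξ, η)))

theorem IsSymbol.integrable_slice {d : ℕ} {Λ : Submodule ℤ (Fin d → ℤ)} {ξ₀ : Freq d} {r : ℝ}
    {a : Torus d × Freq d × realSpan Λ → ℂ} (ha : IsSymbol Λ ξ₀ r a) (ξ : Freq d)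
    (η : realSpan Λ) (k : Fin d → ℤ) :
    Integrable (fun x => a (x, ξ, η) * (starRingEnd ℂ) (character k x)) := by
  have hc : Continuous (fun x => a (x, ξ, η) * (starRingEnd ℂ) (character k x)) :=
    (ha.continuous_slice ξ η).mul (Complex.continuous_conj.comp (continuous_character k))
  exact hc.integrable_of_hasCompactSupport (HasCompactSupport.of_compactSpace _)

/-- The space `S¹_Λ`. -/
def SymbolSpace {d : ℕ} (Λ : Submodule ℤ (Fin d → ℤ)) (ξ₀ : Freq d) (r : ℝ) :
    Submodule ℂ (Torus d × Freq d × realSpan Λ → ℂ) where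
  carrier := {a | IsSymbol Λ ξ₀ r a}
  zero_mem' :=
    { smooth := contDiff_const
      compactSupport := ⟨∅, isCompact_empty, Set.empty_subset _, fun _ _ _ _ => rfl⟩
      homogeneous := ⟨1, one_pos, 0, fun _ _ _ _ => rfl⟩
      modes := fun k _ ξ η => by simp [fourierCoef] }
  add_mem' := by
    intro a b ha hb
    refine ⟨ha.smooth.add hb.smooth, ?_, ?_, ?_⟩
    · obtain ⟨K, hK, hKr, hKa⟩ := ha.compactSupport
      obtain ⟨K', hK', hKr', hKb⟩ := hb.compactSupport
      refine ⟨K ∪ K', hK.union hK', Set.union_subset hKr hKr', fun x ξ η hξ => ?_⟩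
      simp only [Set.mem_union, not_or] at hξ
      simp [hKa x ξ η hξ.1, hKb x ξ η hξ.2]
    · obtain ⟨R, hR, f, hf⟩ := ha.homogeneous
      obtain ⟨R', hR', g, hg⟩ := hb.homogeneous
      refine ⟨max R R', lt_max_of_lt_left hR, f + g, fun x ξ η hη => ?_⟩
      simp [hf x ξ η ((le_max_left _ _).trans_lt hη), hg x ξ η ((le_max_right _ _).trans_lt hη)]
    · intro k hk ξ η
      have h1 := ha.modes k hk ξ η
      have h2 := hb.modes k hk ξ η
      unfold fourierCoef at h1 h2 ⊢
      simp only [Pi.add_apply, add_mul]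
      rw [integral_add (ha.integrable_slice ξ η k) (hb.integrable_slice ξ η k), h1, h2, add_zero]
  smul_mem' := by
    intro c a ha
    refine ⟨ha.smooth.const_smul c, ?_, ?_, ?_⟩
    · obtain ⟨K, hK, hKr, hKa⟩ := ha.compactSupport
      exact ⟨K, hK, hKr, fun x ξ η hξ => by simp [hKa x ξ η hξ]⟩
    · obtain ⟨R, hR, f, hf⟩ := ha.homogeneous
      exact ⟨R, hR, c • f, fun x ξ η hη => by simp [hf x ξ η hη]⟩
    · intro k hk ξ η
      have h1 := ha.modes k hk ξ η
      unfold fourierCoef at h1 ⊢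
      simp only [Pi.smul_apply, smul_eq_mul, mul_assoc]
      rw [integral_const_mul, h1, mul_zero]

/-- `ℓ ∈ (S¹_Λ)'`: a linear form that is bounded by finitely many of the seminorms
`∑_{|α| ≤ N} ‖∂^α_{x,ξ,η} a‖_∞`. -/
def IsContinuousForm {d : ℕ} {Λ : Submodule ℤ (Fin d → ℤ)} {ξ₀ : Freq d} {r : ℝ}
    (ℓ : SymbolSpace Λ ξ₀ r →ₗ[ℂ] ℂ) : Prop :=
  ∃ (N : ℕ) (C : ℝ), ∀ (a : SymbolSpace Λ ξ₀ r) (B : ℝ),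
    (∀ n ≤ N, ∀ p, ‖iteratedFDeriv ℝ n (symbolLift a.1) p‖ ≤ B) → ‖ℓ a‖ ≤ C * B

/-! ### The two-microlocal limit -/

/-- The symbol `a₂(x, ξ, τ η(ξ))` on `T^*𝕋^d`, where
`a₂(x, ξ, η) = a(x, ξ, η) (1 - χ(η/R)) χ(η(ξ)/δ)`. -/
def truncatedSymbol {d : ℕ} (H : Freq d → ℝ) (Λ : Submodule ℤ (Fin d → ℤ)) (ξ₀ : Freq d) (ε : ℝ)
    (χ : realSpan Λ → ℝ) (τ R δ : ℝ) (a : Torus d × Freq d × realSpan Λ → ℂ) :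
    Torus d × Freq d → ℂ :=
  fun p => a (p.1, p.2, τ • etaMap H Λ ξ₀ ε p.2) *
    (((1 - χ (R⁻¹ • (τ • etaMap H Λ ξ₀ ε p.2))) * χ (δ⁻¹ • etaMap H Λ ξ₀ ε p.2) : ℝ) : ℂ)

/-- `lim_{l → ∞} lim_{m → ∞} lim_{n → ∞} F n m l = z`, every limit existing. -/
def HasIteratedLimit (F : ℕ → ℕ → ℕ → ℂ) (z : ℂ) : Prop :=
  ∃ (G : ℕ → ℕ → ℂ) (K : ℕ → ℂ),
    (∀ m l, Tendsto (fun n => F n m l) atTop (𝓝 (G m l))) ∧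
    (∀ l, Tendsto (fun m => G m l) atTop (𝓝 (K l))) ∧
    Tendsto K atTop (𝓝 z)

/-- `μ = μ̃^Λ` as an element of `L^∞(ℝ; (S¹_Λ)')`: for all `φ ∈ L¹(ℝ)` and `a ∈ S¹_Λ`,
`∫ φ(t) ⟨μ(t), a⟩ dt` is the limit of `∫ φ(t) ⟨w^{I_Λ}_{h,R,δ}(t), a⟩ dt` as `h = h_n → 0`, then
`R = R_m → ∞`, then `δ = δ_l → 0`. -/
structure IsTwoMicrolocalLimit {d : ℕ} (H : Freq d → ℝ) (Λ : Submodule ℤ (Fin d → ℤ))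
    (ξ₀ : Freq d) (r ε : ℝ) (χ : realSpan Λ → ℝ) (h τ R δ : ℕ → ℝ)
    (u : ℕ → Lp ℂ 2 (volume : Measure (Torus d)))
    (μ : ℝ → SymbolSpace Λ ξ₀ r →ₗ[ℂ] ℂ) : Prop where
  continuousForm : ∀ᵐ t : ℝ, IsContinuousForm (μ t)
  measurable : ∀ a, AEStronglyMeasurable (fun t => μ t a) (volume : Measure ℝ)
  bounded : ∀ a, ∃ C : ℝ, ∀ᵐ t : ℝ, ‖μ t a‖ ≤ C
  limit : ∀ (φ : ℝ → ℂ), Integrable φ → ∀ a : SymbolSpace Λ ξ₀ r,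
    HasIteratedLimit
      (fun n m l => ∫ t : ℝ, φ t * wigner (h n) (propagatedCoef H (h n) (τ n * t) (u n))
        (truncatedSymbol H Λ ξ₀ ε χ (τ n) (R m) (δ l) a.1))
      (∫ t : ℝ, φ t * μ t a)

/-! ### The compactified phase space and the flows -/

/-- The compactification of `⟨Λ⟩` by its sphere at infinity: the closed unit ball, in which
`η ∈ ⟨Λ⟩` is the point `η / (1 + |η|)` and the unit sphere is the sphere at infinity. -/
abbrev Compactified {d : ℕ} (Λ : Submodule ℤ (Fin d → ℤ)) : Type :=
  Metric.closedBall (0 : realSpan Λ) 1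

/-- `𝕋^d × I_Λ × ⟨Λ⟩̄`. -/
abbrev PhaseSpace {d : ℕ} (H : Freq d → ℝ) (Λ : Submodule ℤ (Fin d → ℤ)) : Type :=
  Torus d × resonantSet H Λ × Compactified Λ

open Classical in
/-- The continuous extension of a symbol to `𝕋^d × I_Λ × ⟨Λ⟩̄`: it is `a` at finite `η`, and the
radial limit `a_hom` on the sphere at infinity. -/
def extendSymbol {d : ℕ} (H : Freq d → ℝ) (Λ : Submodule ℤ (Fin d → ℤ))
    (a : Torus d × Freq d × realSpan Λ → ℂ) (p : PhaseSpace H Λ) : ℂ :=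
  if ‖(p.2.2 : realSpan Λ)‖ < 1 then
    a (p.1, p.2.1, (1 - ‖(p.2.2 : realSpan Λ)‖)⁻¹ • (p.2.2 : realSpan Λ))
  else limUnder atTop (fun ρ : ℝ => a (p.1, p.2.1, ρ • (p.2.2 : realSpan Λ)))

/-- `φ⁰_s(x, ξ, η) = (x + s dH(ξ), ξ, η)`. -/
def flowZero {d : ℕ} (H : Freq d → ℝ) (Λ : Submodule ℤ (Fin d → ℤ)) (s : ℝ)
    (p : PhaseSpace H Λ) : PhaseSpace H Λ :=
  (p.1 + proj (s • gradient H p.2.1), p.2)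

/-- `φ¹_s(x, ξ, η) = (x + s d²H(σ(ξ)) η/|η|, ξ, η)`; in the closed unit ball, `η/|η|` is `z/|z|`,
both at finite `η ≠ 0` and on the sphere at infinity. -/
def flowOne {d : ℕ} (H : Freq d → ℝ) (Λ : Submodule ℤ (Fin d → ℤ)) (ξ₀ : Freq d) (ε : ℝ) (s : ℝ)
    (p : PhaseSpace H Λ) : PhaseSpace H Λ :=
  (p.1 + proj (s • hessian H (sigmaMap H Λ ξ₀ ε p.2.1)
    ((‖(p.2.2 : realSpan Λ)‖⁻¹ • (p.2.2 : realSpan Λ) : realSpan Λ) : Freq d)), p.2)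

/-- `(x, ξ, η) ↦ (x + v, ξ, η)`. -/
def translate {d : ℕ} (H : Freq d → ℝ) (Λ : Submodule ℤ (Fin d → ℤ))
    (v : EuclideanSpace ℝ (Fin d)) (p : PhaseSpace H Λ) : PhaseSpace H Λ :=
  (p.1 + proj v, p.2)

end TwoMicrolocal

end

open Filter Topology MeasureTheory
open scoped ContDiff

noncomputable section

namespace TwoMicrolocal

section


variable {d : ℕ}

/-! ### Harmonic analysis on the torus -/

/-! A symbol has only `x`-modes in `Λ`, so its Weyl matrix couples two frequencies only when they
differ by an element of `Λ`. Along a leaf `ξ + ⟨Λ⟩` the base point `σ` is constant and `η` moves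
exactly as `ξ` does (`norm_etaMap_sub`). Every estimate is made along leaves, and no regularity of
`σ` across them is needed.

Positivity. Let `Re a ≥ 0` at infinity over `I_Λ`. The Weyl matrix is almost Toeplitz on windows `p
+ B`, where `B` is a large Følner set in `Λ`: there the symbol can be frozen at `hp`, because `h` is
small and `τη/R` moves by at most `hτ/R` times the size of `B`, with `hτ` bounded. A frozen form is
`∫ b(x, hp) |∑ c_k e_k|² dx`, bounded below by a lower bound of `Re b`. Averaging over the windows
gives an inequality of Gårding type (`exists_wigner_lower_bound`). Replacing `ξ` by `σ(ξ) ∈ I_Λ`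
costs `O(δ)`. The factor `1 - χ` may be negative only in a shell `τ|η| ~ R`; a pigeonhole over
disjoint shells (`frequently_shell_mass_lt`) makes the mass there small for infinitely many `R_m`.
Symbols independent of `x` are diagonal, which bounds the total mass.

Hessian flow. For a mode `m = j - k`, integration in time against a smooth `φ` yields the Fourier
transform of `φ` at `θ = τ (H(hj) - H(hk))/h`. As `m·dH(σ) = 0`, Taylor expansion gives `θ/τ =
m·d²H(ξ)η + O(|η|² + h)`. A symbol with the factor `m·d²H(ξ)η/|η|` thus contributes `O(1/(τ|η|) +
|η| + h/|η|)`, which vanishes in the iterated limit since `τ|η| ≳ R` and `|η| ≲ δ`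
(`IsTwoMicrolocalLimit.ae_eq_zero`).

Measure. Separability of the symbols in the `C^∞` sense gives one null set of times for all symbols
(`ae_forall_mem_of_isClosed`). Hahn–Banach and Riesz on the compact sphere at infinity yield a
measure (`exists_measure_of_le`), which is averaged over the annihilator of `Λ` so that its modes
lie in `Λ`. Invariance is then tested on trigonometric functions: modes outside `Λ` integrate to
zero; for `k ∈ Λ`, `k·dH = 0` on `I_Λ` settles `φ⁰`, and `e^{is k·d²H ω} - 1` is a bounded multiple
of `k·d²H ω`, which settles `φ¹`. -/

/-- The unnormalized character `e^{i k·x}`. -/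
def phase (k : Fin d → ℤ) (x : Torus d) : ℂ := ∏ i, fourier (k i) (x i)

/-- The normalization constant `(2π)^{-d/2}` of the characters. -/
def charNorm (d : ℕ) : ℝ := (2 * Real.pi) ^ (-(d : ℝ) / 2)

theorem character_eq (k : Fin d → ℤ) (x : Torus d) :
    character k x = (charNorm d : ℂ) * phase k x := rfl

theorem charNorm_pos : 0 < charNorm d := Real.rpow_pos_of_pos Real.two_pi_pos _

theorem phase_add_right (k : Fin d → ℤ) (x y : Torus d) :
    phase k (x + y) = phase k x * phase k y := by
  simp only [phase, ← Finset.prod_mul_distrib]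
  refine Finset.prod_congr rfl fun i _ => ?_
  simp [fourier_apply, smul_add, AddCircle.toCircle_add]

theorem phase_add_left (k l : Fin d → ℤ) (x : Torus d) :
    phase (k + l) x = phase k x * phase l x := by
  simp only [phase, ← Finset.prod_mul_distrib]
  exact Finset.prod_congr rfl fun i _ => by simp

theorem phase_neg_left (k : Fin d → ℤ) (x : Torus d) :
    phase (-k) x = (starRingEnd ℂ) (phase k x) := by
  simp only [phase, map_prod]
  exact Finset.prod_congr rfl fun i _ => by simp only [Pi.neg_apply, fourier_neg]

theorem phase_zero_left (x : Torus d) : phase 0 x = 1 := by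
  simp [phase]

theorem phase_zero_right (k : Fin d → ℤ) : phase k 0 = 1 := by
  simp [phase]

theorem norm_phase (k : Fin d → ℤ) (x : Torus d) : ‖phase k x‖ = 1 := by
  simp only [phase, norm_prod]
  exact Finset.prod_eq_one fun i _ => by
    rw [fourier_apply]; exact Circle.norm_coe _

theorem continuous_phase (k : Fin d → ℤ) : Continuous (phase k : Torus d → ℂ) := by
  unfold phase
  fun_prop

theorem phase_mul_conj (k : Fin d → ℤ) (x : Torus d) :
    phase k x * (starRingEnd ℂ) (phase k x) = 1 := by
  rw [Complex.mul_conj, Complex.normSq_eq_norm_sq, norm_phase]; simp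

theorem phase_proj (k : Fin d → ℤ) (v : Freq d) :
    phase k (proj v) = Complex.exp (Complex.I * ((inner ℝ (latticeVec k) v : ℝ) : ℂ)) := by
  simp only [phase, proj, fourier_coe_apply, ← Complex.exp_sum]
  congr 1
  simp only [PiLp.inner_apply, latticeVec]
  push_cast
  rw [Finset.mul_sum]
  refine Finset.sum_congr rfl fun i _ => ?_
  have : (Real.pi : ℂ) ≠ 0 := by exact_mod_cast Real.pi_ne_zero
  simp
  field_simp

theorem latticeVec_add (k l : Fin d → ℤ) : latticeVec (k + l) = latticeVec k + latticeVec l := by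
  ext i; simp [latticeVec]

theorem latticeVec_sub (k l : Fin d → ℤ) : latticeVec (k - l) = latticeVec k - latticeVec l := by
  ext i; simp [latticeVec]

theorem latticeVec_zero : latticeVec (0 : Fin d → ℤ) = 0 := by
  ext i; simp [latticeVec]

theorem latticeVec_injective : Function.Injective (latticeVec : (Fin d → ℤ) → Freq d) := by
  intro k l h
  funext i
  have := congrArg (fun v : Freq d => v i) h
  simpa [latticeVec] using this

theorem proj_add (v w : Freq d) : proj (v + w) = proj v + proj w := by
  funext i; simp [proj]

theorem continuous_proj : Continuous (proj : Freq d → Torus d) :=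
  isOpenQuotientMap_proj.continuous

/-- If `k ≠ 0`, the vector `v = π k / |k|²` satisfies `e^{i k·v} = -1`. -/
theorem phase_antipode {k : Fin d → ℤ} (hk : k ≠ 0) :
    phase k (proj ((Real.pi / ‖latticeVec k‖ ^ 2) • latticeVec k)) = -1 := by
  have h0 : latticeVec k ≠ 0 := fun h => hk (latticeVec_injective (h.trans latticeVec_zero.symm))
  have h1 : ‖latticeVec k‖ ≠ 0 := norm_ne_zero_iff.2 h0
  rw [phase_proj, real_inner_smul_right, real_inner_self_eq_norm_sq, div_mul_cancel₀ _ (by positivity),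
    mul_comm, Complex.exp_pi_mul_I]

theorem continuous_integrable_torus {E : Type*} [NormedAddCommGroup E] {f : Torus d → E}
    (hf : Continuous f) : Integrable f :=
  hf.integrable_of_hasCompactSupport (HasCompactSupport.of_compactSpace _)

theorem volume_torus : (volume : Measure (Torus d)).real Set.univ = (2 * Real.pi) ^ d := by
  rw [Measure.real, ← Set.pi_univ, volume_pi, Measure.pi_pi]
  simp [AddCircle.measure_univ, Real.pi_pos.le]

theorem charNorm_sq : charNorm d * charNorm d * (2 * Real.pi) ^ d = 1 := by
  unfold charNorm
  rw [← Real.rpow_add Real.two_pi_pos, ← Real.rpow_natCast (2 * Real.pi) d,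
    ← Real.rpow_add Real.two_pi_pos]
  ring_nf
  simp

theorem integral_phase (k : Fin d → ℤ) :
    ∫ x : Torus d, phase k x = if k = 0 then (((2 * Real.pi) ^ d : ℝ) : ℂ) else 0 := by
  split_ifs with hk
  · subst hk
    simp only [phase_zero_left, integral_const, volume_torus]
    simp
  -- Translation by the half-period of `phase_antipode` changes the sign of the integrand, so the
  -- integral equals its own opposite.
  · have h := integral_add_right_eq_self (μ := (volume : Measure (Torus d))) (phase k)
      (proj ((Real.pi / ‖latticeVec k‖ ^ 2) • latticeVec k))
    simp only [phase_add_right, phase_antipode hk, mul_neg, mul_one, integral_neg] at h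
    exact self_eq_neg.1 h.symm

theorem integral_phase_mul_conj (j k : Fin d → ℤ) :
    ∫ x : Torus d, phase j x * (starRingEnd ℂ) (phase k x) =
      if j = k then (((2 * Real.pi) ^ d : ℝ) : ℂ) else 0 := by
  simp only [← phase_neg_left, ← phase_add_left, integral_phase, ← sub_eq_add_neg, sub_eq_zero]

theorem integral_character_mul_conj (j k : Fin d → ℤ) :
    ∫ x : Torus d, character j x * (starRingEnd ℂ) (character k x) = if j = k then 1 else 0 := by
  have : ∀ x : Torus d, character j x * (starRingEnd ℂ) (character k x) =
      ((charNorm d * charNorm d : ℝ) : ℂ) * (phase j x * (starRingEnd ℂ) (phase k x)) := by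
    intro x
    simp only [character_eq, map_mul, Complex.conj_ofReal]
    push_cast; ring
  simp only [this, integral_const_mul, integral_phase_mul_conj]
  split_ifs
  · rw [← Complex.ofReal_mul, charNorm_sq]; simp
  · simp

theorem fourierCoef_phase_mul (m k : Fin d → ℤ) (c : ℂ) :
    fourierCoef (fun x => phase m x * c) k = if m = k then (charNorm d : ℂ)⁻¹ * c else 0 := by
  have h0 : (charNorm d : ℂ) ≠ 0 := by exact_mod_cast charNorm_pos.ne'
  have : ∀ x : Torus d, phase m x * c * (starRingEnd ℂ) (character k x) =
      (c * (charNorm d : ℂ)⁻¹) * (character m x * (starRingEnd ℂ) (character k x)) := by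
    intro x
    rw [character_eq m]; field_simp
  simp only [fourierCoef, this, integral_const_mul, integral_character_mul_conj]
  split_ifs <;> ring

theorem fourierCoef_mul_const (f : Torus d → ℂ) (c : ℂ) (k : Fin d → ℤ) :
    fourierCoef (fun x => f x * c) k = fourierCoef f k * c := by
  simp only [fourierCoef, mul_right_comm _ c, integral_mul_const]

theorem continuous_mul_conj_character {f : Torus d → ℂ} (hf : Continuous f) (k : Fin d → ℤ) :
    Continuous (fun x => f x * (starRingEnd ℂ) (character k x)) :=
  hf.mul (Complex.continuous_conj.comp (continuous_character k))

theorem fourierCoef_sub {f g : Torus d → ℂ} (hf : Continuous f) (hg : Continuous g)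
    (k : Fin d → ℤ) :
    fourierCoef (fun x => f x - g x) k = fourierCoef f k - fourierCoef g k := by
  simp only [fourierCoef, sub_mul]
  exact integral_sub (continuous_integrable_torus (continuous_mul_conj_character hf k))
    (continuous_integrable_torus (continuous_mul_conj_character hg k))

theorem fourierCoef_translate (f : Torus d → ℂ) (g : Torus d) (k : Fin d → ℤ) :
    fourierCoef (fun x => f (x + g)) k = phase k g * fourierCoef f k := by
  have h : ∀ x, f (x + g) * (starRingEnd ℂ) (character k x) =
      phase k g * (fun y => f y * (starRingEnd ℂ) (character k y)) (x + g) := by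
    intro x
    simp only [character_eq, phase_add_right, map_mul]
    have := phase_mul_conj k g
    linear_combination -(f (x + g) * (starRingEnd ℂ) (charNorm d : ℂ) *
      (starRingEnd ℂ) (phase k x)) * this
  simp only [fourierCoef, h, integral_const_mul]
  rw [integral_add_right_eq_self (fun y => f y * (starRingEnd ℂ) (character k y)) g]

theorem norm_fourierCoef_le {f : Torus d → ℂ} {B : ℝ} (hf : ∀ x, ‖f x‖ ≤ B) (k : Fin d → ℤ) :
    ‖fourierCoef f k‖ ≤ (charNorm d)⁻¹ * B := by
  have h := norm_integral_le_of_norm_le_const (μ := (volume : Measure (Torus d)))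
    (f := fun x => f x * (starRingEnd ℂ) (character k x)) (C := charNorm d * B)
    (Eventually.of_forall fun x => by
      rw [norm_mul, RCLike.norm_conj, character_eq, norm_mul, norm_phase, mul_one,
        Complex.norm_real, Real.norm_of_nonneg charNorm_pos.le, mul_comm]
      exact mul_le_mul_of_nonneg_left (hf x) charNorm_pos.le)
  refine h.trans (le_of_eq ?_)
  have := charNorm_sq (d := d)
  have h0 := (charNorm_pos (d := d)).ne'
  rw [volume_torus]
  field_simp
  linear_combination B * this

/-! ### Density of trigonometric polynomials and uniqueness of Fourier coefficients. -/

/-- The trigonometric polynomials, as a star subalgebra. -/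
def trigPoly (d : ℕ) : StarSubalgebra ℂ C(Torus d, ℂ) where
  toSubalgebra := Algebra.adjoin ℂ (Set.range fun k : Fin d → ℤ =>
    (⟨phase k, continuous_phase k⟩ : C(Torus d, ℂ)))
  star_mem' := by
    intro a ha
    change star a ∈ Algebra.adjoin ℂ _
    induction ha using Algebra.adjoin_induction with
    | mem x hx =>
      obtain ⟨k, rfl⟩ := hx
      refine Algebra.subset_adjoin ⟨-k, ?_⟩
      ext x
      simp [phase_neg_left]
    | algebraMap c =>
      rw [← algebraMap_star_comm]
      exact Subalgebra.algebraMap_mem _ _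
    | add x y _ _ hx hy => rw [star_add]; exact add_mem hx hy
    | mul x y _ _ hx hy => rw [star_mul]; exact mul_mem hy hx

theorem phase_separates {x y : Torus d} (h : ∀ k : Fin d → ℤ, phase k x = phase k y) : x = y := by
  funext i
  have h1 := h (Pi.single i 1)
  have h2 : ∀ z : Torus d, phase (Pi.single i 1) z = fourier 1 (z i) := by
    intro z
    unfold phase
    rw [Finset.prod_eq_single i]
    · simp
    · intro j _ hj; simp [Pi.single_eq_of_ne hj]
    · simp
  rw [h2, h2, fourier_one, fourier_one] at h1
  exact AddCircle.injective_toCircle Real.two_pi_pos.ne' (Subtype.ext h1)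

theorem trigPoly_dense : (trigPoly d).topologicalClosure = ⊤ := by
  refine ContinuousMap.starSubalgebra_topologicalClosure_eq_top_of_separatesPoints _ ?_
  intro x y hxy
  by_contra! hcon
  refine hxy (phase_separates fun k => ?_)
  exact hcon _ ⟨⟨phase k, continuous_phase k⟩, Algebra.subset_adjoin ⟨k, rfl⟩, rfl⟩

/-- The condition is linear and closed in `g`, and by Stone–Weierstrass the span of the characters
is dense. -/
theorem integral_eq_zero_of_phase {f : Torus d → ℂ} (hf : Continuous f)
    (h : ∀ k : Fin d → ℤ, ∫ x, f x * phase k x = 0) (g : C(Torus d, ℂ)) :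
    ∫ x, f x * g x = 0 := by
  have hint : ∀ g : C(Torus d, ℂ), Integrable (fun x => f x * g x) := fun g =>
    continuous_integrable_torus (hf.mul g.continuous)
  have hspan : ∀ g ∈ trigPoly d, ∫ x, f x * g x = 0 := by
    intro g hg
    have hg' : g ∈ Submodule.span ℂ (Set.range fun k : Fin d → ℤ =>
        (⟨phase k, continuous_phase k⟩ : C(Torus d, ℂ))) := by
      have h1 : g ∈ Subalgebra.toSubmodule (Algebra.adjoin ℂ (Set.range fun k : Fin d → ℤ =>
        (⟨phase k, continuous_phase k⟩ : C(Torus d, ℂ)))) := hg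
      rw [Algebra.adjoin_eq_span] at h1
      refine Submodule.span_mono ?_ h1
      intro y hy
      induction hy using Submonoid.closure_induction with
      | mem x hx => exact hx
      | one => exact ⟨0, by ext x; simp [phase_zero_left]⟩
      | mul x y _ _ hx hy =>
        obtain ⟨k, rfl⟩ := hx
        obtain ⟨l, rfl⟩ := hy
        exact ⟨k + l, by ext x; simp [phase_add_left]⟩
    clear hg
    induction hg' using Submodule.span_induction with
    | mem x hx => obtain ⟨k, rfl⟩ := hx; exact h k
    | zero => simp
    | add x y _ _ hx hy =>
      simp only [ContinuousMap.add_apply, mul_add]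
      rw [integral_add (hint x) (hint y), hx, hy, add_zero]
    | smul c x _ hx =>
      simp only [ContinuousMap.smul_apply, smul_eq_mul, mul_left_comm _ c, integral_const_mul, hx, mul_zero]
  have hcl : IsClosed {g : C(Torus d, ℂ) | ∫ x, f x * g x = 0} := by
    refine isClosed_eq ?_ continuous_const
    let L : C(Torus d, ℂ) →ₗ[ℂ] ℂ :=
      { toFun := fun g => ∫ x, f x * g x
        map_add' := fun x y => by
          simp only [ContinuousMap.add_apply, mul_add]
          exact integral_add (hint x) (hint y)
        map_smul' := fun c x => by
          simp only [ContinuousMap.smul_apply, smul_eq_mul, mul_left_comm _ c, integral_const_mul,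
            RingHom.id_apply] }
    refine (L.mkContinuous (‖(⟨f, hf⟩ : C(Torus d, ℂ))‖ *
      (volume : Measure (Torus d)).real Set.univ) fun g => ?_).continuous
    refine (norm_integral_le_of_norm_le_const (C := ‖(⟨f, hf⟩ : C(Torus d, ℂ))‖ * ‖g‖)
      (Eventually.of_forall fun x => ?_)).trans (le_of_eq (by ring))
    rw [norm_mul]
    exact mul_le_mul (ContinuousMap.norm_coe_le_norm ⟨f, hf⟩ x) (ContinuousMap.norm_coe_le_norm g x)
      (norm_nonneg _) (norm_nonneg _)
  have hg : g ∈ (trigPoly d).topologicalClosure := by rw [trigPoly_dense]; trivial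
  exact closure_minimal hspan hcl hg

theorem eq_zero_of_fourierCoef {f : Torus d → ℂ} (hf : Continuous f)
    (h : ∀ k : Fin d → ℤ, fourierCoef f k = 0) (x : Torus d) : f x = 0 := by
  have h0 : (charNorm d : ℂ) ≠ 0 := by exact_mod_cast charNorm_pos.ne'
  have h1 : ∀ k : Fin d → ℤ, ∫ x, f x * phase k x = 0 := by
    intro k
    have h2 := h (-k)
    simp only [fourierCoef, character_eq, phase_neg_left, map_mul, Complex.conj_conj,
      Complex.conj_ofReal, mul_left_comm _ (charNorm d : ℂ), integral_const_mul] at h2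
    exact (mul_eq_zero.1 h2).resolve_left h0
  -- Testing against the conjugate of `f` gives `∫ |f|² = 0`.
  have h2 := integral_eq_zero_of_phase hf h1 ⟨fun x => (starRingEnd ℂ) (f x),
    Complex.continuous_conj.comp hf⟩
  simp only [ContinuousMap.coe_mk, Complex.mul_conj, Complex.normSq_eq_norm_sq] at h2
  have h3 : ∫ x, ‖f x‖ ^ 2 = 0 := by
    have := integral_ofReal (𝕜 := ℂ) (μ := (volume : Measure (Torus d)))
      (f := fun x => ‖f x‖ ^ 2)
    refine Complex.ofReal_injective (this.symm.trans (Eq.trans ?_ h2))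
    simp
  have hc : Continuous fun x => ‖f x‖ ^ 2 := by fun_prop
  rw [integral_eq_zero_iff_of_nonneg (fun x => by positivity) (continuous_integrable_torus hc)] at h3
  have h4 := (hc.ae_eq_iff_eq volume continuous_const).1 h3
  exact norm_eq_zero.1 (pow_eq_zero_iff two_ne_zero |>.1 (congrFun h4 x))

/-- Translation by `g` multiplies the mode `k` by `phase k g`, which is `1` on the only modes
present. This is why averaging a measure over the annihilator of `Λ` does not change its integrals
against symbols. -/
theorem IsSymbol.translate_eq {Λ : Submodule ℤ (Fin d → ℤ)} {ξ₀ : Freq d} {r : ℝ}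
    {a : Torus d × Freq d × realSpan Λ → ℂ} (ha : IsSymbol Λ ξ₀ r a) {g : Torus d}
    (hg : ∀ k ∈ Λ, phase k g = 1) (x : Torus d) (ξ : Freq d) (η : realSpan Λ) :
    a (x + g, ξ, η) = a (x, ξ, η) := by
  have hc := ha.continuous_slice ξ η
  have hc' : Continuous fun x => a (x + g, ξ, η) := hc.comp (continuous_add_const g)
  have h := eq_zero_of_fourierCoef (f := fun x => a (x + g, ξ, η) - a (x, ξ, η)) (hc'.sub hc) (fun k => by
    rw [fourierCoef_sub hc' hc, fourierCoef_translate (fun x => a (x, ξ, η))]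
    by_cases hk : k ∈ Λ
    · rw [hg k hk, one_mul, sub_self]
    · rw [ha.modes k hk ξ η, mul_zero, sub_self]) x
  exact sub_eq_zero.1 h

/-- A mode outside a primitive module is detected by a direction orthogonal to the module. -/
theorem IsPrimitive.exists_orthogonal_phase_ne_one {Λ : Submodule ℤ (Fin d → ℤ)}
    (hΛ : IsPrimitive Λ) {k : Fin d → ℤ} (hk : k ∉ Λ) :
    ∃ v : Freq d, IsOrthogonalTo Λ v ∧ phase k (proj v) = -1 := by
  have hk' : latticeVec k ∉ realSpan Λ := fun h => hk ((hΛ k).1 h)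
  -- The component of `k` orthogonal to `⟨Λ⟩`; it is nonzero because `Λ` is primitive.
  set w : Freq d := latticeVec k - (realSpan Λ).starProjection (latticeVec k) with hw
  have hperp : ∀ y ∈ realSpan Λ, inner ℝ y w = 0 := by
    intro y hy
    rw [real_inner_comm]
    exact Submodule.starProjection_inner_eq_zero _ y hy
  have hw0 : w ≠ 0 := by
    intro h
    apply hk'
    rw [sub_eq_zero.1 (hw.symm.trans h)]
    exact Submodule.starProjection_apply_mem _ _
  have hkw : inner ℝ (latticeVec k) w = ‖w‖ ^ 2 := by
    have : latticeVec k = w + (realSpan Λ).starProjection (latticeVec k) := by rw [hw]; abel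
    rw [this, inner_add_left, hperp _ (Submodule.starProjection_apply_mem _ _), add_zero,
      real_inner_self_eq_norm_sq]
  have hn : ‖w‖ ≠ 0 := norm_ne_zero_iff.2 hw0
  refine ⟨(Real.pi / ‖w‖ ^ 2) • w, fun l hl => ?_, ?_⟩
  · rw [real_inner_smul_right, hperp _ (Submodule.subset_span ⟨l, hl, rfl⟩), mul_zero]
  · rw [phase_proj, real_inner_smul_right, hkw, div_mul_cancel₀ _ (by positivity), mul_comm,
      Complex.exp_pi_mul_I]

/-- Bessel's inequality for the characters of the torus. -/
theorem sum_norm_fourierCoef_sq_le (u : Lp ℂ 2 (volume : Measure (Torus d)))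
    (S : Finset (Fin d → ℤ)) : ∑ k ∈ S, ‖fourierCoef u k‖ ^ 2 ≤ ‖u‖ ^ 2 := by
  have hmem : ∀ k : Fin d → ℤ, MemLp (character k : Torus d → ℂ) 2 volume := fun k =>
    (continuous_character k).memLp_of_hasCompactSupport (HasCompactSupport.of_compactSpace _)
  let e : (Fin d → ℤ) → Lp ℂ 2 (volume : Measure (Torus d)) := fun k => (hmem k).toLp _
  have hinner : ∀ (k : Fin d → ℤ) (v : Lp ℂ 2 (volume : Measure (Torus d))),
      inner ℂ (e k) v = fourierCoef v k := by
    intro k v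
    rw [L2.inner_def]
    refine integral_congr_ae ?_
    filter_upwards [(hmem k).coeFn_toLp] with x hx
    simp only [e, hx, RCLike.inner_apply]
  have he : Orthonormal ℂ e := by
    rw [orthonormal_iff_ite]
    intro i j
    rw [hinner, fourierCoef]
    have : ∫ x, (e j : Torus d → ℂ) x * (starRingEnd ℂ) (character i x) =
        ∫ x, character j x * (starRingEnd ℂ) (character i x) := by
      refine integral_congr_ae ?_
      filter_upwards [(hmem j).coeFn_toLp] with x hx
      simp only [e, hx]
    rw [this, integral_character_mul_conj]
    simp only [eq_comm]
  simpa only [hinner] using he.sum_inner_products_le u (s := S)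

end

section


variable {d : ℕ} {Λ : Submodule ℤ (Fin d → ℤ)} {ξ₀ : Freq d} {r : ℝ}
  {a : Torus d × Freq d × realSpan Λ → ℂ}

/-! ### Bounds on the derivatives of a symbol -/

/-- `a` vanishes for `|ξ - ξ₀| > r'` and is homogeneous of degree `0` for `|η| > R₀`. -/
structure HasExtent (ξ₀ : Freq d) (a : Torus d × Freq d × realSpan Λ → ℂ) (r' R₀ : ℝ) : Prop where
  eq_zero : ∀ x ξ η, r' < dist ξ ξ₀ → a (x, ξ, η) = 0
  homogeneous : ∀ x ξ η (s : ℝ), R₀ < ‖η‖ → R₀ < s * ‖η‖ → a (x, ξ, s • η) = a (x, ξ, η)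

theorem HasExtent.mono {r' R₀ r'' R₁ : ℝ} (h : HasExtent ξ₀ a r' R₀) (hr : r' ≤ r'')
    (hR : R₀ ≤ R₁) : HasExtent ξ₀ a r'' R₁ :=
  ⟨fun x ξ η hξ => h.eq_zero x ξ η (hr.trans_lt hξ),
    fun x ξ η s h1 h2 => h.homogeneous x ξ η s (hR.trans_lt h1) (hR.trans_lt h2)⟩

/-- Compactness of the support leaves a margin `r - r'`, used later to treat frequencies near the
boundary of the ball. -/
theorem IsSymbol.exists_hasExtent (ha : IsSymbol Λ ξ₀ r a) :
    ∃ r' < r, ∃ R₀ > 0, HasExtent ξ₀ a r' R₀ := by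
  obtain ⟨K, hK, hKr, hKa⟩ := ha.compactSupport
  obtain ⟨R₀, hR₀, ahom, hhom⟩ := ha.homogeneous
  obtain ⟨r', hr', hKr'⟩ : ∃ r' < r, K ⊆ Metric.closedBall ξ₀ r' := by
    rcases K.eq_empty_or_nonempty with rfl | hne
    · exact ⟨r - 1, by linarith, Set.empty_subset _⟩
    · obtain ⟨y, hy, hmax⟩ := hK.exists_isMaxOn hne
        (continuous_id.dist continuous_const : Continuous fun ξ => dist ξ ξ₀).continuousOn
      exact ⟨dist y ξ₀, hKr hy, fun z hz => hmax hz⟩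
  refine ⟨r', hr', R₀, hR₀, fun x ξ η hξ => hKa x ξ η fun h => ?_, fun x ξ η s h1 h2 => ?_⟩
  · exact absurd (hKr' h) (by simpa using hξ)
  · have hη : 0 < ‖η‖ := hR₀.trans h1
    have hs : 0 < s := pos_of_mul_pos_left (hR₀.trans h2) hη.le
    have h3 : ‖s • η‖ = s * ‖η‖ := by rw [norm_smul, Real.norm_of_nonneg hs.le]
    rw [hhom x ξ η h1, hhom x ξ (s • η) (by rw [h3]; exact h2), h3, smul_smul]
    congr 4
    field_simp

theorem symbolLift_add_period (a : Torus d × Freq d × realSpan Λ → ℂ) (k : Fin d → ℤ)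
    (p : Freq d × Freq d × realSpan Λ) :
    symbolLift a (p + ((2 * Real.pi) • latticeVec k, 0, 0)) = symbolLift a p := by
  have : proj ((2 * Real.pi) • latticeVec k) = 0 := by
    funext i
    simp only [proj, latticeVec, PiLp.smul_apply, smul_eq_mul, Pi.zero_apply]
    rw [mul_comm (2 * Real.pi), ← zsmul_eq_mul, AddCircle.coe_zsmul, AddCircle.coe_period, smul_zero]
  simp [symbolLift, proj_add, this]

/-- The fundamental cube `[0, 2π]^d`. -/
def cube (d : ℕ) : Set (Freq d) := WithLp.ofLp ⁻¹' Set.pi Set.univ fun _ => Set.Icc 0 (2 * Real.pi)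

theorem isCompact_cube : IsCompact (cube d) :=
  (EuclideanSpace.equiv (Fin d) ℝ).toHomeomorph.isCompact_preimage.2
    (isCompact_univ_pi fun _ => isCompact_Icc)

theorem exists_add_period_mem_cube (x : Freq d) :
    ∃ k : Fin d → ℤ, x + (2 * Real.pi) • latticeVec k ∈ cube d := by
  refine ⟨fun i => -⌊x i / (2 * Real.pi)⌋, fun i _ => ?_⟩
  have h1 := Int.floor_le (x i / (2 * Real.pi))
  have h2 := (Int.lt_floor_add_one (x i / (2 * Real.pi))).le
  rw [le_div_iff₀ Real.two_pi_pos] at h1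
  rw [div_le_iff₀ Real.two_pi_pos] at h2
  simp only [latticeVec, PiLp.add_apply, PiLp.smul_apply, smul_eq_mul, Set.mem_Icc, Int.cast_neg]
  constructor <;> nlinarith

/-- A compact set on which the derivatives of a symbol take their extreme values. -/
def coreBox (Λ : Submodule ℤ (Fin d → ℤ)) (ξ₀ : Freq d) (r' R : ℝ) :
    Set (Freq d × Freq d × realSpan Λ) :=
  cube d ×ˢ Metric.closedBall ξ₀ r' ×ˢ Metric.closedBall 0 R

theorem isCompact_coreBox (r' R : ℝ) : IsCompact (coreBox Λ ξ₀ r' R) :=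
  isCompact_cube.prod ((isCompact_closedBall _ _).prod (isCompact_closedBall _ _))

/-- Periodicity brings `x` into the cube, the support condition bounds `ξ`, and homogeneity of
degree `0` brings a large `η` back to radius `R₀ + 1` by a contraction. The chain rule for a
contraction can only make the derivatives at the original point smaller. -/
theorem exists_core_point (ha : ContDiff ℝ ∞ (symbolLift a)) {r' R₀ : ℝ} (hR₀ : 0 < R₀)
    (he : HasExtent ξ₀ a r' R₀) (n : ℕ) (p : Freq d × Freq d × realSpan Λ) :
    iteratedFDeriv ℝ n (symbolLift a) p = 0 ∨ ∃ p' ∈ coreBox Λ ξ₀ r' (R₀ + 1),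
      ‖iteratedFDeriv ℝ n (symbolLift a) p‖ ≤ ‖iteratedFDeriv ℝ n (symbolLift a) p'‖ := by
  obtain ⟨x, ξ, η⟩ := p
  by_cases hξ : r' < dist ξ ξ₀
  · left
    have h1 : symbolLift a =ᶠ[𝓝 (x, ξ, η)] fun _ => 0 := by
      have : ∀ᶠ q : Freq d × Freq d × realSpan Λ in 𝓝 (x, ξ, η), r' < dist q.2.1 ξ₀ :=
        (isOpen_lt continuous_const (by fun_prop)).mem_nhds hξ
      filter_upwards [this] with q hq
      exact he.eq_zero _ _ _ hq
    rw [(Filter.EventuallyEq.iteratedFDeriv ℝ h1 n).eq_of_nhds]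
    rcases n with _ | n
    · ext; simp
    · rw [iteratedFDeriv_const_of_ne (by simp)]; rfl
  right
  have hξ' : ξ ∈ Metric.closedBall ξ₀ r' := not_lt.1 hξ
  have key : ∀ η' : realSpan Λ, ‖η'‖ ≤ R₀ + 1 → ∃ p' ∈ coreBox Λ ξ₀ r' (R₀ + 1),
      ‖iteratedFDeriv ℝ n (symbolLift a) (x, ξ, η')‖ ≤ ‖iteratedFDeriv ℝ n (symbolLift a) p'‖ := by
    intro η' hη'
    obtain ⟨k, hk⟩ := exists_add_period_mem_cube x
    refine ⟨(x, ξ, η') + ((2 * Real.pi) • latticeVec k, 0, 0), ⟨hk, ?_, ?_⟩, ?_⟩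
    · simpa using hξ'
    · simpa using hη'
    · rw [← iteratedFDeriv_comp_add_right]
      simp only [symbolLift_add_period]
      rfl
  by_cases hη : ‖η‖ ≤ R₀ + 1
  · exact key η hη
  push Not at hη
  have hη0 : 0 < ‖η‖ := by linarith
  -- Radius `R₀ + 1` rather than `R₀`: homogeneity must hold in a neighbourhood of the contracted
  -- point.
  set s : ℝ := (R₀ + 1) / ‖η‖ with hs
  have hs0 : 0 < s := by positivity
  have hs1 : s ≤ 1 := (div_le_one hη0).2 hη.le
  have hsη : s * ‖η‖ = R₀ + 1 := div_mul_cancel₀ _ hη0.ne'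
  let Ls : (Freq d × Freq d × realSpan Λ) →L[ℝ] (Freq d × Freq d × realSpan Λ) :=
    (ContinuousLinearMap.id ℝ _).prodMap
      ((ContinuousLinearMap.id ℝ _).prodMap (s • ContinuousLinearMap.id ℝ _))
  have hLs : ‖Ls‖ ≤ 1 := by
    refine ContinuousLinearMap.opNorm_le_bound _ zero_le_one fun q => ?_
    have : ‖s • q.2.2‖ ≤ ‖q.2.2‖ := by
      rw [norm_smul, Real.norm_of_nonneg hs0.le]
      exact mul_le_of_le_one_left (norm_nonneg _) hs1
    simp only [Ls, one_mul, Prod.norm_def]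
    exact max_le_max le_rfl (max_le_max le_rfl this)
  have h1 : symbolLift a =ᶠ[𝓝 (x, ξ, η)] symbolLift a ∘ Ls := by
    have t1 : ∀ᶠ q : Freq d × Freq d × realSpan Λ in 𝓝 (x, ξ, η), R₀ < ‖q.2.2‖ :=
      (isOpen_lt continuous_const (by fun_prop)).mem_nhds (show R₀ < ‖η‖ by linarith)
    have t2 : ∀ᶠ q : Freq d × Freq d × realSpan Λ in 𝓝 (x, ξ, η), R₀ < s * ‖q.2.2‖ :=
      (isOpen_lt continuous_const (by fun_prop)).mem_nhds (show R₀ < s * ‖η‖ by linarith)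
    filter_upwards [t1, t2] with q hq1 hq2
    exact (he.homogeneous _ _ _ s hq1 hq2).symm
  obtain ⟨p', hp', hle⟩ := key (s • η) (by
    rw [norm_smul, Real.norm_of_nonneg hs0.le, hsη])
  refine ⟨p', hp', le_trans ?_ hle⟩
  rw [(Filter.EventuallyEq.iteratedFDeriv ℝ h1 n).eq_of_nhds,
    ContinuousLinearMap.iteratedFDeriv_comp_right Ls ha _ (i := n) (mod_cast le_top)]
  refine (ContinuousMultilinearMap.norm_compContinuousLinearMap_le _ _).trans ?_
  refine mul_le_of_le_one_right (ContinuousMultilinearMap.opNorm_nonneg _) ?_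
  simp only [Finset.prod_const, Finset.card_univ, Fintype.card_fin]
  exact pow_le_one₀ (ContinuousLinearMap.opNorm_nonneg _) hLs

theorem IsSymbol.exists_iteratedFDeriv_bound (ha : IsSymbol Λ ξ₀ r a) (n : ℕ) :
    ∃ B : ℝ, 0 ≤ B ∧ ∀ p, ‖iteratedFDeriv ℝ n (symbolLift a) p‖ ≤ B := by
  obtain ⟨r', -, R₀, hR₀, he⟩ := ha.exists_hasExtent
  have hc : Continuous (iteratedFDeriv ℝ n (symbolLift a)) :=
    ha.smooth.continuous_iteratedFDeriv (mod_cast le_top)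
  obtain ⟨B, hB⟩ := (isCompact_coreBox (Λ := Λ) (ξ₀ := ξ₀) r' (R₀ + 1)).exists_bound_of_continuousOn
    ((continuous_norm (E := (Freq d × Freq d × realSpan Λ) [×n]→L[ℝ] ℂ)).comp hc).continuousOn
  simp only [Function.comp_apply, norm_norm] at hB
  refine ⟨max B 0, le_max_right _ _, fun p => ?_⟩
  rcases exists_core_point ha.smooth hR₀ he n p with h | ⟨p', hp', h⟩
  · rw [h]
    exact (norm_zero (E := (Freq d × Freq d × realSpan Λ) [×n]→L[ℝ] ℂ)).trans_le (le_max_right _ _)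
  · exact h.trans ((hB p' hp').trans (le_max_left _ _))

theorem IsSymbol.exists_bound (ha : IsSymbol Λ ξ₀ r a) : ∃ B : ℝ, 0 ≤ B ∧ ∀ p, ‖a p‖ ≤ B := by
  obtain ⟨B, hB0, hB⟩ := ha.exists_iteratedFDeriv_bound 0
  refine ⟨B, hB0, fun ⟨x, ξ, η⟩ => ?_⟩
  obtain ⟨y, rfl⟩ := isOpenQuotientMap_proj.surjective x
  have := hB (y, ξ, η)
  rwa [norm_iteratedFDeriv_zero] at this

/-! ### Finite differences and decay of the Fourier coefficients -/

/-- The finite difference of `f` with increment `v`. -/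
def fdiff {E F : Type*} [Add E] [Sub F] (v : E) (f : E → F) : E → F := fun p => f (p + v) - f p

theorem contDiff_foldr_fdiff {E F : Type} [NormedAddCommGroup E] [NormedSpace ℝ E]
    [NormedAddCommGroup F] [NormedSpace ℝ F] {f : E → F} (hf : ContDiff ℝ ∞ f) (l : List E) :
    ContDiff ℝ ∞ (l.foldr fdiff f) := by
  induction l with
  | nil => exact hf
  | cons v l ih =>
    have h2 : ContDiff ℝ ∞ fun p : E => p + v := contDiff_id.add contDiff_const
    exact (ih.comp h2).sub ih

theorem fderiv_foldr_fdiff {E F : Type} [NormedAddCommGroup E] [NormedSpace ℝ E]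
    [NormedAddCommGroup F] [NormedSpace ℝ F] {f : E → F} (hf : ContDiff ℝ ∞ f) (l : List E) :
    fderiv ℝ (l.foldr fdiff f) = l.foldr fdiff (fderiv ℝ f) := by
  induction l with
  | nil => rfl
  | cons v l ih =>
    have hd : Differentiable ℝ (l.foldr fdiff f) :=
      (contDiff_foldr_fdiff hf l).differentiable (by simp)
    funext p
    have h1 : DifferentiableAt ℝ (fun q => l.foldr fdiff f (q + v)) p :=
      DifferentiableAt.comp p hd.differentiableAt (by fun_prop)
    simp only [List.foldr_cons]
    change fderiv ℝ (fun q => l.foldr fdiff f (q + v) - l.foldr fdiff f q) p =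
      l.foldr fdiff (fderiv ℝ f) (p + v) - l.foldr fdiff (fderiv ℝ f) p
    rw [fderiv_fun_sub h1 hd.differentiableAt, fderiv_comp_add_right, ih]

/-- Each difference costs one derivative by the mean value inequality. The induction passes from `f`
to its derivative, so the target space has to be quantified inside. -/
theorem norm_foldr_fdiff_le {E : Type} [NormedAddCommGroup E] [NormedSpace ℝ E] (l : List E) :
    ∀ {F : Type} [NormedAddCommGroup F] [NormedSpace ℝ F] {f : E → F}, ContDiff ℝ ∞ f →
      ∀ {B : ℝ}, (∀ p, ‖iteratedFDeriv ℝ l.length f p‖ ≤ B) →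
      ∀ p, ‖l.foldr fdiff f p‖ ≤ B * (l.map norm).prod := by
  induction l with
  | nil =>
    intro F _ _ f hf B hB p
    simpa using hB p
  | cons v l ih =>
    intro F _ _ f hf B hB p
    have hf' : ContDiff ℝ ∞ (fderiv ℝ f) := hf.fderiv_right (by simp)
    have h1 : ∀ q, ‖fderiv ℝ (l.foldr fdiff f) q‖ ≤ B * (l.map norm).prod := by
      rw [fderiv_foldr_fdiff hf]
      exact ih hf' fun q => by
        rw [norm_iteratedFDeriv_fderiv]; exact hB q
    have hd : Differentiable ℝ (l.foldr fdiff f) :=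
      (contDiff_foldr_fdiff hf l).differentiable (by simp)
    have h2 := convex_univ.norm_image_sub_le_of_norm_fderiv_le
      (fun q _ => hd.differentiableAt) (fun q _ => h1 q) (Set.mem_univ p) (Set.mem_univ (p + v))
    simp only [List.foldr_cons, List.map_cons, List.prod_cons, fdiff]
    refine h2.trans (le_of_eq ?_)
    rw [add_sub_cancel_left]; ring

theorem fourierCoef_fdiff_iterate {f : Torus d → ℂ} (hf : Continuous f) (g : Torus d)
    (k : Fin d → ℤ) (N : ℕ) : Continuous ((fdiff g)^[N] f) ∧
      fourierCoef ((fdiff g)^[N] f) k = (phase k g - 1) ^ N * fourierCoef f k := by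
  induction N with
  | zero => exact ⟨hf, by simp⟩
  | succ N ih =>
    rw [Function.iterate_succ_apply']
    have hc : Continuous fun x => (fdiff g)^[N] f (x + g) := ih.1.comp (continuous_add_const g)
    refine ⟨hc.sub ih.1, ?_⟩
    unfold fdiff at *
    rw [fourierCoef_sub hc ih.1, fourierCoef_translate (((fun f p => f (p + g) - f p)^[N] f)), ih.2]
    ring

/-- A substitute for integration by parts: a difference by the half-period of the mode `k`
multiplies its coefficient by `-2`, while the increment has length `π/|k|`, so `N` differences of a
smooth function give decay of order `N`. -/
theorem norm_fourierCoef_le_of_fdiff {f : Torus d → ℂ} (hf : Continuous f) {k : Fin d → ℤ}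
    (hk : k ≠ 0) (N : ℕ) {B : ℝ}
    (hB : ∀ x, ‖(fdiff (proj ((Real.pi / ‖latticeVec k‖ ^ 2) • latticeVec k)))^[N] f x‖ ≤ B) :
    ‖fourierCoef f k‖ ≤ (charNorm d)⁻¹ * B := by
  have h1 := (fourierCoef_fdiff_iterate hf
    (proj ((Real.pi / ‖latticeVec k‖ ^ 2) • latticeVec k)) k N).2
  have h2 := norm_fourierCoef_le hB k
  rw [h1, phase_antipode hk, norm_mul, norm_pow] at h2
  have h3 : (1 : ℝ) ≤ ‖(-1 - 1 : ℂ)‖ ^ N := one_le_pow₀ (by norm_num)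
  exact (le_mul_of_one_le_left (norm_nonneg _) h3).trans h2

theorem symbolLift_fdiff (v : Freq d) (N : ℕ) (y ξ : Freq d) (η : realSpan Λ) :
    (List.replicate N ((v, 0, 0) : Freq d × Freq d × realSpan Λ)).foldr fdiff (symbolLift a)
      (y, ξ, η) = (fdiff (proj v))^[N] (fun x => a (x, ξ, η)) (proj y) := by
  induction N generalizing y with
  | zero => rfl
  | succ N ih =>
    rw [Function.iterate_succ_apply', List.replicate_succ, List.foldr_cons]
    simp only [fdiff] at ih ⊢
    simp only [Prod.mk_add_mk, add_zero, ih, proj_add]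

theorem foldr_fdiff_sub {E : Type} [NormedAddCommGroup E] (f g : E → ℂ) (l : List E) (p : E) :
    l.foldr fdiff (fun q => f q - g q) p = l.foldr fdiff f p - l.foldr fdiff g p := by
  induction l generalizing p with
  | nil => rfl
  | cons v l ih => simp only [List.foldr_cons, fdiff] at ih ⊢; rw [ih, ih]; ring

theorem fdiff_iterate_sub (f₁ f₂ : Torus d → ℂ) (g : Torus d) (N : ℕ) (x : Torus d) :
    (fdiff g)^[N] (fun x => f₁ x - f₂ x) x = (fdiff g)^[N] f₁ x - (fdiff g)^[N] f₂ x := by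
  induction N generalizing x with
  | zero => rfl
  | succ N ih =>
    simp only [Function.iterate_succ_apply']
    simp only [fdiff] at ih ⊢
    rw [ih, ih]; ring

theorem foldr_fdiff_comp_add {E : Type} [NormedAddCommGroup E] (f : E → ℂ) (w : E) (l : List E)
    (p : E) : l.foldr fdiff (fun q => f (q + w)) p = l.foldr fdiff f (p + w) := by
  induction l generalizing p with
  | nil => rfl
  | cons v l ih => simp only [List.foldr_cons, fdiff] at ih ⊢; rw [ih, ih, add_right_comm]

/-! ### Summable weights for the Fourier coefficients of a symbol. -/

theorem latticeVec_mem_span (k : Fin d → ℤ) : latticeVec k ∈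
    Submodule.span ℤ (Set.range (EuclideanSpace.basisFun (Fin d) ℝ).toBasis) := by
  have : latticeVec k = ∑ i, k i • (EuclideanSpace.basisFun (Fin d) ℝ).toBasis i := by
    ext j
    simp [latticeVec, Finset.sum_apply, Pi.single_apply]
  rw [this]
  exact Submodule.sum_mem _ fun i _ => Submodule.smul_mem _ _ (Submodule.subset_span ⟨i, rfl⟩)

/-- The exponent `d + 1` exceeds the rank `d` of the lattice. -/
theorem summable_pow_of_mem_lattice (L : Submodule ℤ (Freq d)) [DiscreteTopology L]
    [IsZLattice ℝ L] (hL : ∀ k : Fin d → ℤ, latticeVec k ∈ L) :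
    Summable fun k : Fin d → ℤ => (‖latticeVec k‖⁻¹) ^ (d + 1) := by
  have hrank : Module.finrank ℤ L < d + 1 := by
    rw [ZLattice.rank ℝ L, finrank_euclideanSpace_fin]
    exact Nat.lt_succ_self d
  have h := ZLattice.summable_norm_pow_inv L (d + 1) hrank
  have hinj : Function.Injective fun k : Fin d → ℤ => (⟨latticeVec k, hL k⟩ : L) :=
    fun k l hkl => latticeVec_injective (congrArg Subtype.val hkl)
  refine (h.comp_injective hinj).congr fun k => ?_
  simp

theorem summable_latticeVec_pow : Summable fun k : Fin d → ℤ => (‖latticeVec k‖⁻¹) ^ (d + 1) :=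
  summable_pow_of_mem_lattice _ latticeVec_mem_span

/-- One summable weight controls both the coefficients and their Lipschitz constants in `(ξ, η)`, as
needed for Schur's test. Summability takes `d + 1` differences in `x`; the Lipschitz bound takes one
more in `(ξ, η)`. -/
theorem IsSymbol.exists_weight (ha : IsSymbol Λ ξ₀ r a) :
    ∃ w : (Fin d → ℤ) → ℝ, Summable w ∧ (∀ k, 0 ≤ w k) ∧ (∀ k ∉ Λ, w k = 0) ∧
      (∀ k ξ η, ‖fourierCoef (fun x => a (x, ξ, η)) k‖ ≤ w k) ∧
      ∀ k ξ η ξ' η', ‖fourierCoef (fun x => a (x, ξ, η)) k - fourierCoef (fun x => a (x, ξ', η')) k‖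
        ≤ w k * (‖ξ - ξ'‖ + ‖η - η'‖) := by
  classical
  obtain ⟨B0, hB00, hB0⟩ := ha.exists_iteratedFDeriv_bound 0
  obtain ⟨B1, hB10, hB1⟩ := ha.exists_iteratedFDeriv_bound 1
  obtain ⟨B2, hB20, hB2⟩ := ha.exists_iteratedFDeriv_bound (d + 1)
  obtain ⟨B3, hB30, hB3⟩ := ha.exists_iteratedFDeriv_bound (d + 2)
  set cN : ℝ := (charNorm d)⁻¹
  have hcN : 0 < cN := inv_pos.2 charNorm_pos
  set D : ℝ := cN * ((B0 + B1) + (B2 + B3) * Real.pi ^ (d + 1))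
  have hD : 0 ≤ D := by positivity
  -- a general bound for a smooth function
  have hlist : ∀ k : Fin d → ℤ, k ≠ 0 →
      ‖(Real.pi / ‖latticeVec k‖ ^ 2) • latticeVec k‖ = Real.pi * ‖latticeVec k‖⁻¹ := by
    intro k hk
    have h0 : latticeVec k ≠ 0 := fun h => hk (latticeVec_injective (h.trans latticeVec_zero.symm))
    have h1 : ‖latticeVec k‖ ≠ 0 := norm_ne_zero_iff.2 h0
    rw [norm_smul, Real.norm_of_nonneg (by positivity)]
    field_simp
  have hprod : ∀ (v : Freq d) (N : ℕ), ((List.replicate N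
      ((v, 0, 0) : Freq d × Freq d × realSpan Λ)).map norm).prod = ‖v‖ ^ N := by
    intro v N
    simp [Prod.norm_def]
  have hsz : ∀ ξ ξ' : Freq d, ∀ η η' : realSpan Λ,
      ‖((0, ξ - ξ', η - η') : Freq d × Freq d × realSpan Λ)‖ ≤ ‖ξ - ξ'‖ + ‖η - η'‖ := by
    intro ξ ξ' η η'
    simp only [Prod.norm_def, norm_zero]
    have := norm_nonneg (ξ - ξ'); have := norm_nonneg (η - η')
    refine max_le (by positivity) (max_le ?_ ?_) <;> linarith
  -- The mode `0` needs its own term, since `‖latticeVec 0‖⁻¹` is `0`.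
  let w : (Fin d → ℤ) → ℝ := fun k =>
    if k ∈ Λ then D * ((if k = 0 then 1 else 0) + (‖latticeVec k‖⁻¹) ^ (d + 1)) else 0
  have hw0 : ∀ k, 0 ≤ w k := by
    intro k
    simp only [w]
    split_ifs <;> positivity
  refine ⟨w, ?_, hw0, fun k hk => by simp [w, hk], ?_, ?_⟩
  · have h1 : Summable fun k : Fin d → ℤ =>
        D * ((if k = 0 then (1 : ℝ) else 0) + (‖latticeVec k‖⁻¹) ^ (d + 1)) := by
      refine Summable.mul_left _ (Summable.add ?_ summable_latticeVec_pow)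
      exact (hasSum_ite_eq 0 1).summable
    refine Summable.of_nonneg_of_le hw0 (fun k => ?_) h1
    simp only [w]
    split_ifs <;> first | exact le_rfl | positivity
  · intro k ξ η
    by_cases hkΛ : k ∈ Λ
    swap
    · rw [ha.modes k hkΛ ξ η, norm_zero]; exact hw0 k
    simp only [w, if_pos hkΛ]
    by_cases hk : k = 0
    · have h1 := norm_fourierCoef_le (f := fun x => a (x, ξ, η)) (B := B0) (fun x => by
        obtain ⟨y, rfl⟩ := isOpenQuotientMap_proj.surjective x
        have := hB0 (y, ξ, η)
        rwa [norm_iteratedFDeriv_zero] at this) k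
      refine h1.trans ?_
      have h2 : cN * B0 ≤ D := mul_le_mul_of_nonneg_left (by
        have : 0 ≤ (B2 + B3) * Real.pi ^ (d + 1) := by positivity
        linarith) hcN.le
      have h3 : (0 : ℝ) ≤ (‖latticeVec k‖⁻¹) ^ (d + 1) := by positivity
      rw [if_pos hk]
      nlinarith
    · rw [if_neg hk, zero_add]
      have h1 := norm_fourierCoef_le_of_fdiff (ha.continuous_slice ξ η) hk (d + 1)
        (B := B2 * (Real.pi * ‖latticeVec k‖⁻¹) ^ (d + 1)) (fun x => by
        obtain ⟨y, rfl⟩ := isOpenQuotientMap_proj.surjective x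
        rw [← symbolLift_fdiff]
        refine (norm_foldr_fdiff_le _ ha.smooth (B := B2) (fun p => ?_) _).trans (le_of_eq ?_)
        · rw [List.length_replicate]; exact hB2 p
        · rw [hprod, hlist k hk])
      refine h1.trans ?_
      rw [mul_pow]
      have h3 : (0 : ℝ) ≤ (‖latticeVec k‖⁻¹) ^ (d + 1) := by positivity
      have h2 : cN * (B2 * Real.pi ^ (d + 1)) ≤ D := mul_le_mul_of_nonneg_left (by
        have : 0 ≤ B3 * Real.pi ^ (d + 1) := by positivity
        nlinarith) hcN.le
      calc cN * (B2 * (Real.pi ^ (d + 1) * ‖latticeVec k‖⁻¹ ^ (d + 1)))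
          = cN * (B2 * Real.pi ^ (d + 1)) * ‖latticeVec k‖⁻¹ ^ (d + 1) := by ring
        _ ≤ _ := mul_le_mul_of_nonneg_right h2 h3
  · intro k ξ η ξ' η'
    by_cases hkΛ : k ∈ Λ
    swap
    · rw [ha.modes k hkΛ ξ η, ha.modes k hkΛ ξ' η', sub_zero, norm_zero]
      exact mul_nonneg (hw0 k) (by positivity)
    simp only [w, if_pos hkΛ]
    rw [← fourierCoef_sub (ha.continuous_slice ξ η) (ha.continuous_slice ξ' η')]
    set δ : ℝ := ‖ξ - ξ'‖ + ‖η - η'‖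
    have hδ : 0 ≤ δ := by positivity
    set W : Freq d × Freq d × realSpan Λ := (0, ξ - ξ', η - η') with hW
    have hshift : ∀ y : Freq d, (y, ξ, η) = (y, ξ', η') + W := by
      intro y; simp [hW]
    by_cases hk : k = 0
    · have h1 := norm_fourierCoef_le (f := fun x => a (x, ξ, η) - a (x, ξ', η')) (B := B1 * δ)
        (fun x => by
        obtain ⟨y, rfl⟩ := isOpenQuotientMap_proj.surjective x
        have := norm_foldr_fdiff_le [W] ha.smooth (B := B1) hB1 (y, ξ', η')
        simp only [List.foldr_cons, List.foldr_nil, fdiff, ← hshift, List.map_cons, List.map_nil,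
          List.prod_cons, List.prod_nil, mul_one] at this
        exact this.trans (mul_le_mul_of_nonneg_left (hsz _ _ _ _) hB10)) k
      refine h1.trans ?_
      have h2 : cN * B1 ≤ D := mul_le_mul_of_nonneg_left (by
        have : 0 ≤ (B2 + B3) * Real.pi ^ (d + 1) := by positivity
        linarith) hcN.le
      have h3 : (0 : ℝ) ≤ (‖latticeVec k‖⁻¹) ^ (d + 1) := by positivity
      rw [if_pos hk, ← mul_assoc]
      exact mul_le_mul_of_nonneg_right (by nlinarith) hδ
    · rw [if_neg hk, zero_add]
      have h1 := norm_fourierCoef_le_of_fdiff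
        ((ha.continuous_slice ξ η).sub (ha.continuous_slice ξ' η')) hk (d + 1)
        (B := B3 * ((Real.pi * ‖latticeVec k‖⁻¹) ^ (d + 1) * δ)) (fun x => by
        obtain ⟨y, rfl⟩ := isOpenQuotientMap_proj.surjective x
        set v : Freq d := (Real.pi / ‖latticeVec k‖ ^ 2) • latticeVec k with hv
        -- The innermost difference is the one in `(ξ, η)`; the `d + 1` others are in `x`.
        have h4 := norm_foldr_fdiff_le (List.replicate (d + 1) (v, 0, 0) ++ [W]) ha.smooth (B := B3)
          (fun p => by
            rw [show (List.replicate (d + 1) ((v, 0, 0) : Freq d × Freq d × realSpan Λ) ++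
              [W]).length = d + 2 by simp]
            exact hB3 p) (y, ξ', η')
        rw [List.foldr_append, List.map_append, List.prod_append, hprod, hv, hlist k hk] at h4
        have h5 : (List.replicate (d + 1) ((v, 0, 0) : Freq d × Freq d × realSpan Λ)).foldr fdiff
            ([W].foldr fdiff (symbolLift a)) (y, ξ', η') =
            (fdiff (proj v))^[d + 1] (fun x => a (x, ξ, η) - a (x, ξ', η')) (proj y) := by
          rw [fdiff_iterate_sub, ← symbolLift_fdiff, ← symbolLift_fdiff]
          have : [W].foldr fdiff (symbolLift a) =
            fun q => (fun q => symbolLift a (q + W)) q - symbolLift a q := rfl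
          rw [this, foldr_fdiff_sub, foldr_fdiff_comp_add, ← hshift]
        rw [h5] at h4
        refine h4.trans ?_
        simp only [List.map_cons, List.map_nil, List.prod_cons, List.prod_nil, mul_one]
        gcongr
        exact hsz _ _ _ _)
      refine h1.trans ?_
      have h3 : (0 : ℝ) ≤ (‖latticeVec k‖⁻¹) ^ (d + 1) := by positivity
      have h2 : cN * (B3 * Real.pi ^ (d + 1)) ≤ D := mul_le_mul_of_nonneg_left (by
        have : 0 ≤ B2 * Real.pi ^ (d + 1) := by positivity
        nlinarith) hcN.le
      calc cN * (B3 * ((Real.pi * ‖latticeVec k‖⁻¹) ^ (d + 1) * δ))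
          = cN * (B3 * Real.pi ^ (d + 1)) * ‖latticeVec k‖⁻¹ ^ (d + 1) * δ := by rw [mul_pow]; ring
        _ ≤ _ := mul_le_mul_of_nonneg_right (mul_le_mul_of_nonneg_right h2 h3) hδ

end

section


/-! ### Separability of the space of symbols -/

/-- Subspaces of second countable spaces are separable; a countable dense part of the image is
lifted to `P` itself, so that a property known on `P` holds on `D`. -/
theorem exists_countable_approx {α X : Type*} [TopologicalSpace X] [SecondCountableTopology X]
    (f : α → X) (P : Set α) :
    ∃ D ⊆ P, D.Countable ∧ ∀ a ∈ P, f a ∈ closure (f '' D) := by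
  obtain ⟨c, hc, hdense⟩ := TopologicalSpace.exists_countable_dense ↥(f '' P)
  have hpre : ∀ y : ↥(f '' P), ∃ a ∈ P, f a = y := fun y => y.2
  choose g hgP hg using hpre
  refine ⟨g '' c, ?_, hc.image g, fun a ha => ?_⟩
  · rintro _ ⟨y, -, rfl⟩; exact hgP y
  · have h1 : (⟨f a, a, ha, rfl⟩ : ↥(f '' P)) ∈ closure c := hdense _
    have h2 := image_closure_subset_closure_image continuous_subtype_val ⟨_, h1, rfl⟩
    refine closure_mono ?_ h2
    rintro _ ⟨y, hy, rfl⟩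
    exact ⟨g y, ⟨y, hy, rfl⟩, hg y⟩

instance finiteDimensional_continuousMultilinearMap (V : Type) [NormedAddCommGroup V]
    [NormedSpace ℝ V] [FiniteDimensional ℝ V] (n : ℕ) : FiniteDimensional ℝ (V [×n]→L[ℝ] ℂ) :=
  FiniteDimensional.of_injective
    (ContinuousMultilinearMap.toMultilinearMapLinear :
      (V [×n]→L[ℝ] ℂ) →ₗ[ℝ] MultilinearMap ℝ (fun _ : Fin n => V) ℂ)
    ContinuousMultilinearMap.toMultilinearMap_injective

/-- The full jet takes values in a countable product of second countable spaces `C(K, ·)`. The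
product topology gives approximation of any finite number of derivatives by a single countable set.
-/
theorem exists_countable_jet_approx {V : Type} [NormedAddCommGroup V]
    [NormedSpace ℝ V] [FiniteDimensional ℝ V] {K : Set V} (hK : IsCompact K) {α : Type*}
    (F : α → V → ℂ) (hF : ∀ a, ContDiff ℝ ∞ (F a)) (P : Set α) :
    ∃ D ⊆ P, D.Countable ∧ ∀ a ∈ P, ∀ (N : ℕ) (e : ℝ), 0 < e → ∃ a' ∈ D, ∀ n ≤ N, ∀ p ∈ K,
      ‖iteratedFDeriv ℝ n (F a) p - iteratedFDeriv ℝ n (F a') p‖ < e := by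
  have : CompactSpace K := isCompact_iff_compactSpace.1 hK
  have : ProperSpace V := FiniteDimensional.proper ℝ V
  have : ∀ n : ℕ, ProperSpace (V [×n]→L[ℝ] ℂ) := fun n => FiniteDimensional.proper ℝ _
  let J : α → ∀ n : ℕ, C(K, V [×n]→L[ℝ] ℂ) := fun a n =>
    ⟨fun p => iteratedFDeriv ℝ n (F a) p,
      ((hF a).continuous_iteratedFDeriv (mod_cast le_top)).comp continuous_subtype_val⟩
  obtain ⟨D, hDP, hD, hcl⟩ := exists_countable_approx J P
  refine ⟨D, hDP, hD, fun a ha N e he => ?_⟩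
  have hopen : IsOpen ((Set.Iic N).pi fun n => Metric.ball (J a n) e) :=
    isOpen_set_pi (Set.finite_Iic N) fun n _ => Metric.isOpen_ball
  obtain ⟨g, hg, a', ha', rfl⟩ := mem_closure_iff.1 (hcl a ha) _ hopen
    (fun n _ => Metric.mem_ball_self he)
  refine ⟨a', ha', fun n hn p hp => ?_⟩
  have h1 := hg n hn
  rw [Metric.mem_ball, dist_comm] at h1
  have h2 := (ContinuousMap.dist_apply_le_dist (f := J a n) (g := J a' n) ⟨p, hp⟩).trans_lt h1
  rwa [dist_eq_norm] at h2

variable {d : ℕ} {Λ : Submodule ℤ (Fin d → ℤ)} {ξ₀ : Freq d} {r : ℝ}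

/-- A closed condition that holds, for each symbol of a family, for almost all `t`, holds for almost
all `t` for all symbols of the family. -/
theorem ae_forall_mem_of_isClosed {μ : ℝ → SymbolSpace Λ ξ₀ r →ₗ[ℂ] ℂ}
    (hμ : ∀ᵐ t : ℝ, IsContinuousForm (μ t)) (P : Set (SymbolSpace Λ ξ₀ r)) {Q : Set ℂ}
    (hQ : IsClosed Q) (h : ∀ a ∈ P, ∀ᵐ t : ℝ, μ t a ∈ Q) :
    ∀ᵐ t : ℝ, ∀ a ∈ P, μ t a ∈ Q := by
  -- Symbols of uniformly bounded extent: differences of two of them keep the same extent, so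
  -- `exists_core_point` turns closeness on one compact box into closeness everywhere. Every symbol
  -- belongs to such a class for `q` large.
  let Pq : ℕ → Set (SymbolSpace Λ ξ₀ r) := fun q =>
    {a | a ∈ P ∧ HasExtent ξ₀ a.1 (r - 1 / ((q : ℝ) + 1)) ((q : ℝ) + 1)}
  have hK : ∀ q : ℕ, IsCompact
      (coreBox Λ ξ₀ (r - 1 / ((q : ℝ) + 1)) ((q : ℝ) + 1 + 1)) := fun q => isCompact_coreBox _ _
  choose D hDP hDc hD using fun q => exists_countable_jet_approx (hK q)
    (fun a : SymbolSpace Λ ξ₀ r => symbolLift a.1) (fun a => a.2.smooth) (Pq q)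
  have hall : ∀ᵐ t : ℝ, ∀ a ∈ ⋃ q, D q, μ t a ∈ Q := by
    rw [ae_ball_iff (Set.countable_iUnion hDc)]
    intro a ha
    obtain ⟨q, hq⟩ := Set.mem_iUnion.1 ha
    exact h a (hDP q hq).1
  filter_upwards [hμ, hall] with t ht hallt a ha
  obtain ⟨N, C, hC⟩ := ht
  obtain ⟨r', hr', R₀, hR₀, he⟩ := a.2.exists_hasExtent
  obtain ⟨q, hq1, hq2⟩ : ∃ q : ℕ, r' ≤ r - 1 / ((q : ℝ) + 1) ∧ R₀ ≤ (q : ℝ) + 1 := by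
    obtain ⟨q1, hq1⟩ := exists_nat_one_div_lt (sub_pos.2 hr')
    obtain ⟨q2, hq2⟩ := exists_nat_ge R₀
    refine ⟨max q1 q2, ?_, ?_⟩
    · have : 1 / (((max q1 q2 : ℕ) : ℝ) + 1) ≤ 1 / ((q1 : ℝ) + 1) :=
        one_div_le_one_div_of_le (by positivity) (by gcongr; exact le_max_left _ _)
      linarith
    · have : (q2 : ℝ) ≤ ((max q1 q2 : ℕ) : ℝ) := by exact_mod_cast le_max_right _ _
      linarith
  have haq : a ∈ Pq q := ⟨ha, he.mono hq1 hq2⟩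
  rw [← hQ.closure_eq, Metric.mem_closure_iff]
  intro e he0
  have hC1 : 0 < |C| + 1 := by positivity
  obtain ⟨a', ha', hclose⟩ := hD q a haq N (e / (|C| + 1)) (by positivity)
  refine ⟨μ t a', hallt a' (Set.mem_iUnion.2 ⟨q, ha'⟩), ?_⟩
  have hext : HasExtent ξ₀ (a - a').1 (r - 1 / ((q : ℝ) + 1)) ((q : ℝ) + 1) := by
    have h1 := haq.2
    have h2 := (hDP q ha').2
    refine ⟨fun x ξ η hξ => ?_, fun x ξ η s hη hs => ?_⟩
    · change a.1 (x, ξ, η) - a'.1 (x, ξ, η) = 0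
      rw [h1.eq_zero x ξ η hξ, h2.eq_zero x ξ η hξ, sub_zero]
    · change a.1 (x, ξ, s • η) - a'.1 (x, ξ, s • η) = a.1 (x, ξ, η) - a'.1 (x, ξ, η)
      rw [h1.homogeneous x ξ η s hη hs, h2.homogeneous x ξ η s hη hs]
  have hsub : ∀ (n : ℕ) (p), iteratedFDeriv ℝ n (symbolLift (a - a').1) p =
      iteratedFDeriv ℝ n (symbolLift a.1) p - iteratedFDeriv ℝ n (symbolLift a'.1) p := by
    intro n p
    have : symbolLift (a - a').1 = symbolLift a.1 - symbolLift a'.1 := rfl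
    rw [this, iteratedFDeriv_sub_apply (a.2.smooth.of_le (mod_cast le_top)).contDiffAt
      (a'.2.smooth.of_le (mod_cast le_top)).contDiffAt]
  have hbound : ‖μ t (a - a')‖ ≤ C * (e / (|C| + 1)) := by
    refine hC (a - a') _ fun n hn p => ?_
    rcases exists_core_point (a - a').2.smooth (by positivity) hext n p with h0 | ⟨p', hp', hle⟩
    · rw [h0]
      exact (norm_zero (E := (Freq d × Freq d × realSpan Λ) [×n]→L[ℝ] ℂ)).trans_le (by positivity)
    · refine hle.trans ?_
      rw [hsub]
      exact (hclose n hn p' hp').le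
  rw [dist_eq_norm, ← map_sub]
  refine hbound.trans_lt ?_
  rw [mul_div_assoc', div_lt_iff₀ hC1]
  nlinarith [le_abs_self C]

/-! ### Boxes in the module of resonances -/

/-- A Følner sequence of finite subsets of `Λ`. -/
theorem exists_folner_sequence (Λ : Submodule ℤ (Fin d → ℤ)) :
    ∃ B : ℕ → Finset (Fin d → ℤ), (∀ L, (B L).Nonempty) ∧ (∀ L, ∀ k ∈ B L, k ∈ Λ) ∧
      ∀ m ∈ Λ, Tendsto (fun L => (((B L).filter fun k => k - m ∈ B L).card : ℝ) / (B L).card)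
        atTop (𝓝 1) := by
  classical
  let b := Module.Free.chooseBasis ℤ Λ
  let ι := Module.Free.ChooseBasisIndex ℤ Λ
  let f : (ι → ℤ) → (Fin d → ℤ) := fun c => (b.equivFun.symm c : Λ)
  have hf : Function.Injective f := Subtype.val_injective.comp b.equivFun.symm.injective
  have hfadd : ∀ c c', f (c + c') = f c + f c' := fun c c' => by
    simp only [f, map_add]; rfl
  -- Discrete cubes in the coordinates of a `ℤ`-basis of `Λ`.
  let C : ℕ → Finset (ι → ℤ) := fun L => Fintype.piFinset fun _ => Finset.Ico (0 : ℤ) (L + 1)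
  refine ⟨fun L => (C L).image f, fun L => ?_, fun L k hk => ?_, fun m hm => ?_⟩
  · refine Finset.Nonempty.image ⟨0, ?_⟩ f
    simp only [C, Fintype.mem_piFinset, Pi.zero_apply, Finset.mem_Ico]
    intro; omega
  · obtain ⟨c, -, rfl⟩ := Finset.mem_image.1 hk
    exact (b.equivFun.symm c).2
  · obtain ⟨c, hc⟩ : ∃ c, f c = -m := ⟨b.equivFun ⟨-m, neg_mem hm⟩, by
      simp only [f, LinearEquiv.symm_apply_apply]⟩
    simp only [sub_eq_add_neg, ← hc]
    have hcard : ∀ L, ((C L).image f).card = (L + 1) ^ Fintype.card ι := by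
      intro L
      rw [Finset.card_image_of_injective _ hf]
      simp [C]
    have hlow : ∀ L : ℕ, ∏ i : ι, (((L + 1 : ℕ) : ℝ) - 2 * |(c i : ℝ)|) ⊔ 0 ≤
        ((((C L).image f).filter fun k => k + f c ∈ (C L).image f).card : ℝ) := by
      intro L
      -- The cube shrunk by `|c i|` on both sides stays in the cube after translation by `c`; it may
      -- be empty, hence the truncation at `0` of each side length.
      let D : Finset (ι → ℤ) := Fintype.piFinset fun i => Finset.Ico |c i| ((L : ℤ) + 1 - |c i|)
      have hsub : D.image f ⊆ ((C L).image f).filter fun k => k + f c ∈ (C L).image f := by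
        intro k hk
        obtain ⟨c', hc', rfl⟩ := Finset.mem_image.1 hk
        simp only [D, Fintype.mem_piFinset, Finset.mem_Ico] at hc'
        refine Finset.mem_filter.2 ⟨Finset.mem_image_of_mem _ ?_, ?_⟩
        · simp only [C, Fintype.mem_piFinset, Finset.mem_Ico]
          intro i
          have := hc' i; have := abs_nonneg (c i)
          omega
        · rw [← hfadd]
          refine Finset.mem_image_of_mem _ ?_
          simp only [C, Fintype.mem_piFinset, Finset.mem_Ico, Pi.add_apply]
          intro i
          have := hc' i; have := neg_abs_le (c i); have := le_abs_self (c i)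
          omega
      have h1 := Finset.card_le_card hsub
      rw [Finset.card_image_of_injective _ hf] at h1
      refine le_trans (le_of_eq ?_) (Nat.cast_le.2 h1)
      simp only [D, Fintype.card_piFinset, Int.card_Ico, Nat.cast_prod]
      refine Finset.prod_congr rfl fun i _ => ?_
      have : ((((L : ℤ) + 1 - |c i| - |c i|).toNat : ℤ) : ℝ) =
          (((L + 1 : ℕ) : ℝ) - 2 * |(c i : ℝ)|) ⊔ 0 := by
        rw [Int.toNat_eq_max]
        push_cast
        congr 1
        ring
      rw [← this]; rfl
    have hup : ∀ L : ℕ,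
        ((((C L).image f).filter fun k => k + f c ∈ (C L).image f).card : ℝ) /
          ((C L).image f).card ≤ 1 := fun L =>
      div_le_one_of_le₀ (Nat.cast_le.2 (Finset.card_filter_le _ _)) (by positivity)
    have hlim : Tendsto (fun L : ℕ => ∏ i : ι,
        ((1 - 2 * |(c i : ℝ)| * (1 / ((L : ℝ) + 1))) ⊔ 0)) atTop (𝓝 1) := by
      have : Tendsto (fun L : ℕ => ∏ i : ι,
          ((1 - 2 * |(c i : ℝ)| * (1 / ((L : ℝ) + 1))) ⊔ 0)) atTop
          (𝓝 (∏ i : ι, ((1 - 2 * |(c i : ℝ)| * 0) ⊔ 0))) :=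
        tendsto_finsetProd _ fun i _ =>
          ((tendsto_one_div_add_atTop_nhds_zero_nat.const_mul _).const_sub 1).max
            tendsto_const_nhds
      simpa using this
    refine tendsto_of_tendsto_of_tendsto_of_le_of_le hlim tendsto_const_nhds (fun L => ?_) hup
    have hpos : (0 : ℝ) < (L : ℝ) + 1 := by positivity
    simp only []
    rw [hcard, le_div_iff₀ (by positivity)]
    refine le_trans (le_of_eq ?_) (hlow L)
    rw [Nat.cast_pow, ← Finset.card_univ, ← Finset.prod_const, ← Finset.prod_mul_distrib]
    refine Finset.prod_congr rfl fun i _ => ?_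
    rw [max_mul_of_nonneg _ _ (by positivity), zero_mul]
    push_cast
    congr 1
    field_simp

end

section


variable {d : ℕ}

/-! ### A lower bound for quadratic forms with almost Toeplitz coefficients -/

/-- Schur's test: `2|c_j||c_k| ≤ |c_j|² + |c_k|²`, and each row sum and column sum of `v (j - k)` is
at most the total sum of `v`. -/
theorem schur_bound {S : Finset (Fin d → ℤ)} (c : (Fin d → ℤ) → ℂ) {v : (Fin d → ℤ) → ℝ}
    (hv : Summable v) (hv0 : ∀ m, 0 ≤ v m) :
    ∑ j ∈ S, ∑ k ∈ S, ‖c j‖ * ‖c k‖ * v (j - k) ≤ (∑ k ∈ S, ‖c k‖ ^ 2) * ∑' m, v m := by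
  have h1 : ∀ j, ∑ k ∈ S, v (j - k) ≤ ∑' m, v m := by
    intro j
    have := ((Equiv.subLeft j).summable_iff.2 hv).sum_le_tsum S (fun k _ => hv0 _)
    rw [(Equiv.subLeft j).tsum_eq v] at this
    exact this
  have h2 : ∀ k, ∑ j ∈ S, v (j - k) ≤ ∑' m, v m := by
    intro k
    have := ((Equiv.subRight k).summable_iff.2 hv).sum_le_tsum S (fun k _ => hv0 _)
    rw [(Equiv.subRight k).tsum_eq v] at this
    exact this
  calc ∑ j ∈ S, ∑ k ∈ S, ‖c j‖ * ‖c k‖ * v (j - k)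
      ≤ ∑ j ∈ S, ∑ k ∈ S, (1 / 2 * (‖c j‖ ^ 2 * v (j - k)) + 1 / 2 * (‖c k‖ ^ 2 * v (j - k))) := by
        refine Finset.sum_le_sum fun j _ => Finset.sum_le_sum fun k _ => ?_
        nlinarith [hv0 (j - k), mul_nonneg (sq_nonneg (‖c j‖ - ‖c k‖)) (hv0 (j - k))]
    _ = 1 / 2 * ∑ j ∈ S, ‖c j‖ ^ 2 * ∑ k ∈ S, v (j - k) +
          1 / 2 * ∑ k ∈ S, ‖c k‖ ^ 2 * ∑ j ∈ S, v (j - k) := by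
        simp only [Finset.sum_add_distrib, ← Finset.mul_sum]
        congr 2
        rw [Finset.sum_comm]
        simp only [← Finset.mul_sum]
    _ ≤ 1 / 2 * ∑ j ∈ S, ‖c j‖ ^ 2 * ∑' m, v m + 1 / 2 * ∑ k ∈ S, ‖c k‖ ^ 2 * ∑' m, v m := by
        gcongr <;> first | exact h1 _ | exact h2 _
    _ = _ := by rw [← Finset.sum_mul]; ring

theorem character_mul_conj (j k : Fin d → ℤ) (x : Torus d) :
    (starRingEnd ℂ) (character j x) * character k x =
      (charNorm d : ℂ) * (starRingEnd ℂ) (character (j - k) x) := by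
  simp only [character_eq, map_mul, Complex.conj_ofReal, sub_eq_add_neg, phase_add_left,
    phase_neg_left, Complex.conj_conj]
  ring

/-- A Toeplitz form is an integral against a nonnegative density; pointwise lower bounds of `Re g`
thus become lower bounds of the form. -/
theorem integral_mul_normSq_sum {g : Torus d → ℂ} (hg : Continuous g) (S : Finset (Fin d → ℤ))
    (c : (Fin d → ℤ) → ℂ) :
    ∫ x, g x * ((‖∑ k ∈ S, c k * character k x‖ ^ 2 : ℝ) : ℂ) =
      ∑ j ∈ S, ∑ k ∈ S, (starRingEnd ℂ) (c j) * c k * ((charNorm d : ℂ) * fourierCoef g (j - k)) := by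
  have h1 : ∀ x : Torus d, g x * ((‖∑ k ∈ S, c k * character k x‖ ^ 2 : ℝ) : ℂ) =
      ∑ j ∈ S, ∑ k ∈ S, ((starRingEnd ℂ) (c j) * c k * (charNorm d : ℂ)) *
        (g x * (starRingEnd ℂ) (character (j - k) x)) := by
    intro x
    rw [← Complex.normSq_eq_norm_sq, Complex.normSq_eq_conj_mul_self, map_sum, Finset.sum_mul_sum,
      Finset.mul_sum]
    refine Finset.sum_congr rfl fun j _ => ?_
    rw [Finset.mul_sum]
    refine Finset.sum_congr rfl fun k _ => ?_
    rw [map_mul]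
    linear_combination (g x * (starRingEnd ℂ) (c j) * c k) * character_mul_conj j k x
  simp only [h1]
  have hint : ∀ j k : Fin d → ℤ, Integrable fun x => ((starRingEnd ℂ) (c j) * c k *
      (charNorm d : ℂ)) * (g x * (starRingEnd ℂ) (character (j - k) x)) := fun j k =>
    (continuous_integrable_torus (continuous_mul_conj_character hg (j - k))).const_mul _
  rw [integral_finsetSum _ fun j _ => integrable_finsetSum _ fun k _ => hint j k]
  refine Finset.sum_congr rfl fun j _ => ?_
  rw [integral_finsetSum _ fun k _ => hint j k]
  refine Finset.sum_congr rfl fun k _ => ?_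
  rw [integral_const_mul, fourierCoef]
  ring

theorem fourierCoef_one (k : Fin d → ℤ) :
    fourierCoef (fun _ => 1) k = if k = 0 then (charNorm d : ℂ)⁻¹ else 0 := by
  have := fourierCoef_phase_mul 0 k 1
  simp only [phase_zero_left, mul_one] at this
  rw [this]
  simp only [eq_comm]

theorem integral_normSq_sum (S : Finset (Fin d → ℤ)) (c : (Fin d → ℤ) → ℂ) :
    ∫ x, ‖∑ k ∈ S, c k * character k x‖ ^ 2 = ∑ k ∈ S, ‖c k‖ ^ 2 := by
  classical
  have h0 : (charNorm d : ℂ) ≠ 0 := by exact_mod_cast charNorm_pos.ne'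
  have h := integral_mul_normSq_sum (g := fun _ => 1) continuous_const S c
  simp only [one_mul, fourierCoef_one, sub_eq_zero] at h
  have h2 : ∀ j ∈ S, ∑ k ∈ S, (starRingEnd ℂ) (c j) * c k *
      ((charNorm d : ℂ) * if j = k then (charNorm d : ℂ)⁻¹ else 0) = ((‖c j‖ ^ 2 : ℝ) : ℂ) := by
    intro j hj
    rw [Finset.sum_eq_single j]
    · rw [if_pos rfl, mul_inv_cancel₀ h0, mul_one, ← Complex.normSq_eq_conj_mul_self,
        Complex.normSq_eq_norm_sq]
    · intro k _ hk; simp [hk.symm]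
    · exact fun h => absurd hj h
  rw [Finset.sum_congr rfl h2, ← Complex.ofReal_sum, integral_complex_ofReal] at h
  exact Complex.ofReal_injective h

theorem re_integral_lower_bound {g : Torus d → ℂ} (hg : Continuous g) {q : ℝ}
    (hq : ∀ x, -q ≤ (g x).re) (S : Finset (Fin d → ℤ)) (c : (Fin d → ℤ) → ℂ) :
    -(q * ∑ k ∈ S, ‖c k‖ ^ 2) ≤
      (∑ j ∈ S, ∑ k ∈ S, (starRingEnd ℂ) (c j) * c k *
        ((charNorm d : ℂ) * fourierCoef g (j - k))).re := by
  have hG : Continuous fun x : Torus d => ‖∑ k ∈ S, c k * character k x‖ ^ 2 :=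
    (continuous_finsetSum _ fun k _ => continuous_const.mul (continuous_character k)).norm.pow 2
  rw [← integral_mul_normSq_sum hg, ← integral_normSq_sum, ← integral_const_mul, ← integral_neg]
  have h1 := integral_re (𝕜 := ℂ) (μ := (volume : Measure (Torus d)))
    (continuous_integrable_torus (hg.mul (Complex.continuous_ofReal.comp hG)))
  change _ ≤ RCLike.re (K := ℂ) _
  refine le_trans ?_ h1.le
  refine integral_mono ?_ ?_ fun x => ?_
  · exact continuous_integrable_torus (continuous_const.mul hG).neg
  · exact (continuous_integrable_torus (hg.mul (Complex.continuous_ofReal.comp hG))).re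
  · simp only [RCLike.re_to_complex, Pi.mul_apply, Function.comp_apply, Complex.re_mul_ofReal]
    have := mul_le_mul_of_nonneg_right (hq x) (sq_nonneg ‖∑ k ∈ S, c k * character k x‖)
    linarith

/-! ### Averaging frozen Toeplitz forms over windows. -/

open Classical in
/-- The proportion of `B` that is also in `B + m`. -/
def overlap (B : Finset (Fin d → ℤ)) (m : Fin d → ℤ) : ℝ :=
  ((B.filter fun k => k - m ∈ B).card : ℝ) / B.card

theorem overlap_nonneg (B : Finset (Fin d → ℤ)) (m : Fin d → ℤ) : 0 ≤ overlap B m := by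
  unfold overlap; positivity

theorem overlap_le_one (B : Finset (Fin d → ℤ)) (m : Fin d → ℤ) : overlap B m ≤ 1 :=
  div_le_one_of_le₀ (Nat.cast_le.2 (Finset.card_filter_le _ _)) (by positivity)

/-- In each window `p + B` the matrix is replaced by the Toeplitz matrix of `g p`, bounded below by
`re_integral_lower_bound`. The average over windows reproduces `M j k` with the factor `overlap B (j
- k)`. The error is the defect `1 - overlap` plus the freezing error `e`, both weighted by `w` and
summed by Schur's test. -/
theorem re_quadraticForm_lower_bound {S B : Finset (Fin d → ℤ)} (hB : B.Nonempty)
    (c : (Fin d → ℤ) → ℂ) {M : (Fin d → ℤ) → (Fin d → ℤ) → ℂ} {g : (Fin d → ℤ) → Torus d → ℂ}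
    (hg : ∀ p, Continuous (g p)) {w : (Fin d → ℤ) → ℝ} (hw : Summable w) (hw0 : ∀ m, 0 ≤ w m)
    {e : ℝ} (he : 0 ≤ e) {q : (Fin d → ℤ) → ℝ}
    (hM : ∀ j ∈ S, ∀ k ∈ S, ‖M j k‖ ≤ w (j - k))
    (hMg : ∀ j ∈ S, ∀ k ∈ S, ∀ p, j - p ∈ B → k - p ∈ B →
      ‖M j k - fourierCoef (g p) (j - k)‖ ≤ e * w (j - k))
    (hq : ∀ p x, -q p ≤ (g p x).re) :
    -(∑ k ∈ S, ‖c k‖ ^ 2 * ((∑ β ∈ B, q (k - β)) / B.card)) -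
        charNorm d * ((∑ k ∈ S, ‖c k‖ ^ 2) * ∑' m, w m * (1 - overlap B m + e)) ≤
      (∑ j ∈ S, ∑ k ∈ S, (starRingEnd ℂ) (c j) * c k * ((charNorm d : ℂ) * M j k)).re := by
  classical
  have hBc : (0 : ℝ) < B.card := Nat.cast_pos.2 hB.card_pos
  -- The centres `p` of all windows that meet `S`.
  let P : Finset (Fin d → ℤ) := (S ×ˢ B).image fun kb => kb.1 - kb.2
  have hreal : ∀ k ∈ S, ∀ f : (Fin d → ℤ) → ℝ,
      ∑ p ∈ P with k - p ∈ B, f p = ∑ β ∈ B, f (k - β) := by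
    intro k hk f
    refine Finset.sum_nbij' (fun p => k - p) (fun β => k - β) ?_ ?_ ?_ ?_ ?_
    · intro p hp; exact (Finset.mem_filter.1 hp).2
    · intro β hβ
      refine Finset.mem_filter.2 ⟨Finset.mem_image.2 ⟨(k, β), Finset.mk_mem_product hk hβ, rfl⟩, ?_⟩
      simpa using hβ
    · intro p _; simp
    · intro β _; simp
    · intro p _; simp
  -- The number of windows that contain both `j` and `k`.
  have hcount : ∀ j ∈ S, ∀ k, ((P.filter fun p => j - p ∈ B ∧ k - p ∈ B).card : ℝ) =
      overlap B (j - k) * B.card := by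
    intro j hj k
    rw [overlap, div_mul_cancel₀ _ hBc.ne']
    congr 1
    refine Finset.card_nbij' (fun p => j - p) (fun β => j - β) ?_ ?_ ?_ ?_
    · intro p hp
      have h1 := (Finset.mem_filter.1 hp).2
      refine Finset.mem_filter.2 ⟨h1.1, ?_⟩
      rw [show j - p - (j - k) = k - p by abel]
      exact h1.2
    · intro β hβ
      have h1 := Finset.mem_filter.1 hβ
      refine Finset.mem_filter.2 ⟨Finset.mem_image.2 ⟨(j, β), Finset.mk_mem_product hj h1.1, rfl⟩,
        ?_, ?_⟩
      · simpa using h1.1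
      · rw [show k - (j - β) = β - (j - k) by abel]; exact h1.2
    · intro p _; simp
    · intro β _; simp
  -- the positive form
  set A : ℂ := ∑ j ∈ S, ∑ k ∈ S, (starRingEnd ℂ) (c j) * c k * ((charNorm d : ℂ) *
    ((∑ p ∈ P with j - p ∈ B ∧ k - p ∈ B, fourierCoef (g p) (j - k)) / B.card)) with hA
  have hAeq : A = (∑ p ∈ P, ∑ j ∈ S with j - p ∈ B, ∑ k ∈ S with k - p ∈ B,
      (starRingEnd ℂ) (c j) * c k * ((charNorm d : ℂ) * fourierCoef (g p) (j - k))) / B.card := by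
    rw [hA, Finset.sum_div]
    simp only [Finset.sum_filter, Finset.sum_div, Finset.mul_sum]
    conv_rhs => rw [Finset.sum_comm]
    refine Finset.sum_congr rfl fun j _ => ?_
    rw [Finset.sum_comm]
    refine Finset.sum_congr rfl fun p _ => ?_
    by_cases h1 : j - p ∈ B
    · simp only [h1, true_and, if_true, Finset.sum_div]
      refine Finset.sum_congr rfl fun k _ => ?_
      split_ifs <;> ring
    · simp [h1]
  have hAre : -(∑ k ∈ S, ‖c k‖ ^ 2 * ((∑ β ∈ B, q (k - β)) / B.card)) ≤ A.re := by
    have h1 : -(∑ p ∈ P, q p * ∑ k ∈ S with k - p ∈ B, ‖c k‖ ^ 2) ≤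
        (∑ p ∈ P, ∑ j ∈ S with j - p ∈ B, ∑ k ∈ S with k - p ∈ B,
          (starRingEnd ℂ) (c j) * c k * ((charNorm d : ℂ) * fourierCoef (g p) (j - k))).re := by
      rw [Complex.re_sum, ← Finset.sum_neg_distrib]
      exact Finset.sum_le_sum fun p _ => re_integral_lower_bound (hg p) (hq p) _ c
    have h2 : ∑ k ∈ S, ‖c k‖ ^ 2 * ((∑ β ∈ B, q (k - β)) / B.card) =
        (∑ p ∈ P, q p * ∑ k ∈ S with k - p ∈ B, ‖c k‖ ^ 2) / B.card := by
      simp only [Finset.sum_filter, Finset.mul_sum]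
      rw [Finset.sum_comm, Finset.sum_div]
      refine Finset.sum_congr rfl fun k hk => ?_
      rw [← hreal k hk, Finset.sum_filter, mul_div_assoc', Finset.mul_sum]
      congr 1
      refine Finset.sum_congr rfl fun p _ => ?_
      split_ifs <;> ring
    rw [h2, hAeq, ← Complex.ofReal_natCast, Complex.div_ofReal_re, ← neg_div]
    exact div_le_div_of_nonneg_right h1 hBc.le
  -- the remainder
  set W : ℂ := ∑ j ∈ S, ∑ k ∈ S, (starRingEnd ℂ) (c j) * c k * ((charNorm d : ℂ) * M j k) with hW
  have hcoef : ∀ j ∈ S, ∀ k ∈ S, ‖M j k -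
      (∑ p ∈ P with j - p ∈ B ∧ k - p ∈ B, fourierCoef (g p) (j - k)) / B.card‖ ≤
      w (j - k) * (1 - overlap B (j - k) + e) := by
    intro j hj k hk
    -- The total weight of the windows containing `j` and `k` is the overlap, so the missing part of
    -- `M j k` is its multiple by `1 - overlap`, and the rest is an average of freezing errors.
    have h1 : M j k - (∑ p ∈ P with j - p ∈ B ∧ k - p ∈ B, fourierCoef (g p) (j - k)) / B.card =
        ((1 - overlap B (j - k) : ℝ) : ℂ) * M j k + (∑ p ∈ P with j - p ∈ B ∧ k - p ∈ B,
          (M j k - fourierCoef (g p) (j - k))) / B.card := by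
      have hc : ((P.filter fun p => j - p ∈ B ∧ k - p ∈ B).card : ℂ) =
          (overlap B (j - k) : ℂ) * (B.card : ℂ) := by
        exact_mod_cast congrArg Complex.ofReal (hcount j hj k)
      rw [Finset.sum_sub_distrib, Finset.sum_const, nsmul_eq_mul, hc]
      have : (B.card : ℂ) ≠ 0 := by exact_mod_cast hBc.ne'
      push_cast
      field_simp
      ring
    rw [h1]
    refine (norm_add_le _ _).trans ?_
    have ho := overlap_le_one B (j - k)
    have ho' := overlap_nonneg B (j - k)
    have h2 : ‖((1 - overlap B (j - k) : ℝ) : ℂ) * M j k‖ ≤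
        w (j - k) * (1 - overlap B (j - k)) := by
      rw [norm_mul, Complex.norm_real, Real.norm_of_nonneg (by linarith), mul_comm]
      exact mul_le_mul_of_nonneg_right (hM j hj k hk) (by linarith)
    have h3 : ‖(∑ p ∈ P with j - p ∈ B ∧ k - p ∈ B,
          (M j k - fourierCoef (g p) (j - k))) / (B.card : ℂ)‖ ≤ w (j - k) * e := by
      rw [norm_div, Complex.norm_natCast, div_le_iff₀ hBc]
      refine (norm_sum_le_of_le _ (f := fun p => M j k - fourierCoef (g p) (j - k))
        (n := fun _ => e * w (j - k)) fun p hp => ?_).trans ?_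
      · have := (Finset.mem_filter.1 hp).2
        exact hMg j hj k hk p this.1 this.2
      · rw [Finset.sum_const, nsmul_eq_mul, hcount j hj k]
        have : 0 ≤ e * w (j - k) := mul_nonneg he (hw0 _)
        nlinarith [mul_nonneg this hBc.le]
    linarith
  have hsum : Summable fun m => w m * (1 - overlap B m + e) := by
    refine Summable.of_nonneg_of_le (fun m => mul_nonneg (hw0 m) ?_) (fun m => ?_)
      (hw.mul_right (1 + e))
    · linarith [overlap_le_one B m]
    · exact mul_le_mul_of_nonneg_left (by linarith [overlap_nonneg B m]) (hw0 m)
  have hdiff : ‖W - A‖ ≤ charNorm d * ((∑ k ∈ S, ‖c k‖ ^ 2) *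
      ∑' m, w m * (1 - overlap B m + e)) := by
    have h1 : W - A = ∑ j ∈ S, ∑ k ∈ S, (starRingEnd ℂ) (c j) * c k * ((charNorm d : ℂ) *
        (M j k - (∑ p ∈ P with j - p ∈ B ∧ k - p ∈ B, fourierCoef (g p) (j - k)) / B.card)) := by
      rw [hW, hA, ← Finset.sum_sub_distrib]
      refine Finset.sum_congr rfl fun j _ => ?_
      rw [← Finset.sum_sub_distrib]
      exact Finset.sum_congr rfl fun k _ => by ring
    refine le_trans ?_ (mul_le_mul_of_nonneg_left
      (schur_bound c hsum fun m => mul_nonneg (hw0 m) ?_) charNorm_pos.le)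
    · rw [h1, Finset.mul_sum]
      refine norm_sum_le_of_le _ fun j hj => ?_
      rw [Finset.mul_sum]
      refine norm_sum_le_of_le _ fun k hk => ?_
      rw [norm_mul, norm_mul, norm_mul, RCLike.norm_conj, Complex.norm_real,
        Real.norm_of_nonneg charNorm_pos.le]
      have := mul_le_mul_of_nonneg_left (hcoef j hj k hk)
        (mul_nonneg (charNorm_pos (d := d)).le (mul_nonneg (norm_nonneg (c j)) (norm_nonneg (c k))))
      linarith
    · linarith [overlap_le_one B m]
  have h1 : A.re - W.re ≤ ‖W - A‖ := by
    rw [norm_sub_rev, ← Complex.sub_re]; exact Complex.re_le_norm _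
  linarith

end

section


variable {d : ℕ}

/-! ### Frequency support and Wigner distributions as finite sums -/

theorem finite_lattice_ball {h : ℝ} (hh : 0 < h) (ξ₀ : Freq d) (r : ℝ) :
    {k : Fin d → ℤ | h • latticeVec k ∈ Metric.ball ξ₀ r}.Finite := by
  obtain ⟨N, hN⟩ := exists_nat_ge ((r + ‖ξ₀‖) / h)
  refine (Set.finite_Icc (fun _ : Fin d => -(N : ℤ)) (fun _ => (N : ℤ))).subset fun k hk => ?_
  have h1 : ‖h • latticeVec k‖ ≤ r + ‖ξ₀‖ := by
    have h2 := norm_le_norm_add_norm_sub' (h • latticeVec k) ξ₀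
    rw [Set.mem_ofPred_eq, mem_ball_iff_norm] at hk
    linarith
  rw [norm_smul, Real.norm_of_nonneg hh.le, ← le_div_iff₀' hh] at h1
  have h2 : ∀ i, |(k i : ℝ)| ≤ N := fun i => by
    have := PiLp.norm_apply_le (latticeVec k) i
    simp only [latticeVec, Real.norm_eq_abs] at this
    exact this.trans (h1.trans hN)
  have h3 : ∀ i, |k i| ≤ (N : ℤ) := fun i => by exact_mod_cast h2 i
  exact ⟨fun i => (abs_le.1 (h3 i)).1, fun i => (abs_le.1 (h3 i)).2⟩

/-- The frequencies `k` with `hk ∈ B(ξ₀, r)`. -/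
def freqSupport (h : ℝ) (ξ₀ : Freq d) (r : ℝ) : Finset (Fin d → ℤ) :=
  if hh : 0 < h then (finite_lattice_ball hh ξ₀ r).toFinset else ∅

theorem mem_freqSupport {h : ℝ} (hh : 0 < h) {ξ₀ : Freq d} {r : ℝ} {k : Fin d → ℤ} :
    k ∈ freqSupport h ξ₀ r ↔ h • latticeVec k ∈ Metric.ball ξ₀ r := by
  simp [freqSupport, hh]

theorem wigner_eq_sum {h : ℝ} {c : (Fin d → ℤ) → ℂ} {S : Finset (Fin d → ℤ)}
    (hc : ∀ k ∉ S, c k = 0) (b : Torus d × Freq d → ℂ) :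
    wigner h c b = ∑ j ∈ S, ∑ k ∈ S, (starRingEnd ℂ) (c j) * c k * ((charNorm d : ℂ) *
      fourierCoef (fun x => b (x, (h / 2) • latticeVec (k + j))) (j - k)) := by
  unfold wigner
  rw [tsum_eq_sum (s := S) fun j hj => by rw [hc j hj]; simp]
  refine Finset.sum_congr rfl fun j _ => ?_
  unfold weylCoef
  rw [tsum_eq_sum (s := S) fun k hk => by rw [hc k hk]; simp, Finset.mul_sum, Finset.mul_sum]
  refine Finset.sum_congr rfl fun k _ => ?_
  simp only [charNorm]
  ring

/-- The propagator acts by unimodular factors, so bounds in terms of `|c_k|` are uniform in `t`. -/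
theorem norm_propagatedCoef (H : Freq d → ℝ) (h t : ℝ) (u : Torus d → ℂ) (k : Fin d → ℤ) :
    ‖propagatedCoef H h t u k‖ = ‖fourierCoef u k‖ := by
  unfold propagatedCoef
  rw [norm_mul, ← mul_neg, ← Complex.ofReal_neg, mul_comm Complex.I, Complex.norm_exp_ofReal_mul_I,
    one_mul]

theorem continuous_propagatedCoef (H : Freq d → ℝ) (h τ : ℝ) (u : Torus d → ℂ) (k : Fin d → ℤ) :
    Continuous fun t : ℝ => propagatedCoef H h (τ * t) u k := by
  unfold propagatedCoef
  fun_prop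

theorem continuous_wigner_propagatedCoef (H : Freq d → ℝ) (h τ : ℝ) (u : Torus d → ℂ)
    {S : Finset (Fin d → ℤ)} (hu : ∀ k ∉ S, fourierCoef u k = 0) (b : Torus d × Freq d → ℂ) :
    Continuous fun t : ℝ => wigner h (propagatedCoef H h (τ * t) u) b := by
  have h1 : ∀ t : ℝ, ∀ k ∉ S, propagatedCoef H h (τ * t) u k = 0 := fun t k hk => by
    rw [propagatedCoef, hu k hk, mul_zero]
  simp only [wigner_eq_sum (h1 _)]
  refine continuous_finsetSum _ fun j _ => continuous_finsetSum _ fun k _ => ?_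
  exact ((Complex.continuous_conj.comp (continuous_propagatedCoef H h τ u j)).mul
    (continuous_propagatedCoef H h τ u k)).mul continuous_const

theorem exists_wigner_bound (H : Freq d → ℝ) (h τ : ℝ) (u : Torus d → ℂ)
    {S : Finset (Fin d → ℤ)} (hu : ∀ k ∉ S, fourierCoef u k = 0) (b : Torus d × Freq d → ℂ) :
    ∃ C : ℝ, ∀ t : ℝ, ‖wigner h (propagatedCoef H h (τ * t) u) b‖ ≤ C := by
  have h1 : ∀ t : ℝ, ∀ k ∉ S, propagatedCoef H h (τ * t) u k = 0 := fun t k hk => by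
    rw [propagatedCoef, hu k hk, mul_zero]
  refine ⟨∑ j ∈ S, ∑ k ∈ S, ‖fourierCoef u j‖ * ‖fourierCoef u k‖ * ‖(charNorm d : ℂ) *
      fourierCoef (fun x => b (x, (h / 2) • latticeVec (k + j))) (j - k)‖, fun t => ?_⟩
  rw [wigner_eq_sum (h1 t)]
  refine norm_sum_le_of_le _ fun j _ => norm_sum_le_of_le _ fun k _ => ?_
  rw [norm_mul, norm_mul, RCLike.norm_conj, norm_propagatedCoef, norm_propagatedCoef]

theorem integrable_mul_wigner (H : Freq d → ℝ) (h τ : ℝ) (u : Torus d → ℂ)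
    {S : Finset (Fin d → ℤ)} (hu : ∀ k ∉ S, fourierCoef u k = 0) (b : Torus d × Freq d → ℂ)
    {φ : ℝ → ℂ} (hφ : Integrable φ) :
    Integrable fun t : ℝ => φ t * wigner h (propagatedCoef H h (τ * t) u) b := by
  obtain ⟨C, hC⟩ := exists_wigner_bound H h τ u hu b
  exact hφ.mul_bdd (continuous_wigner_propagatedCoef H h τ u hu b).aestronglyMeasurable
    (Eventually.of_forall hC)

/-! ### The decomposition `ξ = σ(ξ) + η(ξ)` along the leaves -/

section Leaves

variable {H : Freq d → ℝ} {Λ : Submodule ℤ (Fin d → ℤ)} {ξ₀ : Freq d} {r ε : ℝ}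

theorem isBasePoint_sigmaMap (hdecomp : ∀ ξ ∈ Metric.ball ξ₀ r, ∃! σ, IsBasePoint H Λ ξ₀ ε ξ σ)
    {ξ : Freq d} (hξ : ξ ∈ Metric.ball ξ₀ r) :
    IsBasePoint H Λ ξ₀ ε ξ (sigmaMap H Λ ξ₀ ε ξ) := by
  have h := (hdecomp ξ hξ).exists
  rw [sigmaMap, dif_pos h]
  exact h.choose_spec

theorem etaMap_coe (H : Freq d → ℝ) (Λ : Submodule ℤ (Fin d → ℤ)) (ξ₀ : Freq d) (ε : ℝ)
    (ξ : Freq d) : (etaMap H Λ ξ₀ ε ξ : Freq d) = ξ - sigmaMap H Λ ξ₀ ε ξ := rfl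

theorem sigmaMap_eq_of_sub_mem
    (hdecomp : ∀ ξ ∈ Metric.ball ξ₀ r, ∃! σ, IsBasePoint H Λ ξ₀ ε ξ σ) {ξ ξ' : Freq d}
    (hξ : ξ ∈ Metric.ball ξ₀ r) (hξ' : ξ' ∈ Metric.ball ξ₀ r) (hl : ξ - ξ' ∈ realSpan Λ) :
    sigmaMap H Λ ξ₀ ε ξ = sigmaMap H Λ ξ₀ ε ξ' := by
  have h1 := isBasePoint_sigmaMap hdecomp hξ
  have h2 := isBasePoint_sigmaMap hdecomp hξ'
  refine (hdecomp ξ hξ).unique h1 ⟨h2.1, h2.2.1, ?_⟩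
  have := add_mem hl h2.2.2
  rwa [sub_add_sub_cancel] at this

/-- By uniqueness of the decomposition `σ` is constant along a leaf, so `η` varies isometrically
with `ξ` there. This replaces any smoothness of `η`. -/
theorem norm_etaMap_sub
    (hdecomp : ∀ ξ ∈ Metric.ball ξ₀ r, ∃! σ, IsBasePoint H Λ ξ₀ ε ξ σ) {ξ ξ' : Freq d}
    (hξ : ξ ∈ Metric.ball ξ₀ r) (hξ' : ξ' ∈ Metric.ball ξ₀ r) (hl : ξ - ξ' ∈ realSpan Λ) :
    ‖etaMap H Λ ξ₀ ε ξ - etaMap H Λ ξ₀ ε ξ'‖ = ‖ξ - ξ'‖ := by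
  change ‖((etaMap H Λ ξ₀ ε ξ - etaMap H Λ ξ₀ ε ξ' : realSpan Λ) : Freq d)‖ = _
  rw [Submodule.coe_sub, etaMap_coe, etaMap_coe,
    sigmaMap_eq_of_sub_mem hdecomp hξ hξ' hl]
  congr 1
  abel

theorem sigmaMap_of_mem_resonantSet
    (hdecomp : ∀ ξ ∈ Metric.ball ξ₀ r, ∃! σ, IsBasePoint H Λ ξ₀ ε ξ σ) (hrε : r ≤ ε) {ξ : Freq d}
    (hξ : ξ ∈ Metric.ball ξ₀ r) (hI : ξ ∈ resonantSet H Λ) : sigmaMap H Λ ξ₀ ε ξ = ξ :=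
  (hdecomp ξ hξ).unique (isBasePoint_sigmaMap hdecomp hξ)
    ⟨hI, Metric.ball_subset_ball hrε hξ, by rw [sub_self]; exact zero_mem _⟩

end Leaves

/-! ### Rescaled symbols -/

section Rescaled

variable {Λ : Submodule ℤ (Fin d → ℤ)} {ξ₀ : Freq d} {r : ℝ}
  {a : Torus d × Freq d × realSpan Λ → ℂ}

/-- A cutoff on `⟨Λ⟩`, with constants. -/
structure IsCutoff (χ : realSpan Λ → ℝ) (c₀ C₀ Cχ : ℝ) : Prop where
  smooth : ContDiff ℝ ∞ χ
  nonneg : ∀ η, 0 ≤ χ η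
  c_pos : 0 < c₀
  C_pos : 0 < C₀
  eq_one : ∀ η, ‖η‖ < c₀ → χ η = 1
  eq_zero : ∀ η, C₀ < ‖η‖ → χ η = 0
  le : ∀ η, χ η ≤ Cχ
  lipschitz : ∀ η η', |χ η - χ η'| ≤ Cχ * ‖η - η'‖

theorem exists_isCutoff {χ : realSpan Λ → ℝ} (hχ : ContDiff ℝ ∞ χ) (hχc : HasCompactSupport χ)
    (hχ0 : ∀ η, 0 ≤ χ η) (hχ1 : ∀ᶠ η in 𝓝 0, χ η = 1) : ∃ c₀ C₀ Cχ, IsCutoff χ c₀ C₀ Cχ := by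
  obtain ⟨c₀, hc₀, hc⟩ := Metric.eventually_nhds_iff.1 hχ1
  obtain ⟨C₀, hC₀⟩ := hχc.isCompact.isBounded.subset_closedBall 0
  obtain ⟨B, hB⟩ := hχc.exists_bound_of_continuous hχ.continuous
  obtain ⟨L, hL⟩ := ContDiff.lipschitzWith_of_hasCompactSupport hχc hχ (by simp)
  refine ⟨c₀, max C₀ 1, max B L, hχ, hχ0, hc₀, lt_max_of_lt_right one_pos,
    fun η hη => hc (by simpa using hη), fun η hη => ?_, fun η => ?_, fun η η' => ?_⟩
  · by_contra h
    have := hC₀ (subset_tsupport _ h)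
    rw [mem_closedBall_zero_iff] at this
    exact absurd (lt_of_le_of_lt (le_max_left _ _) hη) (not_lt.2 this)
  · exact (le_abs_self _).trans ((hB η).trans (le_max_left _ _))
  · have := hL.dist_le_mul η η'
    rw [dist_eq_norm, dist_eq_norm, Real.norm_eq_abs] at this
    exact this.trans (mul_le_mul_of_nonneg_right (le_max_right _ _) (norm_nonneg _))

/-- `a(x, ξ, Rη) (1 - χ(η))`. -/
def rescaledSymbol (χ : realSpan Λ → ℝ) (R : ℝ) (a : Torus d × Freq d × realSpan Λ → ℂ) :
    Torus d × Freq d × realSpan Λ → ℂ :=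
  fun p => a (p.1, p.2.1, R • p.2.2) * ((1 - χ p.2.2 : ℝ) : ℂ)

theorem isSymbol_rescaledSymbol (ha : IsSymbol Λ ξ₀ r a) {χ : realSpan Λ → ℝ} {c₀ C₀ Cχ : ℝ}
    (hχ : IsCutoff χ c₀ C₀ Cχ) {R : ℝ} (hR : 0 < R) :
    IsSymbol Λ ξ₀ r (rescaledSymbol χ R a) := by
  refine ⟨?_, ?_, ?_, fun k hk ξ η => ?_⟩
  · have h1 : ContDiff ℝ ∞ fun p : Freq d × Freq d × realSpan Λ =>
        ((p.1, p.2.1, R • p.2.2) : Freq d × Freq d × realSpan Λ) := by fun_prop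
    have h2 : ContDiff ℝ ∞ fun p : Freq d × Freq d × realSpan Λ => ((1 - χ p.2.2 : ℝ) : ℂ) :=
      Complex.ofRealCLM.contDiff.comp (contDiff_const.sub
        (hχ.smooth.comp (contDiff_snd.comp contDiff_snd)))
    exact (ha.smooth.comp h1).mul h2
  · obtain ⟨K, hK, hKr, hKa⟩ := ha.compactSupport
    exact ⟨K, hK, hKr, fun x ξ η hξ => by simp [rescaledSymbol, hKa x ξ _ hξ]⟩
  · obtain ⟨R₀, hR₀, ahom, hhom⟩ := ha.homogeneous
    refine ⟨max (R₀ / R) C₀, lt_max_of_lt_right hχ.C_pos, ahom, fun x ξ η hη => ?_⟩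
    have h1 : R₀ < ‖R • η‖ := by
      rw [norm_smul, Real.norm_of_nonneg hR.le, ← div_lt_iff₀' hR]
      exact (le_max_left _ _).trans_lt hη
    have h2 : (‖R • η‖)⁻¹ • R • η = ‖η‖⁻¹ • η := by
      rw [norm_smul, Real.norm_of_nonneg hR.le, smul_smul]
      congr 1
      field_simp
    simp only [rescaledSymbol, hχ.eq_zero η ((le_max_right _ _).trans_lt hη), hhom x ξ _ h1, h2]
    simp
  · simp only [rescaledSymbol, fourierCoef_mul_const, ha.modes k hk, zero_mul]

/-- Where `1 - χ(ζ) ≠ 0` with `ζ = τη/R`, one has `|ζ| ≥ c₀`, so `R₁ζ` is in the homogeneous region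
and `a` takes the same value at `τη` and at `R₁ζ`. The large parameters then enter only through `ζ`,
and one fixed symbol supplies bounds uniform in `τ` and `R ≥ R₁`. -/
theorem truncatedSymbol_eq (H : Freq d → ℝ) (ε : ℝ) {R₀ r' : ℝ} (hR₀ : 0 < R₀)
    (he : HasExtent ξ₀ a r' R₀) {χ : realSpan Λ → ℝ} {c₀ C₀ Cχ : ℝ} (hχ : IsCutoff χ c₀ C₀ Cχ)
    {τ R R₁ δ : ℝ} (hR₁ : R₀ < R₁ * c₀) (hR : R₁ ≤ R) (x : Torus d) (ξ : Freq d) :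
    truncatedSymbol H Λ ξ₀ ε χ τ R δ a (x, ξ) =
      rescaledSymbol χ R₁ a (x, ξ, (τ / R) • etaMap H Λ ξ₀ ε ξ) *
        ((χ (δ⁻¹ • etaMap H Λ ξ₀ ε ξ) : ℝ) : ℂ) := by
  have hR₁0 : 0 < R₁ := pos_of_mul_pos_left (hR₀.trans hR₁) hχ.c_pos.le
  have hR0 : 0 < R := hR₁0.trans_le hR
  simp only [truncatedSymbol, rescaledSymbol]
  set η := etaMap H Λ ξ₀ ε ξ
  have h1 : R⁻¹ • τ • η = (τ / R) • η := by rw [smul_smul]; congr 1; ring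
  rw [h1]
  set ζ := (τ / R) • η with hζ
  have h2 : τ • η = (R / R₁) • R₁ • ζ := by
    rw [hζ, smul_smul, smul_smul]; congr 1; field_simp
  by_cases hζc : ‖ζ‖ < c₀
  · rw [hχ.eq_one ζ hζc]; simp
  · push Not at hζc
    have h4 : ‖R₁ • ζ‖ = R₁ * ‖ζ‖ := by rw [norm_smul, Real.norm_of_nonneg hR₁0.le]
    have h3 : R₀ < ‖R₁ • ζ‖ := by
      rw [h4]
      exact hR₁.trans_le (mul_le_mul_of_nonneg_left hζc hR₁0.le)
    rw [h2, he.homogeneous x ξ (R₁ • ζ) (R / R₁) h3 (h3.trans_le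
      (le_mul_of_one_le_left (norm_nonneg _) ((one_le_div hR₁0).2 hR)))]
    push_cast
    ring

theorem IsSymbol.exists_lipschitz (ha : IsSymbol Λ ξ₀ r a) : ∃ B : ℝ, 0 ≤ B ∧
    ∀ x ξ ξ' η, ‖a (x, ξ, η) - a (x, ξ', η)‖ ≤ B * ‖ξ - ξ'‖ := by
  obtain ⟨B, hB0, hB⟩ := ha.exists_iteratedFDeriv_bound 1
  refine ⟨B, hB0, fun x ξ ξ' η => ?_⟩
  obtain ⟨y, rfl⟩ := isOpenQuotientMap_proj.surjective x
  have := norm_foldr_fdiff_le [((0, ξ - ξ', 0) : Freq d × Freq d × realSpan Λ)] ha.smooth hB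
    (y, ξ', η)
  simpa [fdiff, symbolLift, Prod.norm_def] using this

end Rescaled

end

section


variable {d : ℕ} {H : Freq d → ℝ} {Λ : Submodule ℤ (Fin d → ℤ)} {ξ₀ : Freq d} {r ε : ℝ}
  {a : Torus d × Freq d × realSpan Λ → ℂ}

/-! ### Positivity -/

theorem IsCutoff.one_le {χ : realSpan Λ → ℝ} {c₀ C₀ Cχ : ℝ} (hχ : IsCutoff χ c₀ C₀ Cχ) :
    1 ≤ Cχ := by
  rw [← hχ.eq_one 0 (by simpa using hχ.c_pos)]; exact hχ.le 0

/-- The pointwise lower bound for the truncated symbol, outside a shell of the variable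
`(τ/R) η(ξ)`. -/
theorem re_truncatedSymbol_lower_bound
    (hdecomp : ∀ ξ ∈ Metric.ball ξ₀ r, ∃! σ, IsBasePoint H Λ ξ₀ ε ξ σ)
    {χ : realSpan Λ → ℝ} {c₀ C₀ Cχ : ℝ} (hχ : IsCutoff χ c₀ C₀ Cχ)
    {R₀ r' : ℝ} (hR₀ : 0 < R₀) (hr' : r' < r) (he : HasExtent ξ₀ a r' R₀)
    (hpos : ∀ x ξ η, ξ ∈ resonantSet H Λ → ξ ∈ Metric.ball ξ₀ r → R₀ < ‖η‖ → 0 ≤ (a (x, ξ, η)).re)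
    {R₁ : ℝ} (hR₁ : R₀ < R₁ * c₀) {B₁ : ℝ}
    (hB₁0 : 0 ≤ B₁) (hB₁ : ∀ x ξ ξ' η, ‖rescaledSymbol χ R₁ a (x, ξ, η) -
      rescaledSymbol χ R₁ a (x, ξ', η)‖ ≤ B₁ * ‖ξ - ξ'‖)
    {Ba : ℝ} (hBa0 : 0 ≤ Ba) (hBa : ∀ p, ‖a p‖ ≤ Ba) {τ R δ : ℝ} (hτ : 0 < τ) (hR : R₁ ≤ R)
    (hδ : 0 < δ) (x : Torus d) (ξ : Freq d) :
    (ξ ∈ Metric.ball ξ₀ r ∧ c₀ ≤ τ / R * ‖etaMap H Λ ξ₀ ε ξ‖ ∧ τ / R * ‖etaMap H Λ ξ₀ ε ξ‖ ≤ C₀ ∧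
      -(B₁ * C₀ * Cχ * δ + Ba * Cχ * Cχ) ≤ (truncatedSymbol H Λ ξ₀ ε χ τ R δ a (x, ξ)).re) ∨
    -(B₁ * C₀ * Cχ * δ) ≤ (truncatedSymbol H Λ ξ₀ ε χ τ R δ a (x, ξ)).re := by
  have hR₁0 : 0 < R₁ := pos_of_mul_pos_left (hR₀.trans hR₁) hχ.c_pos.le
  have hR0 : 0 < R := hR₁0.trans_le hR
  have hCχ : 0 ≤ Cχ := zero_le_one.trans hχ.one_le
  have hC₀ := hχ.C_pos
  rw [truncatedSymbol_eq H ε hR₀ he hχ hR₁ hR]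
  set η := etaMap H Λ ξ₀ ε ξ with hη
  have hnorm : ‖(τ / R) • η‖ = τ / R * ‖η‖ := by
    rw [norm_smul, Real.norm_of_nonneg (by positivity)]
  rw [← hnorm]
  set ζ := (τ / R) • η with hζ
  have hzero : ∀ ξ' ζ', ξ' ∉ Metric.ball ξ₀ r → rescaledSymbol χ R₁ a (x, ξ', ζ') = 0 := by
    intro ξ' ζ' hξ'
    rw [rescaledSymbol, he.eq_zero x ξ' _ (hr'.trans_le (by simpa using hξ')), zero_mul]
  by_cases hξ : ξ ∈ Metric.ball ξ₀ r
  swap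
  · right
    rw [hzero ξ _ hξ]
    simp only [zero_mul, Complex.zero_re]
    have : 0 ≤ B₁ * C₀ * Cχ * δ := by positivity
    linarith
  set s := χ (δ⁻¹ • η) with hs
  have hs0 : 0 ≤ s := hχ.nonneg _
  have hs1 : s ≤ Cχ := hχ.le _
  by_cases hs' : s = 0
  · right
    rw [hs']
    simp only [Complex.ofReal_zero, mul_zero, Complex.zero_re]
    have : 0 ≤ B₁ * C₀ * Cχ * δ := by positivity
    linarith
  -- On the support of the cutoff in `η/δ`, moving from `ξ` to `σ(ξ)`, where positivity is known,
  -- costs `O(δ)`.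
  have hηδ : ‖η‖ ≤ C₀ * δ := by
    by_contra hcon
    push Not at hcon
    apply hs'
    refine hχ.eq_zero _ ?_
    rw [norm_smul, norm_inv, Real.norm_of_nonneg hδ.le, inv_mul_eq_div, lt_div_iff₀ hδ]
    exact hcon
  set σ := sigmaMap H Λ ξ₀ ε ξ with hσ
  have hσI : σ ∈ resonantSet H Λ := (isBasePoint_sigmaMap hdecomp hξ).1
  have hdiff : ‖rescaledSymbol χ R₁ a (x, ξ, ζ) - rescaledSymbol χ R₁ a (x, σ, ζ)‖ ≤
      B₁ * (C₀ * δ) := by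
    refine (hB₁ x ξ σ ζ).trans (mul_le_mul_of_nonneg_left ?_ hB₁0)
    have : ‖ξ - σ‖ = ‖η‖ := rfl
    rw [this]; exact hηδ
  have hre : (rescaledSymbol χ R₁ a (x, σ, ζ)).re - B₁ * (C₀ * δ) ≤
      (rescaledSymbol χ R₁ a (x, ξ, ζ)).re := by
    have h1 := (Complex.abs_re_le_norm _).trans hdiff
    rw [Complex.sub_re] at h1
    linarith [(abs_le.1 h1).1]
  have key : ∀ E : ℝ, 0 ≤ E → -E ≤ (rescaledSymbol χ R₁ a (x, σ, ζ)).re →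
      -(B₁ * C₀ * Cχ * δ + E * Cχ) ≤
        (rescaledSymbol χ R₁ a (x, ξ, ζ) * ((s : ℝ) : ℂ)).re := by
    intro E hE h1
    rw [Complex.re_mul_ofReal]
    have h2 : -(B₁ * (C₀ * δ) + E) ≤ (rescaledSymbol χ R₁ a (x, ξ, ζ)).re := by linarith
    have h3 := mul_le_mul_of_nonneg_right h2 hs0
    have h4 : (B₁ * (C₀ * δ) + E) * s ≤ (B₁ * (C₀ * δ) + E) * Cχ :=
      mul_le_mul_of_nonneg_left hs1 (by positivity)
    linarith
  have hrescaled : (rescaledSymbol χ R₁ a (x, σ, ζ)).re = (a (x, σ, R₁ • ζ)).re * (1 - χ ζ) := by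
    rw [rescaledSymbol, Complex.re_mul_ofReal]
  by_cases hζ1 : ‖ζ‖ < c₀
  · right
    have := key 0 le_rfl (by rw [hrescaled, hχ.eq_one ζ hζ1]; simp)
    simpa using this
  push Not at hζ1
  have hpos' : 0 ≤ (a (x, σ, R₁ • ζ)).re := by
    -- The base point lies in `B(ξ₀, ε)` only; if it leaves the smaller ball, `a` vanishes there.
    by_cases hσb : σ ∈ Metric.ball ξ₀ r
    · refine hpos x σ _ hσI hσb ?_
      rw [norm_smul, Real.norm_of_nonneg hR₁0.le]
      exact hR₁.trans_le (mul_le_mul_of_nonneg_left hζ1 hR₁0.le)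
    · rw [he.eq_zero x σ _ (hr'.trans_le (by simpa using hσb))]; simp
  -- Only in this shell can `1 - χ` be negative, as `χ` may exceed `1`; beyond it `1 - χ = 1`.
  by_cases hζ2 : ‖ζ‖ ≤ C₀
  · left
    refine ⟨hξ, hζ1, hζ2, key (Ba * Cχ) (by positivity) ?_⟩
    rw [hrescaled]
    have h1 : (a (x, σ, R₁ • ζ)).re ≤ Ba := (Complex.re_le_norm _).trans (hBa _)
    have h2 := hχ.le ζ
    have h3 := hχ.nonneg ζ
    nlinarith [mul_le_mul h1 h2 h3 hBa0]
  · right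
    push Not at hζ2
    have := key 0 le_rfl (by rw [hrescaled, hχ.eq_zero ζ hζ2]; linarith)
    simpa using this

-- An inequality of Gårding type, obtained from `re_quadraticForm_lower_bound` with the symbol
-- frozen at `hp`. The order of the constants matters: `κ` determines the Følner set, hence its size
-- `K`, and only then must `hK` and `(τ/R)hK` be small. The possible negative part of `1 - χ` is
-- kept as the mass of a shell.
set_option maxHeartbeats 400000 in
open Classical in
theorem exists_wigner_lower_bound
    (hdecomp : ∀ ξ ∈ Metric.ball ξ₀ r, ∃! σ, IsBasePoint H Λ ξ₀ ε ξ σ)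
    {χ : realSpan Λ → ℝ} {c₀ C₀ Cχ : ℝ} (hχ : IsCutoff χ c₀ C₀ Cχ) (ha : IsSymbol Λ ξ₀ r a)
    {R₀ : ℝ} (hpos : ∀ x ξ η, ξ ∈ resonantSet H Λ → ξ ∈ Metric.ball ξ₀ r → R₀ < ‖η‖ →
      0 ≤ (a (x, ξ, η)).re) :
    ∃ C ≥ 0, ∃ c₁ > 0, ∃ C₁ R₁ : ℝ, 0 < R₁ ∧ ∀ κ > 0, ∃ K ≥ 0, ∃ ρ > 0, ∀ h τ R δ : ℝ,
      0 < h → 0 < τ → R₁ ≤ R → 0 < δ → h * K < ρ → τ / R * (h * K) ≤ ρ →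
      ∀ c : (Fin d → ℤ) → ℂ, (∀ k ∉ freqSupport h ξ₀ r, c k = 0) →
      -((∑ k ∈ freqSupport h ξ₀ r, ‖c k‖ ^ 2) *
          (κ + C * δ + C * (h * K * (1 + τ / R + 1 / δ)))) -
        C * (∑ k ∈ freqSupport h ξ₀ r with
          c₁ ≤ τ / R * ‖etaMap H Λ ξ₀ ε (h • latticeVec k)‖ ∧
            τ / R * ‖etaMap H Λ ξ₀ ε (h • latticeVec k)‖ ≤ C₁, ‖c k‖ ^ 2) ≤
        (wigner h c (truncatedSymbol H Λ ξ₀ ε χ τ R δ a)).re := by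
  obtain ⟨r', hr', R₀', hR₀', he'⟩ := ha.exists_hasExtent
  set R₂ := max R₀ R₀' with hR₂
  have hR₂0 : 0 < R₂ := lt_max_of_lt_right hR₀'
  have he : HasExtent ξ₀ a r' R₂ := he'.mono le_rfl (le_max_right _ _)
  have hc₀ := hχ.c_pos
  have hC₀ := hχ.C_pos
  have hCχ : 0 < Cχ := zero_lt_one.trans_le hχ.one_le
  -- Chosen so that `R₂ < R₁ c₀`, as `truncatedSymbol_eq` requires.
  set R₁ := (R₂ + 1) / c₀ with hR₁
  have hR₁0 : 0 < R₁ := by positivity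
  have hR₁c : R₂ < R₁ * c₀ := by rw [hR₁, div_mul_cancel₀ _ hc₀.ne']; linarith
  have hã := isSymbol_rescaledSymbol ha hχ hR₁0
  obtain ⟨w, hw, hw0, hwΛ, hwb, hwl⟩ := hã.exists_weight
  obtain ⟨B₁, hB₁0, hB₁⟩ := hã.exists_lipschitz
  obtain ⟨Ba, hBa0, hBa⟩ := ha.exists_bound
  have hw' : Summable fun m => Cχ * w m := hw.mul_left _
  have hw'0 : ∀ m, 0 ≤ Cχ * w m := fun m => mul_nonneg hCχ.le (hw0 m)
  have hT0 : 0 ≤ ∑' m, Cχ * w m := tsum_nonneg hw'0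
  set T := ∑' m, Cχ * w m with hT
  set C := B₁ * C₀ * Cχ + Ba * Cχ * Cχ + charNorm d * T with hC
  have hN := charNorm_pos (d := d)
  have hE1 : 0 ≤ B₁ * C₀ * Cχ := by positivity
  have hE2 : 0 ≤ Ba * Cχ * Cχ := by positivity
  have hE3 : 0 ≤ charNorm d * T := by positivity
  -- The shell is enlarged by `c₀/2` on each side: averaging over a window moves `(τ/R)|η|` by at
  -- most that much.
  refine ⟨C, by positivity, c₀ / 2, by positivity, C₀ + c₀ / 2, R₁, hR₁0, fun κ hκ => ?_⟩
  obtain ⟨B, hBne, hBΛ, hBlim⟩ := exists_folner_sequence Λ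
  -- The overlaps tend to `1` for `m ∈ Λ`, the weight vanishes for `m ∉ Λ`, and dominated
  -- convergence makes the total overlap defect small.
  have hlim : Tendsto (fun L => charNorm d * ∑' m, Cχ * w m * (1 - overlap (B L) m)) atTop
      (𝓝 (charNorm d * ∑' m : Fin d → ℤ, 0)) := by
    refine (tendsto_tsum_of_dominated_convergence (bound := fun m => Cχ * w m) hw' (fun m => ?_)
      (Eventually.of_forall fun L m => ?_)).const_mul _
    · by_cases hm : m ∈ Λ
      · have := ((hBlim m hm).const_sub 1).const_mul (Cχ * w m)
        simp only [sub_self, mul_zero] at this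
        exact this
      · simp [hwΛ m hm]
    · have h1 := overlap_le_one (B L) m
      have h2 := overlap_nonneg (B L) m
      rw [Real.norm_of_nonneg (mul_nonneg (hw'0 m) (by linarith))]
      exact mul_le_of_le_one_right (hw'0 m) (by linarith)
  rw [tsum_zero, mul_zero] at hlim
  obtain ⟨L, hL⟩ := (hlim.eventually (gt_mem_nhds hκ)).exists
  set K := ∑ β ∈ B L, ‖latticeVec β‖ with hK
  have hK0 : 0 ≤ K := Finset.sum_nonneg fun _ _ => norm_nonneg _
  have hKle : ∀ β ∈ B L, ‖latticeVec β‖ ≤ K := fun β hβ =>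
    Finset.single_le_sum (f := fun β => ‖latticeVec β‖) (fun _ _ => norm_nonneg _) hβ
  have hspan : ∀ β ∈ B L, latticeVec β ∈ realSpan Λ := fun β hβ =>
    Submodule.subset_span ⟨β, hBΛ L β hβ, rfl⟩
  -- The bound `r - r'` handles windows centred outside the ball, and `c₀/2` the enlargement of the
  -- shell.
  refine ⟨K, hK0, min (r - r') (c₀ / 2), lt_min (by linarith) (by positivity), ?_⟩
  intro h τ R δ hh hτ hR hδ hhK hτK c hc
  have hR0 : 0 < R := hR₁0.trans_le hR
  set S := freqSupport h ξ₀ r with hS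
  have hSball : ∀ k ∈ S, h • latticeVec k ∈ Metric.ball ξ₀ r := fun k hk => (mem_freqSupport hh).1 hk
  set b := truncatedSymbol H Λ ξ₀ ε χ τ R δ a with hb
  have hbeq : ∀ x ξ, b (x, ξ) = rescaledSymbol χ R₁ a (x, ξ, (τ / R) • etaMap H Λ ξ₀ ε ξ) *
      ((χ (δ⁻¹ • etaMap H Λ ξ₀ ε ξ) : ℝ) : ℂ) :=
    truncatedSymbol_eq H ε hR₂0 he hχ hR₁c hR
  have hbcoef : ∀ ξ m, fourierCoef (fun x => b (x, ξ)) m =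
      fourierCoef (fun x => rescaledSymbol χ R₁ a (x, ξ, (τ / R) • etaMap H Λ ξ₀ ε ξ)) m *
        ((χ (δ⁻¹ • etaMap H Λ ξ₀ ε ξ) : ℝ) : ℂ) := by
    intro ξ m
    simp only [hbeq, fourierCoef_mul_const]
  have hbcont : ∀ ξ, Continuous fun x => b (x, ξ) := by
    intro ξ
    simp only [hbeq]
    exact (hã.continuous_slice _ _).mul continuous_const
  set e := h * K * (1 + τ / R + 1 / δ) with he_def
  have he0 : 0 ≤ e := by positivity
  have hhK0 : 0 ≤ h * K + τ / R * (h * K) := by positivity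
  let Sh : (Fin d → ℤ) → Prop := fun p => h • latticeVec p ∈ Metric.ball ξ₀ r ∧
    c₀ ≤ τ / R * ‖etaMap H Λ ξ₀ ε (h • latticeVec p)‖ ∧
      τ / R * ‖etaMap H Λ ξ₀ ε (h • latticeVec p)‖ ≤ C₀
  let q : (Fin d → ℤ) → ℝ := fun p => B₁ * C₀ * Cχ * δ + if Sh p then Ba * Cχ * Cχ else 0
  have hχnorm : ∀ η, ‖((χ η : ℝ) : ℂ)‖ ≤ Cχ := fun η => by
    rw [Complex.norm_real, Real.norm_of_nonneg (hχ.nonneg η)]; exact hχ.le η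
  have hmain := re_quadraticForm_lower_bound (S := S) (hBne L) c
    (M := fun j k => fourierCoef (fun x => b (x, (h / 2) • latticeVec (k + j))) (j - k))
    (g := fun p x => b (x, h • latticeVec p)) (fun p => hbcont _) hw' hw'0 he0 (q := q) ?_ ?_ ?_
  · rw [wigner_eq_sum hc]
    refine le_trans ?_ hmain
    have hq : ∀ k ∈ S, (∑ β ∈ B L, q (k - β)) / (B L).card ≤ B₁ * C₀ * Cχ * δ +
        if c₀ / 2 ≤ τ / R * ‖etaMap H Λ ξ₀ ε (h • latticeVec k)‖ ∧
            τ / R * ‖etaMap H Λ ξ₀ ε (h • latticeVec k)‖ ≤ C₀ + c₀ / 2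
        then Ba * Cχ * Cχ else 0 := by
      intro k hk
      rw [div_le_iff₀ (Nat.cast_pos.2 (hBne L).card_pos), mul_comm, ← nsmul_eq_mul]
      refine Finset.sum_le_card_nsmul _ _ _ fun β hβ => ?_
      refine add_le_add le_rfl ?_
      by_cases hsh : Sh (k - β)
      · rw [if_pos hsh]
        have hd : h • latticeVec k - h • latticeVec (k - β) = h • latticeVec β := by
          rw [latticeVec_sub, smul_sub]; abel
        have h1 := norm_etaMap_sub hdecomp (hSball k hk) hsh.1
          (by rw [hd]; exact Submodule.smul_mem _ _ (hspan β hβ))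
        rw [hd, norm_smul, Real.norm_of_nonneg hh.le] at h1
        have h2 : τ / R * (h * ‖latticeVec β‖) ≤ c₀ / 2 := by
          refine le_trans ?_ (hτK.trans (min_le_right _ _))
          gcongr
          exact hKle β hβ
        rw [← h1] at h2
        have h3 := norm_sub_norm_le (etaMap H Λ ξ₀ ε (h • latticeVec k))
          (etaMap H Λ ξ₀ ε (h • latticeVec (k - β)))
        have h4 := norm_sub_norm_le (etaMap H Λ ξ₀ ε (h • latticeVec (k - β)))
          (etaMap H Λ ξ₀ ε (h • latticeVec k))
        rw [norm_sub_rev] at h4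
        have h5 := mul_le_mul_of_nonneg_left h3 (show 0 ≤ τ / R by positivity)
        have h6 := mul_le_mul_of_nonneg_left h4 (show 0 ≤ τ / R by positivity)
        rw [mul_sub] at h5 h6
        have h7 := hsh.2.1
        have h8 := hsh.2.2
        rw [if_pos ⟨by linarith, by linarith⟩]
      · rw [if_neg hsh]
        split_ifs <;> first | exact hE2 | exact le_rfl
    have hsum1 : ∑ k ∈ S, ‖c k‖ ^ 2 * ((∑ β ∈ B L, q (k - β)) / (B L).card) ≤
        (∑ k ∈ S, ‖c k‖ ^ 2) * (B₁ * C₀ * Cχ * δ) + (Ba * Cχ * Cχ) *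
          (∑ k ∈ S with
          c₀ / 2 ≤ τ / R * ‖etaMap H Λ ξ₀ ε (h • latticeVec k)‖ ∧
            τ / R * ‖etaMap H Λ ξ₀ ε (h • latticeVec k)‖ ≤ C₀ + c₀ / 2, ‖c k‖ ^ 2) := by
      rw [Finset.sum_filter, Finset.mul_sum, Finset.sum_mul, ← Finset.sum_add_distrib]
      refine Finset.sum_le_sum fun k hk => ?_
      refine (mul_le_mul_of_nonneg_left (hq k hk) (sq_nonneg _)).trans (le_of_eq ?_)
      split_ifs <;> ring
    have hsum2 : charNorm d * ((∑ k ∈ S, ‖c k‖ ^ 2) *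
        ∑' m, Cχ * w m * (1 - overlap (B L) m + e)) ≤
        (∑ k ∈ S, ‖c k‖ ^ 2) * (κ + charNorm d * T * e) := by
      have h1 : ∑' m, Cχ * w m * (1 - overlap (B L) m + e) =
          (∑' m, Cχ * w m * (1 - overlap (B L) m)) + T * e := by
        rw [hT, ← tsum_mul_right, ← Summable.tsum_add]
        · simp only [mul_add]
        · refine Summable.of_nonneg_of_le (fun m => mul_nonneg (hw'0 m) ?_) (fun m => ?_) hw'
          · linarith [overlap_le_one (B L) m]
          · exact mul_le_of_le_one_right (hw'0 m) (by linarith [overlap_nonneg (B L) m])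
        · exact hw'.mul_right e
      rw [h1, mul_left_comm]
      refine mul_le_mul_of_nonneg_left ?_ (Finset.sum_nonneg fun _ _ => sq_nonneg _)
      rw [mul_add]
      linarith
    have hmass0 : 0 ≤ ∑ k ∈ S, ‖c k‖ ^ 2 := Finset.sum_nonneg fun _ _ => sq_nonneg _
    have hF0 : 0 ≤ ∑ k ∈ S with
          c₀ / 2 ≤ τ / R * ‖etaMap H Λ ξ₀ ε (h • latticeVec k)‖ ∧
            τ / R * ‖etaMap H Λ ξ₀ ε (h • latticeVec k)‖ ≤ C₀ + c₀ / 2, ‖c k‖ ^ 2 :=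
      Finset.sum_nonneg fun _ _ => sq_nonneg _
    have hA1 : (∑ k ∈ S, ‖c k‖ ^ 2) * (B₁ * C₀ * Cχ * δ + charNorm d * T * e) ≤
        (∑ k ∈ S, ‖c k‖ ^ 2) * (C * δ + C * e) := by
      refine mul_le_mul_of_nonneg_left (add_le_add ?_ ?_) hmass0
      · exact mul_le_mul_of_nonneg_right (by rw [hC]; linarith) hδ.le
      · exact mul_le_mul_of_nonneg_right (by rw [hC]; linarith) he0
    have hA2 := mul_le_mul_of_nonneg_right (show Ba * Cχ * Cχ ≤ C by rw [hC]; linarith) hF0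
    linarith
  · intro j _ k _
    rw [hbcoef, norm_mul, mul_comm]
    exact mul_le_mul (hχnorm _) (hwb _ _ _) (norm_nonneg _) hCχ.le
  · intro j hj k hk p hjp hkp
    have hmid : (h / 2) • latticeVec (k + j) ∈ Metric.ball ξ₀ r := by
      have h1 := (convex_ball ξ₀ r) (hSball k hk) (hSball j hj) (a := 1 / 2) (b := 1 / 2)
        (by norm_num) (by norm_num) (by norm_num)
      have h2 : (h / 2) • latticeVec (k + j) =
          (1 / 2 : ℝ) • h • latticeVec k + (1 / 2 : ℝ) • h • latticeVec j := by
        rw [latticeVec_add, smul_add, smul_smul, smul_smul]; congr 2 <;> ring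
      rw [h2]; exact h1
    -- With `j - p` and `k - p` in `B`, the midpoint `h(j + k)/2` is on the leaf of `hp`, at
    -- distance at most `hK`.
    have hd : (h / 2) • latticeVec (k + j) - h • latticeVec p =
        (h / 2) • (latticeVec (k - p) + latticeVec (j - p)) := by
      rw [← latticeVec_add, show k - p + (j - p) = (k + j) - (p + p) by abel, latticeVec_sub,
        smul_sub, latticeVec_add p p, smul_add (h / 2) (latticeVec p), ← add_smul, add_halves]
    have hdn : ‖(h / 2) • latticeVec (k + j) - h • latticeVec p‖ ≤ h * K := by
      rw [hd, norm_smul, Real.norm_of_nonneg (by positivity)]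
      have := norm_add_le (latticeVec (k - p)) (latticeVec (j - p))
      have h1 := hKle _ hkp
      have h2 := hKle _ hjp
      calc h / 2 * ‖latticeVec (k - p) + latticeVec (j - p)‖ ≤ h / 2 * (K + K) := by gcongr; linarith
        _ = h * K := by ring
    simp only [hbcoef]
    set ξ := (h / 2) • latticeVec (k + j) with hξ
    set ξ' := h • latticeVec p with hξ'
    by_cases hp : ξ' ∈ Metric.ball ξ₀ r
    · have hη := norm_etaMap_sub hdecomp hmid hp (by
        rw [hd]; exact Submodule.smul_mem _ _ (add_mem (hspan _ hkp) (hspan _ hjp)))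
      set η := etaMap H Λ ξ₀ ε ξ
      set η' := etaMap H Λ ξ₀ ε ξ'
      set F := fourierCoef (fun x => rescaledSymbol χ R₁ a (x, ξ, (τ / R) • η)) (j - k)
      set F' := fourierCoef (fun x => rescaledSymbol χ R₁ a (x, ξ', (τ / R) • η')) (j - k)
      have h1 : ‖F - F'‖ ≤ w (j - k) * (h * K + τ / R * (h * K)) := by
        refine (hwl _ _ _ _ _).trans (mul_le_mul_of_nonneg_left ?_ (hw0 _))
        rw [← smul_sub, norm_smul, Real.norm_of_nonneg (by positivity), hη]
        gcongr
      have h2 : ‖((χ (δ⁻¹ • η) : ℝ) : ℂ) - ((χ (δ⁻¹ • η') : ℝ) : ℂ)‖ ≤ Cχ * (1 / δ * (h * K)) := by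
        rw [← Complex.ofReal_sub, Complex.norm_real, Real.norm_eq_abs]
        refine (hχ.lipschitz _ _).trans (mul_le_mul_of_nonneg_left ?_ hCχ.le)
        rw [← smul_sub, norm_smul, Real.norm_of_nonneg (by positivity), hη, one_div]
        gcongr
      have h3 : F * ((χ (δ⁻¹ • η) : ℝ) : ℂ) - F' * ((χ (δ⁻¹ • η') : ℝ) : ℂ) =
          (F - F') * ((χ (δ⁻¹ • η) : ℝ) : ℂ) +
            F' * (((χ (δ⁻¹ • η) : ℝ) : ℂ) - ((χ (δ⁻¹ • η') : ℝ) : ℂ)) := by ring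
      rw [h3]
      refine (norm_add_le _ _).trans ?_
      rw [norm_mul, norm_mul]
      have h4 := mul_le_mul h1 (hχnorm (δ⁻¹ • η)) (norm_nonneg _)
        (mul_nonneg (hw0 (j - k)) hhK0)
      have h5 := mul_le_mul (hwb (j - k) ξ' ((τ / R) • η')) h2 (norm_nonneg _) (hw0 _)
      refine (add_le_add h4 h5).trans (le_of_eq ?_)
      rw [he_def]; ring
    -- Outside the ball `η` is not controlled; but then the midpoint is already beyond radius `r'`,
    -- and both coefficients vanish.
    · have hp' : r ≤ dist ξ' ξ₀ := by simpa using hp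
      have hdist : r' < dist ξ ξ₀ := by
        have h1 := dist_triangle_left ξ' ξ₀ ξ
        rw [dist_eq_norm ξ ξ'] at h1
        have h2 := hhK.trans_le (min_le_left _ _)
        linarith
      have hz : ∀ y ζ, r' < dist y ξ₀ →
          fourierCoef (fun x => rescaledSymbol χ R₁ a (x, y, ζ)) (j - k) = 0 := by
        intro y ζ hy
        have : ∀ x, rescaledSymbol χ R₁ a (x, y, ζ) = 0 := fun x => by
          rw [rescaledSymbol, he.eq_zero x y _ hy, zero_mul]
        simp [this, fourierCoef]
      rw [hz ξ _ hdist, hz ξ' _ (hr'.trans_le hp'), zero_mul, zero_mul, sub_zero, norm_zero]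
      exact mul_nonneg he0 (hw'0 _)
  · intro p x
    have := re_truncatedSymbol_lower_bound hdecomp hχ hR₂0 hr' he
      (fun x ξ η h1 h2 h3 => hpos x ξ η h1 h2 ((le_max_left _ _).trans_lt h3)) hR₁c hB₁0 hB₁ hBa0
      hBa hτ hR hδ x (h • latticeVec p)
    simp only [q]
    rcases this with ⟨h1, h2, h3, h4⟩ | h1
    · rw [if_pos (show Sh p from ⟨h1, h2, h3⟩)]; exact h4
    · refine le_trans ?_ h1
      split_ifs <;> linarith

end

section


/-! ### Iterated limits -/

/-- Since the inner limits exist, a bound along infinitely many `m` and `n` is enough; the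
pigeonhole on shells provides nothing more. -/
theorem HasIteratedLimit.re_nonneg {F : ℕ → ℕ → ℕ → ℂ} {z : ℂ} (hF : HasIteratedLimit F z)
    (h : ∀ κ > 0, ∀ᶠ l in atTop, ∃ᶠ m in atTop, ∃ᶠ n in atTop, -κ ≤ (F n m l).re) : 0 ≤ z.re := by
  obtain ⟨G, K, hG, hK, hz⟩ := hF
  have key : ∀ κ > 0, -κ ≤ z.re := by
    intro κ hκ
    refine ge_of_tendsto ((Complex.continuous_re.tendsto z).comp hz) ?_
    filter_upwards [h κ hκ] with l hl
    refine ge_of_tendsto_of_frequently ((Complex.continuous_re.tendsto _).comp (hK l)) ?_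
    refine hl.mono fun m hm => ?_
    exact ge_of_tendsto_of_frequently ((Complex.continuous_re.tendsto _).comp (hG m l)) hm
  by_contra hcon
  push Not at hcon
  have := key (-z.re / 2) (by linarith)
  linarith

theorem HasIteratedLimit.norm_le {F : ℕ → ℕ → ℕ → ℂ} {z : ℂ} (hF : HasIteratedLimit F z) {C : ℝ}
    (h : ∀ κ > 0, ∀ᶠ l in atTop, ∀ᶠ m in atTop, ∀ᶠ n in atTop, ‖F n m l‖ ≤ C + κ) :
    ‖z‖ ≤ C := by
  obtain ⟨G, K, hG, hK, hz⟩ := hF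
  refine le_of_forall_pos_le_add fun κ hκ => ?_
  refine le_of_tendsto hz.norm ?_
  filter_upwards [h κ hκ] with l hl
  refine le_of_tendsto (hK l).norm ?_
  filter_upwards [hl] with m hm
  exact le_of_tendsto (hG m l).norm hm

/-! ### Disjoint shells -/

open Classical in
/-- A family of finite measures of bounded mass charges little some shell `c₁ ≤ s / R_m ≤ C₁`, for
infinitely many members of the family. -/
theorem frequently_shell_mass_lt {α : Type*} (S : ℕ → Finset α) (y s : ℕ → α → ℝ)
    (hy : ∀ n k, 0 ≤ y n k) {D : ℝ} (hD : ∀ n, ∑ k ∈ S n, y n k ≤ D) {c₁ C₁ : ℝ} (hc₁ : 0 < c₁)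
    {R : ℕ → ℝ} (hR : ∀ m, 0 < R m) (hR_top : Tendsto R atTop atTop) {κ : ℝ} (hκ : 0 < κ) :
    ∃ᶠ m in atTop, ∃ᶠ n in atTop,
      ∑ k ∈ S n with c₁ ≤ s n k / R m ∧ s n k / R m ≤ C₁, y n k < κ := by
  by_contra hcon
  rw [not_frequently] at hcon
  simp only [not_frequently, not_lt] at hcon
  obtain ⟨m₀, hm₀⟩ := eventually_atTop.1 hcon
  -- Since `R_m → ∞`, an index with `c₁ R_m > C₁ R_t` for all earlier `t` adds a shell disjoint from
  -- the previous ones.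
  have hT : ∀ J : ℕ, ∃ T : Finset ℕ, T.card = J ∧ (∀ m ∈ T, m₀ ≤ m) ∧
      ∀ m ∈ T, ∀ m' ∈ T, m ≠ m' → ∀ x : ℝ, c₁ ≤ x / R m → x / R m ≤ C₁ → c₁ ≤ x / R m' →
        x / R m' ≤ C₁ → False := by
    intro J
    induction J with
    | zero => exact ⟨∅, rfl, by simp, by simp⟩
    | succ J ih =>
      obtain ⟨T, hTc, hTm, hTd⟩ := ih
      have h1 : ∀ᶠ m in atTop, ∀ t ∈ T, C₁ * R t < c₁ * R m := by
        rw [Filter.eventually_all_finset]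
        intro t _
        exact (hR_top.const_mul_atTop hc₁).eventually_gt_atTop _
      obtain ⟨m, hm1, hm2⟩ := (h1.and (eventually_ge_atTop m₀)).exists
      have hdisj : ∀ t ∈ T, ∀ x : ℝ, x / R t ≤ C₁ → c₁ ≤ x / R m → False := by
        intro t ht x hx1 hx2
        rw [div_le_iff₀ (hR t)] at hx1
        rw [le_div_iff₀ (hR m)] at hx2
        linarith [hm1 t ht]
      by_cases hmT : m ∈ T
      · by_cases hcC : c₁ ≤ C₁
        · exact (hdisj m hmT (c₁ * R m) (by rw [mul_div_cancel_right₀ _ (hR m).ne']; exact hcC)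
            (by rw [mul_div_cancel_right₀ _ (hR m).ne'])).elim
        -- If `C₁ < c₁` the shell is empty, which already contradicts a mass at least `κ`.
        · obtain ⟨n, hn⟩ := (hm₀ m hm2).exists
          rw [Finset.filter_false_of_mem, Finset.sum_empty] at hn
          · linarith
          · rintro k - ⟨h3, h4⟩; exact hcC (h3.trans h4)
      · refine ⟨insert m T, by rw [Finset.card_insert_of_notMem hmT, hTc], ?_, ?_⟩
        · intro m' hm'
          rcases Finset.mem_insert.1 hm' with rfl | h
          · exact hm2
          · exact hTm m' h
        · intro m' hm' m'' hm'' hne x h3 h4 h5 h6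
          rcases Finset.mem_insert.1 hm' with rfl | h
          · rcases Finset.mem_insert.1 hm'' with rfl | h'
            · exact hne rfl
            · exact hdisj m'' h' x h6 h3
          · rcases Finset.mem_insert.1 hm'' with rfl | h'
            · exact hdisj m' h x h4 h5
            · exact hTd m' h m'' h' hne x h3 h4 h5 h6
  -- More than `D/κ` disjoint shells, each of mass at least `κ` for a common `n`, would exceed the
  -- total mass.
  obtain ⟨J, hJ⟩ := exists_nat_gt (D / κ)
  obtain ⟨T, hTc, hTm, hTd⟩ := hT J
  have h1 : ∀ᶠ n in atTop, ∀ m ∈ T,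
      κ ≤ ∑ k ∈ S n with c₁ ≤ s n k / R m ∧ s n k / R m ≤ C₁, y n k := by
    rw [Filter.eventually_all_finset]
    exact fun m hm => hm₀ m (hTm m hm)
  obtain ⟨n, hn⟩ := h1.exists
  have h2 : (J : ℝ) * κ ≤ ∑ m ∈ T, ∑ k ∈ S n with c₁ ≤ s n k / R m ∧ s n k / R m ≤ C₁, y n k := by
    rw [← hTc, ← nsmul_eq_mul]
    exact Finset.card_nsmul_le_sum _ _ _ hn
  rw [← Finset.sum_biUnion] at h2
  · have h3 : ∑ k ∈ T.biUnion (fun m => (S n).filter fun k => c₁ ≤ s n k / R m ∧ s n k / R m ≤ C₁),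
        y n k ≤ ∑ k ∈ S n, y n k :=
      Finset.sum_le_sum_of_subset_of_nonneg
        (Finset.biUnion_subset.2 fun m _ => Finset.filter_subset _ _) fun k _ _ => hy n k
    rw [div_lt_iff₀ hκ] at hJ
    linarith [hD n]
  · intro m hm m' hm' hne
    refine Finset.disjoint_left.2 fun k hk hk' => ?_
    have h3 := (Finset.mem_filter.1 hk).2
    have h4 := (Finset.mem_filter.1 hk').2
    exact hTd m hm m' hm' hne _ h3.1 h3.2 h4.1 h4.2

/-! ### Positivity and boundedness of the two-microlocal limit -/

/-- The semiclassical parameters `h_n → 0` and `τ_n → ∞`, with `h_n τ_n` bounded, and a bounded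
sequence localized in `B(ξ₀, r)`. -/
structure IsLocalizedFamily {d : ℕ} (ξ₀ : Freq d) (r : ℝ) (h τ : ℕ → ℝ)
    (u : ℕ → Lp ℂ 2 (volume : Measure (Torus d))) (M : ℝ) : Prop where
  h_pos : ∀ n, 0 < h n
  h_tendsto : Tendsto h atTop (𝓝 0)
  τ_pos : ∀ n, 0 < τ n
  mul_le : ∀ n, h n * τ n ≤ M
  norm_le : ∀ n, ‖u n‖ ≤ M
  localized : ∀ n (k : Fin d → ℤ), h n • latticeVec k ∉ Metric.ball ξ₀ r → fourierCoef (u n) k = 0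

variable {d : ℕ} {H : Freq d → ℝ} {Λ : Submodule ℤ (Fin d → ℤ)} {ξ₀ : Freq d} {r ε : ℝ}
  {h τ R δ : ℕ → ℝ} {u : ℕ → Lp ℂ 2 (volume : Measure (Torus d))} {M : ℝ}
  {χ : realSpan Λ → ℝ} {c₀ C₀ Cχ : ℝ} {μ : ℝ → SymbolSpace Λ ξ₀ r →ₗ[ℂ] ℂ}

namespace IsLocalizedFamily

theorem coef_eq_zero (hu : IsLocalizedFamily ξ₀ r h τ u M) (n : ℕ) :
    ∀ k ∉ freqSupport (h n) ξ₀ r, fourierCoef (u n) k = 0 := fun k hk =>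
  hu.localized n k fun hk' => hk ((mem_freqSupport (hu.h_pos n)).2 hk')

theorem propagatedCoef_eq_zero (hu : IsLocalizedFamily ξ₀ r h τ u M) (n : ℕ) (t : ℝ) :
    ∀ k ∉ freqSupport (h n) ξ₀ r, propagatedCoef H (h n) t (u n) k = 0 := fun k hk => by
  rw [propagatedCoef, hu.coef_eq_zero n k hk, mul_zero]

theorem nonneg (hu : IsLocalizedFamily ξ₀ r h τ u M) : 0 ≤ M :=
  (norm_nonneg _).trans (hu.norm_le 0)

theorem sum_sq_le (hu : IsLocalizedFamily ξ₀ r h τ u M) (n : ℕ) (S : Finset (Fin d → ℤ)) :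
    ∑ k ∈ S, ‖fourierCoef (u n) k‖ ^ 2 ≤ M ^ 2 :=
  (sum_norm_fourierCoef_sq_le (u n) S).trans
    (pow_le_pow_left₀ (norm_nonneg _) (hu.norm_le n) 2)

theorem integrable (hu : IsLocalizedFamily ξ₀ r h τ u M) (n : ℕ) (b : Torus d × Freq d → ℂ)
    {φ : ℝ → ℂ} (hφ : Integrable φ) :
    Integrable fun t : ℝ => φ t * wigner (h n) (propagatedCoef H (h n) (τ n * t) (u n)) b :=
  integrable_mul_wigner H (h n) (τ n) (u n) (hu.coef_eq_zero n) b hφ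

end IsLocalizedFamily

theorem IsTwoMicrolocalLimit.integrableOn
    (hμ : IsTwoMicrolocalLimit H Λ ξ₀ r ε χ h τ R δ u μ) (a : SymbolSpace Λ ξ₀ r) {s : Set ℝ}
    (hsv : volume s < ⊤) : IntegrableOn (fun t => μ t a) s := by
  obtain ⟨C, hC⟩ := hμ.bounded a
  have : IsFiniteMeasure (volume.restrict s) := ⟨by simpa using hsv⟩
  exact Integrable.of_bound (hμ.measurable a).restrict C (ae_restrict_of_ae hC)

theorem IsTwoMicrolocalLimit.limit_indicator
    (hμ : IsTwoMicrolocalLimit H Λ ξ₀ r ε χ h τ R δ u μ) (a : SymbolSpace Λ ξ₀ r) {s : Set ℝ}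
    (hs : MeasurableSet s) (hsv : volume s < ⊤) :
    HasIteratedLimit (fun n m l => ∫ t in s, wigner (h n) (propagatedCoef H (h n) (τ n * t) (u n))
        (truncatedSymbol H Λ ξ₀ ε χ (τ n) (R m) (δ l) a.1)) (∫ t in s, μ t a) := by
  have h1 := hμ.limit (s.indicator fun _ => 1)
    ((integrable_indicator_iff hs).2 (integrableOn_const hsv.ne)) a
  have h2 : ∀ f : ℝ → ℂ, ∫ t, s.indicator (fun _ => (1 : ℂ)) t * f t = ∫ t in s, f t := by
    intro f
    rw [← integral_indicator hs]
    refine integral_congr_ae (Eventually.of_forall fun t => ?_)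
    by_cases ht : t ∈ s <;> simp [ht]
  simp only [h2] at h1
  exact h1

theorem IsLocalizedFamily.integrableOn (hu : IsLocalizedFamily ξ₀ r h τ u M) (n : ℕ)
    (b : Torus d × Freq d → ℂ) {s : Set ℝ} (hs : MeasurableSet s) (hsv : volume s < ⊤) :
    IntegrableOn (fun t : ℝ => wigner (h n) (propagatedCoef H (h n) (τ n * t) (u n)) b) s := by
  have h1 := hu.integrable (H := H) n b (φ := s.indicator fun _ => 1)
    ((integrable_indicator_iff hs).2 (integrableOn_const hsv.ne))
  rw [← integrable_indicator_iff hs]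
  refine h1.congr (Eventually.of_forall fun t => ?_)
  by_cases ht : t ∈ s <;> simp [ht]

/-- It is enough to integrate over sets of times of finite measure. The loss in
`exists_wigner_lower_bound` is made small by choosing first `l` for `δ`, then `m` for `1/R` and the
shell, then `n` for `h`; the bound `hτ ≤ M` controls `(τ/R)hK`. -/
theorem IsTwoMicrolocalLimit.ae_re_nonneg
    (hdecomp : ∀ ξ ∈ Metric.ball ξ₀ r, ∃! σ, IsBasePoint H Λ ξ₀ ε ξ σ)
    (hχ : IsCutoff χ c₀ C₀ Cχ) (hu : IsLocalizedFamily ξ₀ r h τ u M)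
    (hR : ∀ m, 1 < R m) (hR_top : Tendsto R atTop atTop)
    (hδ : ∀ l, 0 < δ l ∧ δ l < 1) (hδ0 : Tendsto δ atTop (𝓝 0))
    (hμ : IsTwoMicrolocalLimit H Λ ξ₀ r ε χ h τ R δ u μ) (a : SymbolSpace Λ ξ₀ r) {R₀ : ℝ}
    (hpos : ∀ x ξ η, ξ ∈ resonantSet H Λ → ξ ∈ Metric.ball ξ₀ r → R₀ < ‖η‖ →
      0 ≤ (a.1 (x, ξ, η)).re) :
    ∀ᵐ t : ℝ, 0 ≤ (μ t a).re := by
  classical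
  refine ae_nonneg_of_forall_setIntegral_nonneg_of_sigmaFinite
    (fun s _ hsv => (hμ.integrableOn a hsv).re) fun s hs hsv => ?_
  have hre : ∫ t in s, (μ t a).re = (∫ t in s, μ t a).re := integral_re (hμ.integrableOn a hsv)
  rw [hre]
  refine (hμ.limit_indicator a hs hsv).re_nonneg fun κ' hκ' => ?_
  set V := (volume : Measure ℝ).real s with hV
  have hV0 : 0 ≤ V := measureReal_nonneg
  set κ := κ' / (V + 1) with hκ
  have hκ0 : 0 < κ := by positivity
  obtain ⟨C, hC0, c₁, hc₁, C₁, R₁, hR₁, hmain⟩ := exists_wigner_lower_bound hdecomp hχ a.2 hpos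
  set D := M ^ 2 + 1 with hD
  have hD0 : 0 < D := by positivity
  obtain ⟨K, hK0, ρ, hρ, hmain⟩ := hmain (κ / (4 * D)) (by positivity)
  have hM := hu.nonneg
  have hl : ∀ᶠ l in atTop, C * δ l < κ / (4 * D) := by
    have := hδ0.const_mul C
    rw [mul_zero] at this
    exact this.eventually (gt_mem_nhds (by positivity))
  filter_upwards [hl] with l hl
  have hRinv : Tendsto (fun m => M * K / R m) atTop (𝓝 0) := tendsto_const_nhds.div_atTop hR_top
  have hm : ∀ᶠ m in atTop, R₁ ≤ R m ∧ M * K / R m < ρ ∧ C * (M * K / R m) < κ / (8 * D) := by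
    have h2 := hRinv.const_mul C
    rw [mul_zero] at h2
    exact (hR_top.eventually_ge_atTop _).and ((hRinv.eventually (gt_mem_nhds hρ)).and
      (h2.eventually (gt_mem_nhds (by positivity))))
  -- The shell masses involve only `|û(k)|²`, so the same `m` and `n` serve all times.
  have hshell := frequently_shell_mass_lt (fun n => freqSupport (h n) ξ₀ r)
    (fun n k => ‖fourierCoef (u n) k‖ ^ 2)
    (fun n k => τ n * ‖etaMap H Λ ξ₀ ε (h n • latticeVec k)‖) (fun n k => sq_nonneg _)
    (fun n => hu.sum_sq_le n _) hc₁ (C₁ := C₁) (fun m => one_pos.trans (hR m)) hR_top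
    (κ := κ / (4 * (C + 1))) (by positivity)
  refine (hshell.and_eventually hm).mono ?_
  rintro m ⟨hm1, hm2, hm3, hm4⟩
  have hn : ∀ᶠ n in atTop, h n * K < ρ ∧ C * (h n * K * (1 + 1 / δ l)) < κ / (8 * D) := by
    have h2 := hu.h_tendsto.mul_const K
    rw [zero_mul] at h2
    have h3 := (h2.mul_const (1 + 1 / δ l)).const_mul C
    rw [zero_mul, mul_zero] at h3
    exact (h2.eventually (gt_mem_nhds hρ)).and (h3.eventually (gt_mem_nhds (by positivity)))
  refine (hm1.and_eventually hn).mono ?_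
  rintro n ⟨hn1, hn2, hn3⟩
  have hRm := one_pos.trans (hR m)
  have hpoint : ∀ t : ℝ, -κ ≤ (wigner (h n) (propagatedCoef H (h n) (τ n * t) (u n))
        (truncatedSymbol H Λ ξ₀ ε χ (τ n) (R m) (δ l) a.1)).re := by
    intro t
    have hhτ : τ n / R m * (h n * K) ≤ M * K / R m := by
      rw [div_mul_eq_mul_div]
      refine div_le_div_of_nonneg_right ?_ hRm.le
      have := mul_le_mul_of_nonneg_right (hu.mul_le n) hK0
      linarith
    have h1 := hmain (h n) (τ n) (R m) (δ l) (hu.h_pos n) (hu.τ_pos n) hm2 (hδ l).1 hn2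
      (hhτ.trans hm3.le) (propagatedCoef H (h n) (τ n * t) (u n))
      (hu.propagatedCoef_eq_zero n _)
    simp only [norm_propagatedCoef, div_mul_eq_mul_div (τ n)] at h1
    refine le_trans ?_ h1
    have hS := hu.sum_sq_le n (freqSupport (h n) ξ₀ r)
    have hS0 : 0 ≤ ∑ k ∈ freqSupport (h n) ξ₀ r, ‖fourierCoef (u n) k‖ ^ 2 :=
      Finset.sum_nonneg fun _ _ => sq_nonneg _
    set m1 := ∑ k ∈ freqSupport (h n) ξ₀ r, ‖fourierCoef (u n) k‖ ^ 2
    set m2 := ∑ k ∈ freqSupport (h n) ξ₀ r with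
          c₁ ≤ τ n * ‖etaMap H Λ ξ₀ ε (h n • latticeVec k)‖ / R m ∧
            τ n * ‖etaMap H Λ ξ₀ ε (h n • latticeVec k)‖ / R m ≤ C₁, ‖fourierCoef (u n) k‖ ^ 2
      with hm2def
    have e1 : C * (h n * K * (1 + τ n / R m + 1 / δ l)) ≤ κ / (8 * D) + κ / (8 * D) := by
      have : h n * K * (1 + τ n / R m + 1 / δ l) =
          h n * K * (1 + 1 / δ l) + τ n / R m * (h n * K) := by ring
      rw [this, mul_add]
      have := mul_le_mul_of_nonneg_left hhτ hC0
      linarith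
    have e2 : κ / (4 * D) + C * δ l + C * (h n * K * (1 + τ n / R m + 1 / δ l)) ≤
        3 * κ / (4 * D) := by
      have : κ / (8 * D) + κ / (8 * D) = κ / (4 * D) := by field_simp; norm_num
      have h5 : 3 * κ / (4 * D) = κ / (4 * D) + κ / (4 * D) + κ / (4 * D) := by ring
      rw [this] at e1
      rw [h5]
      linarith
    have e3 : m1 * (κ / (4 * D) + C * δ l + C * (h n * K * (1 + τ n / R m + 1 / δ l))) ≤
        3 * κ / 4 := by
      calc _ ≤ D * (3 * κ / (4 * D)) := by
            refine mul_le_mul (by linarith) e2 ?_ hD0.le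
            have := (hδ l).1
            have := hu.h_pos n
            have := hu.τ_pos n
            positivity
        _ = 3 * κ / 4 := by field_simp
    have e4 : C * m2 ≤ κ / 4 := by
      have h6 : C * m2 ≤ C * (κ / (4 * (C + 1))) := mul_le_mul_of_nonneg_left hn1.le hC0
      refine h6.trans ?_
      rw [mul_div_assoc', div_le_div_iff₀ (by positivity) (by norm_num)]
      nlinarith
    linarith
  have hint := hu.integrableOn (H := H) n
    (truncatedSymbol H Λ ξ₀ ε χ (τ n) (R m) (δ l) a.1) hs hsv
  have h1 : (∫ t in s, wigner (h n) (propagatedCoef H (h n) (τ n * t) (u n))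
        (truncatedSymbol H Λ ξ₀ ε χ (τ n) (R m) (δ l) a.1)).re =
      ∫ t in s, (wigner (h n) (propagatedCoef H (h n) (τ n * t) (u n))
        (truncatedSymbol H Λ ξ₀ ε χ (τ n) (R m) (δ l) a.1)).re := (integral_re hint).symm
  rw [h1]
  have h2 : ∫ t in s, -κ ≤ ∫ t in s, (wigner (h n) (propagatedCoef H (h n) (τ n * t) (u n))
        (truncatedSymbol H Λ ξ₀ ε χ (τ n) (R m) (δ l) a.1)).re :=
    integral_mono (integrableOn_const hsv.ne) hint.re fun t => hpoint t
  refine le_trans ?_ h2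
  rw [setIntegral_const, smul_eq_mul, ← hV, hκ, mul_neg, neg_le_neg_iff, mul_div_assoc',
    div_le_iff₀ (by positivity)]
  nlinarith

end

section


/-! ### Taylor estimates -/

theorem exists_taylor_bound {E F : Type*} [NormedAddCommGroup E] [NormedSpace ℝ E]
    [NormedAddCommGroup F] [NormedSpace ℝ F] {f : E → F} (hf : ContDiff ℝ ∞ f) {K : Set E}
    (hK : IsCompact K) (hKc : Convex ℝ K) :
    ∃ L : ℝ, 0 ≤ L ∧ ∀ x ∈ K, ∀ y ∈ K, ‖f y - f x - fderiv ℝ f x (y - x)‖ ≤ L * ‖y - x‖ ^ 2 := by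
  have hf' : ContDiff ℝ ∞ (fderiv ℝ f) := hf.fderiv_right (by simp)
  have hc : Continuous (fderiv ℝ (fderiv ℝ f)) := hf'.continuous_fderiv (by simp)
  obtain ⟨L, hL⟩ := hK.exists_bound_of_continuousOn
    ((continuous_norm (E := E →L[ℝ] E →L[ℝ] F)).comp hc).continuousOn
  simp only [Function.comp_apply, norm_norm] at hL
  refine ⟨max L 0, le_max_right _ _, fun x hx y hy => ?_⟩
  have hd : Differentiable ℝ f := hf.differentiable (by simp)
  have hd' : Differentiable ℝ (fderiv ℝ f) := hf'.differentiable (by simp)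
  have hseg : segment ℝ x y ⊆ K := hKc.segment_subset hx hy
  have h1 : ∀ z ∈ segment ℝ x y, ‖fderiv ℝ f z - fderiv ℝ f x‖ ≤ max L 0 * ‖y - x‖ := by
    intro z hz
    have h2 := hKc.norm_image_sub_le_of_norm_fderiv_le (f := fderiv ℝ f) (C := max L 0)
      (fun w _ => hd'.differentiableAt) (fun w hw => (hL w hw).trans (le_max_left _ _)) hx (hseg hz)
    refine h2.trans (mul_le_mul_of_nonneg_left ?_ (le_max_right _ _))
    obtain ⟨t, ⟨ht0, ht1⟩, rfl⟩ := (segment_eq_image' ℝ x y) ▸ hz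
    rw [add_sub_cancel_left, norm_smul, Real.norm_of_nonneg ht0]
    exact mul_le_of_le_one_left (norm_nonneg _) ht1
  have h3 := (convex_segment x y).norm_image_sub_le_of_norm_fderiv_le' (f := f)
    (φ := fderiv ℝ f x) (fun w _ => hd.differentiableAt) h1 (left_mem_segment ℝ x y)
    (right_mem_segment ℝ x y)
  refine h3.trans (le_of_eq (by ring))

variable {d : ℕ} {H : Freq d → ℝ} {Λ : Submodule ℤ (Fin d → ℤ)} {ξ₀ : Freq d} {r ε : ℝ}

theorem contDiff_gradient (hH : ContDiff ℝ ∞ H) : ContDiff ℝ ∞ (gradient H) := by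
  have h1 : ContDiff ℝ ∞ (fderiv ℝ H) := hH.fderiv_right (by simp)
  exact (InnerProductSpace.toDual ℝ (Freq d)).symm.toContinuousLinearEquiv.contDiff.comp h1

theorem contDiff_hessian (hH : ContDiff ℝ ∞ H) : ContDiff ℝ ∞ (hessian H) :=
  (contDiff_gradient hH).fderiv_right (by simp)

theorem inner_gradient_eq (x v : Freq d) : inner ℝ (gradient H x) v = fderiv ℝ H x v :=
  InnerProductSpace.toDual_symm_apply

/-- The time frequency of the mode `(j, k)` is, up to a small error, the symbol
`d²H(ξ) η(ξ) · (j - k)` at the midpoint `ξ`. -/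
theorem exists_frequency_bound (hH : ContDiff ℝ ∞ H) (hrε : r ≤ ε)
    (hdecomp : ∀ ξ ∈ Metric.ball ξ₀ r, ∃! σ, IsBasePoint H Λ ξ₀ ε ξ σ) {m : Fin d → ℤ}
    (hm : m ∈ Λ) :
    ∃ C : ℝ, 0 ≤ C ∧ ∀ (h : ℝ) (j k : Fin d → ℤ), 0 < h → m = j - k →
      h • latticeVec j ∈ Metric.ball ξ₀ r → h • latticeVec k ∈ Metric.ball ξ₀ r →
      ∀ ξ, ξ = (h / 2) • latticeVec (k + j) → ξ ∈ Metric.ball ξ₀ r ∧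
        |inner ℝ (latticeVec m) (hessian H ξ (etaMap H Λ ξ₀ ε ξ)) -
          (H (h • latticeVec j) - H (h • latticeVec k)) / h| ≤
          C * (‖etaMap H Λ ξ₀ ε ξ‖ ^ 2 + h) := by
  obtain ⟨L₁, hL₁0, hL₁⟩ := exists_taylor_bound hH (isCompact_closedBall ξ₀ ε)
    (convex_closedBall ξ₀ ε)
  obtain ⟨L₂, hL₂0, hL₂⟩ := exists_taylor_bound (contDiff_gradient hH) (isCompact_closedBall ξ₀ ε)
    (convex_closedBall ξ₀ ε)
  have hbc : ∀ y ∈ Metric.ball ξ₀ r, y ∈ Metric.closedBall ξ₀ ε := fun y hy =>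
    Metric.ball_subset_closedBall (Metric.ball_subset_ball hrε hy)
  set N := ‖latticeVec m‖ with hN
  refine ⟨N * L₂ + L₁ * N ^ 2, by positivity, ?_⟩
  intro h j k hh hmjk hj hk ξ hξ
  have hjξ : h • latticeVec j = ξ + (h / 2) • latticeVec m := by
    rw [hξ, hmjk, latticeVec_add, latticeVec_sub]
    module
  have hkξ : h • latticeVec k = ξ - (h / 2) • latticeVec m := by
    rw [hξ, hmjk, latticeVec_add, latticeVec_sub]
    module
  have hξb : ξ ∈ Metric.ball ξ₀ r := by
    have h1 := (convex_ball ξ₀ r) hk hj (a := 1 / 2) (b := 1 / 2)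
      (by norm_num) (by norm_num) (by norm_num)
    rw [hjξ, hkξ] at h1
    convert! h1 using 1
    module
  refine ⟨hξb, ?_⟩
  have hbase := isBasePoint_sigmaMap hdecomp hξb
  set σ := sigmaMap H Λ ξ₀ ε ξ with hσ
  have hη : (etaMap H Λ ξ₀ ε ξ : Freq d) = ξ - σ := rfl
  have hηn : ‖etaMap H Λ ξ₀ ε ξ‖ = ‖ξ - σ‖ := rfl
  -- Taylor expansion of `H` at the midpoint towards `hj` and `hk` gives `H(hj) - H(hk) = h m·dH(ξ)
  -- + O(h²)`.
  have e1 := hL₁ ξ (hbc ξ hξb) _ (hbc _ hj)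
  have e2 := hL₁ ξ (hbc ξ hξb) _ (hbc _ hk)
  -- Expansion of `dH` from `ξ` to `σ`, where `m·dH(σ) = 0`, gives `m·dH(ξ) = m·d²H(ξ)η + O(|η|²)`.
  have e3 := hL₂ ξ (hbc ξ hξb) σ (Metric.ball_subset_closedBall hbase.2.1)
  rw [hjξ, add_sub_cancel_left, ← inner_gradient_eq, real_inner_smul_right, norm_smul,
    Real.norm_of_nonneg (show (0 : ℝ) ≤ h / 2 by positivity), Real.norm_eq_abs, ← hN] at e1
  rw [hkξ, sub_sub_cancel_left, ← inner_gradient_eq, inner_neg_right, real_inner_smul_right,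
    norm_neg, norm_smul, Real.norm_of_nonneg (show (0 : ℝ) ≤ h / 2 by positivity), Real.norm_eq_abs, ← hN] at e2
  have hσm : inner ℝ (latticeVec m) (gradient H σ) = 0 := hbase.1 m hm
  have e4 : |inner ℝ (latticeVec m) (gradient H σ - gradient H ξ - fderiv ℝ (gradient H) ξ (σ - ξ))|
      ≤ N * (L₂ * ‖σ - ξ‖ ^ 2) :=
    (abs_real_inner_le_norm _ _).trans (mul_le_mul_of_nonneg_left e3 (norm_nonneg _))
  rw [← neg_sub ξ σ, map_neg, inner_sub_right, inner_sub_right, inner_neg_right, hσm, norm_neg,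
    ← hη] at e4
  rw [hjξ, hkξ]
  change |inner ℝ (latticeVec m) (fderiv ℝ (gradient H) ξ (etaMap H Λ ξ₀ ε ξ)) - _| ≤ _
  rw [hηn, ← hη]
  set X := inner ℝ (latticeVec m) (fderiv ℝ (gradient H) ξ (etaMap H Λ ξ₀ ε ξ : Freq d))
  rw [real_inner_comm] at e1 e2
  set Y := inner ℝ (latticeVec m) (gradient H ξ)
  set P := H (ξ + (h / 2) • latticeVec m)
  set Q := H (ξ - (h / 2) • latticeVec m)
  set n2 := ‖(etaMap H Λ ξ₀ ε ξ : Freq d)‖ ^ 2 with hn2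
  have hn20 : 0 ≤ n2 := sq_nonneg _
  have f1 : |X - Y| ≤ N * (L₂ * n2) := by
    refine le_trans (le_of_eq ?_) e4
    congr 1
    ring
  have f2 : |Y - (P - Q) / h| ≤ L₁ * N ^ 2 * h := by
    have h3 : |(Y - (P - Q) / h) * h| ≤ L₁ * N ^ 2 * h * h := by
      have h4 : (Y - (P - Q) / h) * h = Y * h - (P - Q) := by field_simp
      rw [h4]
      have a1 := abs_le.1 e1
      have a2 := abs_le.1 e2
      have h5 : L₁ * (h / 2 * N) ^ 2 + L₁ * (h / 2 * N) ^ 2 ≤ L₁ * N ^ 2 * h * h := by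
        have : 0 ≤ L₁ * N ^ 2 * h * h := by positivity
        nlinarith
      rw [abs_le]
      constructor <;> linarith [a1.1, a1.2, a2.1, a2.2]
    rw [abs_mul, abs_of_pos hh] at h3
    exact le_of_mul_le_mul_right h3 hh
  have f3 : X - (P - Q) / h = (X - Y) + (Y - (P - Q) / h) := by ring
  rw [f3]
  refine (abs_add_le _ _).trans ((add_le_add f1 f2).trans ?_)
  have : 0 ≤ N * L₂ * h := by positivity
  have : 0 ≤ L₁ * N ^ 2 * n2 := by positivity
  linarith

/-! ### Oscillatory integrals -/

/-- One integration by parts; the factor `|θ|` stays on the left so that `θ = 0` is allowed. -/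
theorem norm_oscillatory_integral_le {φ : ℝ → ℝ} (hφ : ContDiff ℝ ∞ φ) (hφc : HasCompactSupport φ)
    (θ : ℝ) :
    |θ| * ‖∫ t : ℝ, (φ t : ℂ) * Complex.exp (Complex.I * ((θ * t : ℝ) : ℂ))‖ ≤
      ∫ t : ℝ, ‖deriv φ t‖ := by
  have hderiv : ∀ t, HasDerivAt φ (deriv φ t) t := fun t =>
    (hφ.differentiable (by simp) t).hasDerivAt
  have hu : ∀ t, HasDerivAt (fun t => (φ t : ℂ)) ((deriv φ t : ℝ) : ℂ) t := fun t =>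
    (hderiv t).ofReal_comp
  have hv : ∀ t : ℝ, HasDerivAt (fun t : ℝ => Complex.exp (Complex.I * ((θ * t : ℝ) : ℂ)))
      (Complex.exp (Complex.I * ((θ * t : ℝ) : ℂ)) * (Complex.I * (θ : ℂ))) t := by
    intro t
    refine HasDerivAt.cexp ?_
    have : HasDerivAt (fun t : ℝ => θ * t) θ t := by simpa using (hasDerivAt_id t).const_mul θ
    exact this.ofReal_comp.const_mul Complex.I
  have hφ'c : Continuous (deriv φ) := hφ.continuous_deriv (by simp)
  have hexp : Continuous fun t : ℝ => Complex.exp (Complex.I * ((θ * t : ℝ) : ℂ)) := by fun_prop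
  have hexpn : ∀ t : ℝ, ‖Complex.exp (Complex.I * ((θ * t : ℝ) : ℂ))‖ = 1 := fun t => by
    rw [mul_comm, Complex.norm_exp_ofReal_mul_I]
  have hφi : Integrable fun t => (φ t : ℂ) :=
    (hφ.continuous.integrable_of_hasCompactSupport hφc).ofReal
  have hφ'i : Integrable fun t => ((deriv φ t : ℝ) : ℂ) :=
    (hφ'c.integrable_of_hasCompactSupport hφc.deriv).ofReal
  have hbdd : ∀ {f : ℝ → ℂ}, Integrable f →
      Integrable fun t => f t * Complex.exp (Complex.I * ((θ * t : ℝ) : ℂ)) := fun hf =>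
    hf.mul_bdd (c := 1) hexp.aestronglyMeasurable (Eventually.of_forall fun t => (hexpn t).le)
  have h1 := integral_mul_deriv_eq_deriv_mul_of_integrable (fun t _ => hu t) (fun t _ => hv t)
    (by
      have := (hbdd hφi).mul_const (Complex.I * (θ : ℂ))
      refine this.congr (Eventually.of_forall fun t => ?_)
      simp only [Pi.mul_apply]; ring)
    (hbdd hφ'i) (hbdd hφi)
  have h2 : ∫ t : ℝ, (φ t : ℂ) * (Complex.exp (Complex.I * ((θ * t : ℝ) : ℂ)) *
      (Complex.I * (θ : ℂ))) = (∫ t : ℝ, (φ t : ℂ) *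
        Complex.exp (Complex.I * ((θ * t : ℝ) : ℂ))) * (Complex.I * (θ : ℂ)) := by
    rw [← integral_mul_const]
    simp only [mul_assoc]
  rw [h2] at h1
  have h3 := congrArg norm h1
  rw [norm_mul, norm_mul, Complex.norm_I, one_mul, Complex.norm_real, Real.norm_eq_abs, norm_neg,
    mul_comm] at h3
  rw [h3]
  refine (norm_integral_le_integral_norm _).trans (le_of_eq ?_)
  refine integral_congr_ae (Eventually.of_forall fun t => ?_)
  simp only [norm_mul, hexpn, mul_one, Complex.norm_real]

/-! ### Symbols with a single mode -/

theorem wigner_phase_mul {h : ℝ} {c : (Fin d → ℤ) → ℂ} {S : Finset (Fin d → ℤ)}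
    (hc : ∀ k ∉ S, c k = 0) (m : Fin d → ℤ) {b : Torus d × Freq d → ℂ} {β : Freq d → ℂ}
    (hb : ∀ x ξ, b (x, ξ) = phase m x * β ξ) :
    wigner h c b = ∑ j ∈ S, ∑ k ∈ S, (starRingEnd ℂ) (c j) * c k *
      if m = j - k then β ((h / 2) • latticeVec (k + j)) else 0 := by
  have h0 : (charNorm d : ℂ) ≠ 0 := by exact_mod_cast charNorm_pos.ne'
  rw [wigner_eq_sum hc]
  refine Finset.sum_congr rfl fun j _ => Finset.sum_congr rfl fun k _ => ?_
  simp only [hb, fourierCoef_phase_mul]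
  split_ifs
  · rw [mul_inv_cancel_left₀ h0]
  · rw [mul_zero]

/-- Schur's test with a weight concentrated at `m`: a symbol with a single mode has one nonzero
diagonal. -/
theorem sum_single_mode_le {S : Finset (Fin d → ℤ)} (c : (Fin d → ℤ) → ℂ) (m : Fin d → ℤ)
    {E : ℝ} (hE : 0 ≤ E) :
    ∑ j ∈ S, ∑ k ∈ S, ‖c j‖ * ‖c k‖ * (if m = j - k then E else 0) ≤
      (∑ k ∈ S, ‖c k‖ ^ 2) * E := by
  have h1 : HasSum (fun k : Fin d → ℤ => if m = k then E else 0) E := by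
    simp only [eq_comm (a := m)]
    exact hasSum_ite_eq m E
  have := schur_bound (S := S) c h1.summable (fun k => by split_ifs <;> simp [hE])
  rwa [h1.tsum_eq] at this

variable {h τ R δ : ℕ → ℝ} {u : ℕ → Lp ℂ 2 (volume : Measure (Torus d))} {M : ℝ}
  {χ : realSpan Λ → ℝ} {c₀ C₀ Cχ : ℝ} {μ : ℝ → SymbolSpace Λ ξ₀ r →ₗ[ℂ] ℂ}

/-- The mass of the two-microlocal limit is bounded. -/
theorem IsTwoMicrolocalLimit.ae_re_le
    (hχ : IsCutoff χ c₀ C₀ Cχ) (hu : IsLocalizedFamily ξ₀ r h τ u M)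
    (hμ : IsTwoMicrolocalLimit H Λ ξ₀ r ε χ h τ R δ u μ) (a : SymbolSpace Λ ξ₀ r)
    {f : Freq d × realSpan Λ → ℂ} (haf : ∀ x ξ η, a.1 (x, ξ, η) = f (ξ, η))
    (hf : ∀ p, ‖f p‖ ≤ 1) :
    ∀ᵐ t : ℝ, (μ t a).re ≤ M ^ 2 * ((1 + Cχ) * Cχ) := by
  set C := M ^ 2 * ((1 + Cχ) * Cχ) with hC
  have hCχ : 0 ≤ Cχ := zero_le_one.trans hχ.one_le
  have key : ∀ᵐ t : ℝ, 0 ≤ C - (μ t a).re := by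
    refine ae_nonneg_of_forall_setIntegral_nonneg_of_sigmaFinite
      (fun s _ hsv => (integrableOn_const hsv.ne).sub (hμ.integrableOn a hsv).re)
      fun s hs hsv => ?_
    have h1 : ‖∫ t in s, μ t a‖ ≤ C * (volume : Measure ℝ).real s := by
      refine (hμ.limit_indicator a hs hsv).norm_le fun κ hκ => Eventually.of_forall fun l =>
        Eventually.of_forall fun m => Eventually.of_forall fun n => ?_
      refine le_trans ?_ (le_add_of_nonneg_right hκ.le)
      refine norm_setIntegral_le_of_norm_le_const hsv fun t _ => ?_
      -- Independence of `x` means the single mode `0`, hence a diagonal matrix.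
      have hb : ∀ x ξ, truncatedSymbol H Λ ξ₀ ε χ (τ n) (R m) (δ l) a.1 (x, ξ) =
          phase 0 x * (f (ξ, τ n • etaMap H Λ ξ₀ ε ξ) *
            (((1 - χ ((R m)⁻¹ • (τ n • etaMap H Λ ξ₀ ε ξ))) *
              χ ((δ l)⁻¹ • etaMap H Λ ξ₀ ε ξ) : ℝ) : ℂ)) := by
        intro x ξ
        rw [phase_zero_left, one_mul, truncatedSymbol, haf]
      have hbn : ∀ ξ, ‖f (ξ, τ n • etaMap H Λ ξ₀ ε ξ) *
            (((1 - χ ((R m)⁻¹ • (τ n • etaMap H Λ ξ₀ ε ξ))) *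
              χ ((δ l)⁻¹ • etaMap H Λ ξ₀ ε ξ) : ℝ) : ℂ)‖ ≤ (1 + Cχ) * Cχ := by
        intro ξ
        rw [norm_mul, Complex.norm_real, norm_mul]
        have e1 := hf (ξ, τ n • etaMap H Λ ξ₀ ε ξ)
        have e2 : ‖1 - χ ((R m)⁻¹ • (τ n • etaMap H Λ ξ₀ ε ξ))‖ ≤ 1 + Cχ := by
          rw [Real.norm_eq_abs, abs_le]
          constructor <;> linarith [hχ.nonneg ((R m)⁻¹ • (τ n • etaMap H Λ ξ₀ ε ξ)),
            hχ.le ((R m)⁻¹ • (τ n • etaMap H Λ ξ₀ ε ξ))]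
        have e3 : ‖χ ((δ l)⁻¹ • etaMap H Λ ξ₀ ε ξ)‖ ≤ Cχ := by
          rw [Real.norm_of_nonneg (hχ.nonneg _)]; exact hχ.le _
        have e4 := mul_le_mul e2 e3 (norm_nonneg _) (by linarith)
        have e5 := mul_le_mul e1 e4 (by positivity) zero_le_one
        linarith
      rw [wigner_phase_mul (hu.propagatedCoef_eq_zero n _) 0 hb]
      have h2 := sum_single_mode_le (S := freqSupport (h n) ξ₀ r) (fun k => fourierCoef (u n) k) 0
        (E := (1 + Cχ) * Cχ) (by positivity)
      refine le_trans ?_ (h2.trans (mul_le_mul_of_nonneg_right (hu.sum_sq_le n _) (by positivity)))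
      refine norm_sum_le_of_le _ fun j _ => norm_sum_le_of_le _ fun k _ => ?_
      rw [norm_mul, norm_mul, RCLike.norm_conj, norm_propagatedCoef, norm_propagatedCoef]
      refine mul_le_mul_of_nonneg_left ?_ (by positivity)
      split_ifs
      · exact hbn _
      · rw [norm_zero]
    have hcI : IntegrableOn (fun _ : ℝ => C) s volume := integrableOn_const hsv.ne
    have h0 : ∫ t in s, (C - (μ t a).re) = (∫ _ in s, C) - ∫ t in s, (μ t a).re :=
      integral_sub hcI (hμ.integrableOn a hsv).re
    rw [h0, setIntegral_const, smul_eq_mul]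
    have h2 : ∫ t in s, (μ t a).re = (∫ t in s, μ t a).re := integral_re (hμ.integrableOn a hsv)
    have h3 := (Complex.re_le_norm _).trans h1
    rw [h2]
    linarith
  filter_upwards [key] with t ht
  linarith

/-- The two propagator phases combine into one exponential in `t`, so time integration yields a
Fourier integral of `φ` at the frequency `τ (H(hj) - H(hk))/h`. -/
theorem integral_mul_wigner_phase_mul (n : ℕ) (hu : IsLocalizedFamily ξ₀ r h τ u M)
    (m : Fin d → ℤ) {b : Torus d × Freq d → ℂ} {β : Freq d → ℂ}
    (hb : ∀ x ξ, b (x, ξ) = phase m x * β ξ) {φ : ℝ → ℂ} (hφ : Integrable φ) :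
    ∫ t : ℝ, φ t * wigner (h n) (propagatedCoef H (h n) (τ n * t) (u n)) b =
      ∑ j ∈ freqSupport (h n) ξ₀ r, ∑ k ∈ freqSupport (h n) ξ₀ r,
        (starRingEnd ℂ) (fourierCoef (u n) j) * fourierCoef (u n) k *
          ((if m = j - k then β ((h n / 2) • latticeVec (k + j)) else 0) *
            ∫ t : ℝ, φ t * Complex.exp (Complex.I * ((τ n / h n * (H (h n • latticeVec j) -
              H (h n • latticeVec k)) * t : ℝ) : ℂ))) := by
  have h1 : ∀ t : ℝ, φ t * wigner (h n) (propagatedCoef H (h n) (τ n * t) (u n)) b =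
      ∑ j ∈ freqSupport (h n) ξ₀ r, ∑ k ∈ freqSupport (h n) ξ₀ r,
        ((starRingEnd ℂ) (fourierCoef (u n) j) * fourierCoef (u n) k *
          (if m = j - k then β ((h n / 2) • latticeVec (k + j)) else 0)) *
          (φ t * Complex.exp (Complex.I * ((τ n / h n * (H (h n • latticeVec j) -
              H (h n • latticeVec k)) * t : ℝ) : ℂ))) := by
    intro t
    rw [wigner_phase_mul (hu.propagatedCoef_eq_zero n _) m hb, Finset.mul_sum]
    refine Finset.sum_congr rfl fun j _ => ?_
    rw [Finset.mul_sum]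
    refine Finset.sum_congr rfl fun k _ => ?_
    have h2 : Complex.exp (Complex.I * ((τ n / h n * (H (h n • latticeVec j) -
        H (h n • latticeVec k)) * t : ℝ) : ℂ)) =
        (starRingEnd ℂ) (Complex.exp (-(Complex.I *
          ((τ n * t / h n * H (h n • latticeVec j) : ℝ) : ℂ)))) *
        Complex.exp (-(Complex.I * ((τ n * t / h n * H (h n • latticeVec k) : ℝ) : ℂ))) := by
      rw [← Complex.exp_conj, ← Complex.exp_add]
      congr 1
      simp only [map_neg, map_mul, Complex.conj_I, Complex.conj_ofReal]
      push_cast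
      ring
    rw [h2, propagatedCoef, propagatedCoef, map_mul]
    ring
  simp only [h1]
  have hint : ∀ (C : ℂ) (θ : ℝ), Integrable fun t : ℝ =>
      C * (φ t * Complex.exp (Complex.I * ((θ * t : ℝ) : ℂ))) := by
    intro C θ
    refine (hφ.mul_bdd (c := 1) (Continuous.aestronglyMeasurable (by fun_prop))
      (Eventually.of_forall fun t => ?_)).const_mul C
    rw [mul_comm, Complex.norm_exp_ofReal_mul_I]
  rw [integral_finsetSum _ fun j _ => integrable_finsetSum _ fun k _ => hint _ _]
  refine Finset.sum_congr rfl fun j _ => ?_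
  rw [integral_finsetSum _ fun k _ => hint _ _]
  refine Finset.sum_congr rfl fun k _ => ?_
  rw [integral_const_mul]
  ring

/-- Invariance along the Hessian flow, in infinitesimal form. -/
theorem IsTwoMicrolocalLimit.ae_eq_zero (hH : ContDiff ℝ ∞ H) (hrε : r ≤ ε)
    (hdecomp : ∀ ξ ∈ Metric.ball ξ₀ r, ∃! σ, IsBasePoint H Λ ξ₀ ε ξ σ)
    (hχ : IsCutoff χ c₀ C₀ Cχ) (hu : IsLocalizedFamily ξ₀ r h τ u M)
    (hR : ∀ m, 1 < R m) (hR_top : Tendsto R atTop atTop)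
    (hδ : ∀ l, 0 < δ l ∧ δ l < 1) (hδ0 : Tendsto δ atTop (𝓝 0))
    (hμ : IsTwoMicrolocalLimit H Λ ξ₀ r ε χ h τ R δ u μ) (a : SymbolSpace Λ ξ₀ r)
    {m : Fin d → ℤ} (hm : m ∈ Λ) {F : Freq d × realSpan Λ → ℂ} {CF : ℝ} (hF : ∀ p, ‖F p‖ ≤ CF)
    {ρ : ℝ} (ha : ∀ x ξ (η : realSpan Λ), ρ < ‖η‖ → a.1 (x, ξ, η) = phase m x *
      (F (ξ, η) * ((inner ℝ (latticeVec m) (hessian H ξ η) / ‖η‖ : ℝ) : ℂ))) :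
    ∀ᵐ t : ℝ, μ t a = 0 := by
  have hloc : LocallyIntegrable (fun t => μ t a) := by
    rw [locallyIntegrable_iff]
    exact fun K hK => hμ.integrableOn a hK.measure_lt_top
  refine ae_eq_zero_of_integral_contDiff_smul_eq_zero hloc fun φ hφ hφc => ?_
  have hφi : Integrable fun t => (φ t : ℂ) :=
    (hφ.continuous.integrable_of_hasCompactSupport hφc).ofReal
  have hlim := hμ.limit (fun t => (φ t : ℂ)) hφi a
  obtain ⟨C₂, hC₂0, hC₂⟩ := exists_frequency_bound hH hrε hdecomp hm
  set Φ₀ := ∫ t : ℝ, ‖φ t‖ with hΦ₀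
  set Φ₁ := ∫ t : ℝ, ‖deriv φ t‖ with hΦ₁
  have hΦ₀0 : 0 ≤ Φ₀ := integral_nonneg fun _ => norm_nonneg _
  have hΦ₁0 : 0 ≤ Φ₁ := integral_nonneg fun _ => norm_nonneg _
  have hCF0 : 0 ≤ CF := (norm_nonneg _).trans (hF 0)
  have hCχ : 0 ≤ Cχ := zero_le_one.trans hχ.one_le
  have hc₀ := hχ.c_pos
  have hC₀ := hχ.C_pos
  have hM := hu.nonneg
  set A := CF * ((1 + Cχ) * Cχ) with hA
  have hA0 : 0 ≤ A := by positivity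
  -- The three terms come from the oscillation, of size `1/(τ|η|)`, and from the Taylor remainder
  -- divided by `|η|`, that is `|η| ≤ C₀δ` and `h/|η| ≤ hτ/(c₀R)`.
  let E : ℕ → ℕ → ℝ := fun mm l =>
    A * (Φ₁ / (c₀ * R mm) + C₂ * Φ₀ * (C₀ * δ l + M / (c₀ * R mm)))
  have hbound : ∀ n mm l, ρ < c₀ * R mm → ‖∫ t : ℝ, (φ t : ℂ) *
      wigner (h n) (propagatedCoef H (h n) (τ n * t) (u n))
        (truncatedSymbol H Λ ξ₀ ε χ (τ n) (R mm) (δ l) a.1)‖ ≤ M ^ 2 * E mm l := by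
    intro n mm l hρ
    have hRm := one_pos.trans (hR mm)
    have hδl := (hδ l).1
    have hτ := hu.τ_pos n
    have hh := hu.h_pos n
    have hE0 : 0 ≤ E mm l := by positivity
    set β : Freq d → ℂ := fun ξ => F (ξ, τ n • etaMap H Λ ξ₀ ε ξ) *
      ((inner ℝ (latticeVec m) (hessian H ξ (τ n • etaMap H Λ ξ₀ ε ξ : realSpan Λ)) /
        ‖τ n • etaMap H Λ ξ₀ ε ξ‖ : ℝ) : ℂ) *
      (((1 - χ ((R mm)⁻¹ • (τ n • etaMap H Λ ξ₀ ε ξ))) *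
              χ ((δ l)⁻¹ • etaMap H Λ ξ₀ ε ξ) : ℝ) : ℂ) with hβ
    have hsmall : ∀ ξ, ‖τ n • etaMap H Λ ξ₀ ε ξ‖ < c₀ * R mm →
        χ ((R mm)⁻¹ • (τ n • etaMap H Λ ξ₀ ε ξ)) = 1 := by
      intro ξ hξ
      refine hχ.eq_one _ ?_
      rw [norm_smul, norm_inv, Real.norm_of_nonneg hRm.le, inv_mul_eq_div, div_lt_iff₀ hRm]
      exact hξ
    have hb : ∀ x ξ, truncatedSymbol H Λ ξ₀ ε χ (τ n) (R mm) (δ l) a.1 (x, ξ) =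
        phase m x * β ξ := by
      intro x ξ
      simp only [truncatedSymbol, hβ]
      by_cases hξ : ‖τ n • etaMap H Λ ξ₀ ε ξ‖ < c₀ * R mm
      · rw [hsmall ξ hξ]; simp
      · push Not at hξ
        rw [ha x ξ _ (hρ.trans_le hξ)]
        ring
    rw [integral_mul_wigner_phase_mul n hu m hb hφi]
    have h2 := sum_single_mode_le (S := freqSupport (h n) ξ₀ r) (fun k => fourierCoef (u n) k) m hE0
    refine le_trans ?_ (h2.trans (mul_le_mul_of_nonneg_right (hu.sum_sq_le n _) hE0))
    refine norm_sum_le_of_le _ fun j hj => norm_sum_le_of_le _ fun k hk => ?_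
    rw [norm_mul, norm_mul, RCLike.norm_conj]
    refine mul_le_mul_of_nonneg_left ?_ (by positivity)
    split_ifs with hmjk
    swap
    · rw [zero_mul, norm_zero]
    set ξ := (h n / 2) • latticeVec (k + j) with hξ
    obtain ⟨-, hfreq⟩ := hC₂ (h n) j k hh hmjk ((mem_freqSupport hh).1 hj)
      ((mem_freqSupport hh).1 hk) ξ hξ
    set θ := τ n / h n * (H (h n • latticeVec j) - H (h n • latticeVec k)) with hθ
    set J := ∫ t : ℝ, (φ t : ℂ) * Complex.exp (Complex.I * ((θ * t : ℝ) : ℂ)) with hJ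
    have hJ0 : ‖J‖ ≤ Φ₀ := by
      refine (norm_integral_le_integral_norm _).trans (le_of_eq ?_)
      refine integral_congr_ae (Eventually.of_forall fun t => ?_)
      simp only [norm_mul, Complex.norm_real, mul_comm Complex.I, Complex.norm_exp_ofReal_mul_I,
        mul_one]
    have hJ1 : |θ| * ‖J‖ ≤ Φ₁ := norm_oscillatory_integral_le hφ hφc θ
    set η := etaMap H Λ ξ₀ ε ξ with hη
    have hτη : ‖τ n • η‖ = τ n * ‖η‖ := by rw [norm_smul, Real.norm_of_nonneg hτ.le]
    rw [norm_mul]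
    -- For `τ|η| < c₀R` the factor `1 - χ` vanishes, and for `|η| > C₀δ` the outer cutoff does; this
    -- leaves exactly the range where the three terms are small.
    by_cases hlow : ‖τ n • η‖ < c₀ * R mm
    · simp only [hβ]
      rw [hsmall ξ hlow]
      simpa using hE0
    by_cases hhigh : C₀ * δ l < ‖η‖
    · have : χ ((δ l)⁻¹ • η) = 0 := by
        refine hχ.eq_zero _ ?_
        rw [norm_smul, norm_inv, Real.norm_of_nonneg hδl.le, inv_mul_eq_div, lt_div_iff₀ hδl]
        exact hhigh
      simp only [hβ]
      rw [← hη, this]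
      simpa using hE0
    push Not at hlow hhigh
    rw [hτη] at hlow
    have hcR : 0 < c₀ * R mm := by positivity
    have hη0 : 0 < ‖η‖ := by
      by_contra hcon
      have : ‖η‖ = 0 := le_antisymm (not_lt.1 hcon) (norm_nonneg _)
      rw [this, mul_zero] at hlow
      linarith
    set X := inner ℝ (latticeVec m) (hessian H ξ η) with hX
    have hratio : inner ℝ (latticeVec m) (hessian H ξ (τ n • η : realSpan Λ)) / ‖τ n • η‖ =
        X / ‖η‖ := by
      rw [hτη, Submodule.coe_smul, map_smul, real_inner_smul_right]
      field_simp
      rfl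
    have hXJ : |X| / ‖η‖ * ‖J‖ ≤ Φ₁ / (c₀ * R mm) + C₂ * Φ₀ * (C₀ * δ l + M / (c₀ * R mm)) := by
      have g1 : |X| ≤ |θ| / τ n + C₂ * (‖η‖ ^ 2 + h n) := by
        have : |θ| / τ n = |(H (h n • latticeVec j) - H (h n • latticeVec k)) / h n| := by
          rw [hθ, div_mul_eq_mul_div, mul_div_assoc, abs_mul, abs_of_pos hτ,
            mul_div_cancel_left₀ _ hτ.ne']
        rw [this]
        have := abs_sub_abs_le_abs_sub X ((H (h n • latticeVec j) - H (h n • latticeVec k)) / h n)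
        linarith
      have g2 : 1 / ‖η‖ ≤ τ n / (c₀ * R mm) := by
        rw [div_le_div_iff₀ hη0 hcR]; linarith
      have g3 : |X| * ‖J‖ ≤ Φ₁ / τ n + C₂ * (‖η‖ ^ 2 + h n) * Φ₀ := by
        have g4 : (|θ| / τ n) * ‖J‖ ≤ Φ₁ / τ n := by
          rw [div_mul_eq_mul_div]; exact div_le_div_of_nonneg_right hJ1 hτ.le
        have g5 : C₂ * (‖η‖ ^ 2 + h n) * ‖J‖ ≤ C₂ * (‖η‖ ^ 2 + h n) * Φ₀ :=
          mul_le_mul_of_nonneg_left hJ0 (by positivity)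
        have g6 := mul_le_mul_of_nonneg_right g1 (norm_nonneg J)
        rw [add_mul] at g6
        linarith
      calc |X| / ‖η‖ * ‖J‖ = |X| * ‖J‖ * (1 / ‖η‖) := by ring
        _ ≤ (Φ₁ / τ n + C₂ * (‖η‖ ^ 2 + h n) * Φ₀) * (1 / ‖η‖) :=
            mul_le_mul_of_nonneg_right g3 (by positivity)
        _ = Φ₁ / τ n * (1 / ‖η‖) + C₂ * Φ₀ * (‖η‖ + h n * (1 / ‖η‖)) := by
            field_simp
        _ ≤ Φ₁ / τ n * (τ n / (c₀ * R mm)) + C₂ * Φ₀ * (C₀ * δ l + h n * (τ n / (c₀ * R mm))) := by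
            gcongr
        _ ≤ Φ₁ / (c₀ * R mm) + C₂ * Φ₀ * (C₀ * δ l + M / (c₀ * R mm)) := by
            refine add_le_add (le_of_eq ?_) (mul_le_mul_of_nonneg_left (add_le_add le_rfl ?_)
              (by positivity))
            · field_simp
            · rw [mul_div_assoc']
              exact div_le_div_of_nonneg_right (hu.mul_le n) hcR.le
    have hβn : ‖β ξ‖ ≤ A * (|X| / ‖η‖) := by
      simp only [hβ]
      rw [← hη, hratio, norm_mul, norm_mul, Complex.norm_real, Complex.norm_real, norm_mul,
        Real.norm_eq_abs (X / ‖η‖), abs_div, abs_of_pos hη0]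
      have e1 := hF (ξ, τ n • η)
      have e2 : ‖1 - χ ((R mm)⁻¹ • (τ n • η))‖ ≤ 1 + Cχ := by
        rw [Real.norm_eq_abs, abs_le]
        constructor <;> linarith [hχ.nonneg ((R mm)⁻¹ • (τ n • η)), hχ.le ((R mm)⁻¹ • (τ n • η))]
      have e3 : ‖χ ((δ l)⁻¹ • η)‖ ≤ Cχ := by
        rw [Real.norm_of_nonneg (hχ.nonneg _)]; exact hχ.le _
      have e4 := mul_le_mul e2 e3 (norm_nonneg _) (by linarith)
      have e5 : 0 ≤ |X| / ‖η‖ := by positivity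
      calc _ ≤ CF * (|X| / ‖η‖) * ((1 + Cχ) * Cχ) :=
            mul_le_mul (mul_le_mul_of_nonneg_right e1 e5) e4 (by positivity) (by positivity)
        _ = A * (|X| / ‖η‖) := by rw [hA]; ring
    calc ‖β ξ‖ * ‖J‖ ≤ A * (|X| / ‖η‖) * ‖J‖ := mul_le_mul_of_nonneg_right hβn (norm_nonneg _)
      _ = A * (|X| / ‖η‖ * ‖J‖) := by ring
      _ ≤ E mm l := mul_le_mul_of_nonneg_left hXJ hA0
  have hzero : ‖∫ t : ℝ, (φ t : ℂ) * μ t a‖ ≤ 0 := by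
    refine hlim.norm_le fun κ hκ => ?_
    have hcR_top : Tendsto (fun mm => c₀ * R mm) atTop atTop := hR_top.const_mul_atTop hc₀
    -- The bound is uniform in `n`: `R_m → ∞` removes two terms, and then `δ_l → 0` removes the last
    -- one.
    have hEm : ∀ l, Tendsto (fun mm => M ^ 2 * E mm l) atTop
        (𝓝 (M ^ 2 * (A * (0 + C₂ * Φ₀ * (C₀ * δ l + 0))))) := fun l =>
      (((tendsto_const_nhds.div_atTop hcR_top).add
        (((tendsto_const_nhds.div_atTop hcR_top).const_add _).const_mul _)).const_mul _).const_mul _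
    have hEl : Tendsto (fun l => M ^ 2 * (A * (0 + C₂ * Φ₀ * (C₀ * δ l + 0)))) atTop
        (𝓝 (M ^ 2 * (A * (0 + C₂ * Φ₀ * (C₀ * 0 + 0))))) :=
      (((((hδ0.const_mul _).add_const _).const_mul _).const_add _).const_mul _).const_mul _
    have h0 : M ^ 2 * (A * (0 + C₂ * Φ₀ * (C₀ * 0 + 0))) < κ := by simpa using hκ
    filter_upwards [hEl.eventually (gt_mem_nhds h0)] with l hl
    filter_upwards [(hEm l).eventually (gt_mem_nhds hl), hcR_top.eventually_gt_atTop ρ] with mm h1 h2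
    refine Eventually.of_forall fun n => ?_
    rw [zero_add]
    exact (hbound n mm l h2).trans h1.le
  have := norm_le_zero_iff.1 hzero
  simpa only [Complex.real_smul] using this

end

section


/-! ### A Riesz representation theorem for a positive form on a subspace -/

/-- The hypothesis makes `L` factor through the range of `T`, dominated there by the sublinear
functional `f ↦ C‖f ⊔ 0‖`. This functional vanishes on nonpositive functions, so any Hahn–Banach
extension it dominates is positive and is an integral by Riesz–Markov–Kakutani. -/
theorem exists_measure_of_le {X V : Type*} [TopologicalSpace X] [CompactSpace X] [T2Space X]
    [MeasurableSpace X] [BorelSpace X] [AddCommGroup V] [Module ℝ V] (T : V →ₗ[ℝ] C(X, ℝ))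
    (L : V →ₗ[ℝ] ℝ) {C : ℝ} (hC : 0 ≤ C)
    (hL : ∀ v (c : ℝ), 0 ≤ c → (∀ x, T v x ≤ c) → L v ≤ C * c) :
    ∃ m : Measure X, IsFiniteMeasure m ∧ ∀ v, L v = ∫ x, T v x ∂m := by
  -- `T` need not be injective; a linear section of it lets `L` be defined on the range.
  obtain ⟨g, hg⟩ := T.rangeRestrict.exists_rightInverse_of_surjective
    (LinearMap.range_eq_top.2 T.surjective_rangeRestrict)
  have hker : ∀ v, T v = 0 → L v = 0 := by
    intro v hv
    have h1 := hL v 0 le_rfl (fun x => by rw [hv]; simp)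
    have h2 := hL (-v) 0 le_rfl (fun x => by rw [map_neg, hv]; simp)
    rw [map_neg] at h2
    linarith
  have hTg : ∀ w : LinearMap.range T, T (g w) = w := fun w =>
    congrArg Subtype.val (LinearMap.congr_fun hg w)
  have hLg : ∀ v, L (g ⟨T v, v, rfl⟩) = L v := by
    intro v
    have h1 := hker (g ⟨T v, v, rfl⟩ - v) (by rw [map_sub, hTg, sub_self])
    rw [map_sub] at h1
    linarith
  have hsup : ∀ (f : C(X, ℝ)) x, f x ≤ ‖f ⊔ 0‖ := fun f x =>
    (le_sup_left : f x ≤ f x ⊔ 0).trans ((le_abs_self _).trans ((f ⊔ 0).norm_coe_le_norm x))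
  obtain ⟨G, hG1, hG2⟩ := exists_extension_of_le_sublinear ⟨LinearMap.range T, L ∘ₗ g⟩
    (fun f : C(X, ℝ) => C * ‖f ⊔ 0‖)
    (fun c hc f => by
      have : (c • f) ⊔ 0 = c • (f ⊔ 0) := by
        ext x
        simp [mul_max_of_nonneg _ _ hc.le]
      rw [this, norm_smul, Real.norm_of_nonneg hc.le]
      ring)
    (fun f f' => by
      rw [← mul_add]
      refine mul_le_mul_of_nonneg_left ?_ hC
      refine (ContinuousMap.norm_le _ (by positivity)).2 fun x => ?_
      have h1 := hsup f x
      have h2 := hsup f' x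
      have h3 := norm_nonneg (f ⊔ 0)
      have h4 := norm_nonneg (f' ⊔ 0)
      rw [ContinuousMap.sup_apply, ContinuousMap.add_apply, ContinuousMap.zero_apply,
        Real.norm_of_nonneg (le_max_right _ _)]
      exact max_le (by linarith) (by linarith))
    (fun w => by
      change L (g w) ≤ _
      have h1 := hTg w
      refine (hL (g w) ‖(w : C(X, ℝ)) ⊔ 0‖ (norm_nonneg _) fun x => ?_)
      rw [h1]
      exact hsup _ x)
  have hpos : ∀ f : C(X, ℝ), 0 ≤ f → 0 ≤ G f := by
    intro f hf
    have h1 := hG2 (-f)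
    have h2 : (-f) ⊔ 0 = 0 := sup_eq_right.2 (by simpa using hf)
    simp only [h2, norm_zero, mul_zero, map_neg] at h1
    linarith
  let Gc : CompactlySupportedContinuousMap X ℝ →ₚ[ℝ] ℝ :=
    PositiveLinearMap.mk₀
      { toFun := fun f => G f.toContinuousMap
        map_add' := fun f f' => map_add G f.toContinuousMap f'.toContinuousMap
        map_smul' := fun c f => map_smul G c f.toContinuousMap }
      (fun f hf => hpos _ hf)
  refine ⟨RealRMK.rieszMeasure Gc, inferInstance, fun v => ?_⟩
  have h1 := RealRMK.integral_rieszMeasure Gc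
    (CompactlySupportedContinuousMap.continuousMapEquiv (T v))
  have h2 : Gc (CompactlySupportedContinuousMap.continuousMapEquiv (T v)) = G (T v) := rfl
  rw [h2, hG1 ⟨T v, v, rfl⟩] at h1
  change _ = L (g ⟨T v, v, rfl⟩) at h1
  rw [hLg] at h1
  exact h1.symm

/-! ### Trigonometric functions on the phase space -/

theorem exists_exp_inner_ne {E : Type*} [NormedAddCommGroup E] [InnerProductSpace ℝ E] {x y : E}
    (hxy : x ≠ y) : ∃ ζ : E, Complex.exp (Complex.I * ((inner ℝ ζ x : ℝ) : ℂ)) ≠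
      Complex.exp (Complex.I * ((inner ℝ ζ y : ℝ) : ℂ)) := by
  have hn : ‖x - y‖ ^ 2 ≠ 0 := by simpa [sub_eq_zero] using hxy
  refine ⟨(Real.pi / ‖x - y‖ ^ 2) • (x - y), fun h => ?_⟩
  have h1 : inner ℝ ((Real.pi / ‖x - y‖ ^ 2) • (x - y)) x =
      inner ℝ ((Real.pi / ‖x - y‖ ^ 2) • (x - y)) y + Real.pi := by
    rw [← sub_eq_iff_eq_add', ← inner_sub_right, real_inner_smul_left, real_inner_self_eq_norm_sq]
    exact div_mul_cancel₀ _ hn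
  rw [h1, Complex.ofReal_add, mul_add, Complex.exp_add, mul_comm Complex.I (Real.pi : ℂ),
    Complex.exp_pi_mul_I, mul_neg_one] at h
  exact Complex.exp_ne_zero _ (self_eq_neg.1 h.symm)

variable {d : ℕ} {H : Freq d → ℝ} {Λ : Submodule ℤ (Fin d → ℤ)} {ξ₀ : Freq d} {r ε : ℝ}

/-- `e^{i⟨ζ,ξ⟩ + i⟨ζ',z⟩}`. -/
def expPair {d : ℕ} {Λ : Submodule ℤ (Fin d → ℤ)} (ζ : Freq d × realSpan Λ)
    (q : Freq d × realSpan Λ) : ℂ :=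
  Complex.exp (Complex.I * ((inner ℝ ζ.1 q.1 + inner ℝ ζ.2 q.2 : ℝ) : ℂ))

theorem norm_expPair (ζ q : Freq d × realSpan Λ) : ‖expPair ζ q‖ = 1 := by
  rw [expPair, mul_comm, Complex.norm_exp_ofReal_mul_I]

theorem contDiff_expPair (ζ : Freq d × realSpan Λ) : ContDiff ℝ ∞ (expPair ζ) := by
  unfold expPair
  have h1 : ContDiff ℝ ∞ fun q : Freq d × realSpan Λ =>
      (inner ℝ ζ.1 q.1 + inner ℝ ζ.2 q.2 : ℝ) :=
    (contDiff_const.inner ℝ contDiff_fst).add (contDiff_const.inner ℝ contDiff_snd)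
  exact (contDiff_const.mul (Complex.ofRealCLM.contDiff.comp h1)).cexp

theorem expPair_mul (ζ ζ' q : Freq d × realSpan Λ) :
    expPair ζ q * expPair ζ' q = expPair (ζ + ζ') q := by
  simp only [expPair]
  rw [← Complex.exp_add, ← mul_add, ← Complex.ofReal_add, Prod.fst_add, Prod.snd_add,
    inner_add_left, inner_add_left]
  congr 3
  ring

theorem expPair_conj (ζ q : Freq d × realSpan Λ) :
    (starRingEnd ℂ) (expPair ζ q) = expPair (-ζ) q := by
  simp only [expPair]
  rw [← Complex.exp_conj, map_mul, Complex.conj_I, Complex.conj_ofReal, Prod.fst_neg, Prod.snd_neg,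
    inner_neg_left, inner_neg_left, ← neg_add, Complex.ofReal_neg, neg_mul, mul_neg]

/-- The pair `(ξ, z)` of a point of the phase space. -/
def fiberPair (q : resonantSet H Λ × Compactified Λ) : Freq d × realSpan Λ := (q.1, q.2)

theorem continuous_fiberPair :
    Continuous (fiberPair : resonantSet H Λ × Compactified Λ → Freq d × realSpan Λ) := by
  unfold fiberPair
  fun_prop

/-- `e^{i k·x} e^{i⟨ζ,ξ⟩ + i⟨ζ',z⟩}` on the phase space. -/
def trigFun (H : Freq d → ℝ) (Λ : Submodule ℤ (Fin d → ℤ)) (k : Fin d → ℤ)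
    (ζ : Freq d × realSpan Λ) : BoundedContinuousFunction (PhaseSpace H Λ) ℂ :=
  BoundedContinuousFunction.ofNormedAddCommGroup
    (fun p => phase k p.1 * expPair ζ (fiberPair p.2))
    (((continuous_phase k).comp continuous_fst).mul
      ((contDiff_expPair ζ).continuous.comp (continuous_fiberPair.comp continuous_snd))) 1
    (fun p => by rw [norm_mul, norm_phase, norm_expPair, one_mul])

theorem trigFun_apply (k : Fin d → ℤ) (ζ : Freq d × realSpan Λ) (p : PhaseSpace H Λ) :
    trigFun H Λ k ζ p = phase k p.1 * expPair ζ (fiberPair p.2) := rfl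

/-- The trigonometric polynomials on the phase space. -/
def trigAlgebra (H : Freq d → ℝ) (Λ : Submodule ℤ (Fin d → ℤ)) :
    StarSubalgebra ℂ (BoundedContinuousFunction (PhaseSpace H Λ) ℂ) where
  carrier := Submodule.span ℂ (Set.range fun q : (Fin d → ℤ) × (Freq d × realSpan Λ) =>
    trigFun H Λ q.1 q.2)
  mul_mem' := by
    intro f g hf hg
    simp only [SetLike.mem_coe] at hf hg ⊢
    induction hf, hg using Submodule.span_induction₂ with
    | mem_mem x y hx hy =>
      obtain ⟨⟨k, ζ⟩, rfl⟩ := hx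
      obtain ⟨⟨k', ζ'⟩, rfl⟩ := hy
      refine Submodule.subset_span ⟨(k + k', ζ + ζ'), ?_⟩
      ext p
      simp only [BoundedContinuousFunction.mul_apply, trigFun_apply, phase_add_left,
        ← expPair_mul]
      ring
    | zero_left y hy => simp
    | zero_right x hx => simp
    | add_left x y z _ _ _ h1 h2 => rw [add_mul]; exact Submodule.add_mem _ h1 h2
    | add_right x y z _ _ _ h1 h2 => rw [mul_add]; exact Submodule.add_mem _ h1 h2
    | smul_left c x y _ _ h => rw [smul_mul_assoc]; exact Submodule.smul_mem _ _ h
    | smul_right c x y _ _ h => rw [mul_smul_comm]; exact Submodule.smul_mem _ _ h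
  add_mem' := fun hf hg => Submodule.add_mem _ hf hg
  algebraMap_mem' := by
    intro c
    have h1 : trigFun H Λ 0 0 ∈ Submodule.span ℂ (Set.range fun q : (Fin d → ℤ) ×
        (Freq d × realSpan Λ) => trigFun H Λ q.1 q.2) := Submodule.subset_span ⟨(0, 0), rfl⟩
    have h2 : algebraMap ℂ (BoundedContinuousFunction (PhaseSpace H Λ) ℂ) c =
        c • trigFun H Λ 0 0 := by
      ext p
      simp [trigFun_apply, phase_zero_left, expPair, Algebra.algebraMap_eq_smul_one]
    rw [h2]
    exact Submodule.smul_mem _ _ h1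
  star_mem' := by
    intro f hf
    simp only [SetLike.mem_coe] at hf ⊢
    induction hf using Submodule.span_induction with
    | mem x hx =>
      obtain ⟨⟨k, ζ⟩, rfl⟩ := hx
      refine Submodule.subset_span ⟨(-k, -ζ), ?_⟩
      ext p
      simp only [trigFun_apply, phase_neg_left, ← expPair_conj, BoundedContinuousFunction.star_apply,
        RCLike.star_def, map_mul]
    | zero => rw [star_zero]; exact Submodule.zero_mem _
    | add x y _ _ h1 h2 => rw [star_add]; exact Submodule.add_mem _ h1 h2
    | smul c x _ h => rw [star_smul]; exact Submodule.smul_mem _ _ h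

theorem isClosed_resonantSet (hH : ContDiff ℝ ∞ H) : IsClosed (resonantSet H Λ) := by
  have h1 : resonantSet H Λ = ⋂ k ∈ Λ, {ξ | inner ℝ (latticeVec k) (gradient H ξ) = 0} := by
    ext ξ
    simp [resonantSet, IsOrthogonalTo]
  rw [h1]
  refine isClosed_biInter fun k _ => isClosed_eq ?_ continuous_const
  exact continuous_const.inner (contDiff_gradient hH).continuous

/-- The trigonometric functions span a star algebra that separates points. The phase space need not
be compact, since `I_Λ` may be unbounded; completeness and separability suffice for finite measures.
-/
theorem measure_ext_of_trigFun (hH : ContDiff ℝ ∞ H) {m m' : Measure (PhaseSpace H Λ)}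
    [IsFiniteMeasure m] [IsFiniteMeasure m']
    (h : ∀ k ζ, ∫ p, trigFun H Λ k ζ p ∂m = ∫ p, trigFun H Λ k ζ p ∂m') : m = m' := by
  have : CompleteSpace (resonantSet H Λ) := (isClosed_resonantSet hH).completeSpace_coe
  refine ext_of_forall_mem_subalgebra_integral_eq_of_pseudoEMetric_complete_countable
    (A := trigAlgebra H Λ) ?_ ?_
  · intro p q hpq
    suffices ∃ k ζ, trigFun H Λ k ζ p ≠ trigFun H Λ k ζ q by
      obtain ⟨k, ζ, hk⟩ := this
      exact ⟨_, ⟨_, ⟨trigFun H Λ k ζ, Submodule.subset_span ⟨(k, ζ), rfl⟩, rfl⟩, rfl⟩, hk⟩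
    by_contra! hcon
    refine hpq (Prod.ext ?_ (Prod.ext ?_ ?_))
    · refine phase_separates fun k => ?_
      simpa [trigFun_apply, expPair] using hcon k 0
    · by_contra hne
      obtain ⟨ζ, hζ⟩ := exists_exp_inner_ne (fun h => hne (Subtype.ext h) :
        (p.2.1 : Freq d) ≠ q.2.1)
      exact hζ (by simpa [trigFun_apply, expPair, phase_zero_left, fiberPair] using hcon 0 (ζ, 0))
    · by_contra hne
      obtain ⟨ζ, hζ⟩ := exists_exp_inner_ne (fun h => hne (Subtype.ext h) :
        (p.2.2 : realSpan Λ) ≠ q.2.2)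
      exact hζ (by simpa [trigFun_apply, expPair, phase_zero_left, fiberPair] using hcon 0 (0, ζ))
  · intro g hg
    change g ∈ Submodule.span ℂ _ at hg
    induction hg using Submodule.span_induction with
    | mem x hx => obtain ⟨⟨k, ζ⟩, rfl⟩ := hx; exact h k ζ
    | zero => simp
    | add x y _ _ h1 h2 =>
      simp only [BoundedContinuousFunction.add_apply]
      rw [integral_add (x.integrable m) (y.integrable m),
        integral_add (x.integrable m') (y.integrable m'), h1, h2]
    | smul c x _ h1 =>
      simp only [BoundedContinuousFunction.smul_apply]
      rw [integral_smul, integral_smul, h1]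

/-! ### Shears of the phase space. -/

/-- The shear `(x, ξ, z) ↦ (x + v(ξ, z), ξ, z)`. -/
def shear (v : resonantSet H Λ × Compactified Λ → Freq d) (p : PhaseSpace H Λ) :
    PhaseSpace H Λ :=
  (p.1 + proj (v p.2), p.2)

theorem measurable_shear {v : resonantSet H Λ × Compactified Λ → Freq d} (hv : Measurable v) :
    Measurable (shear v : PhaseSpace H Λ → PhaseSpace H Λ) := by
  unfold shear
  exact (measurable_fst.add (continuous_proj.measurable.comp (hv.comp measurable_snd))).prodMk
    measurable_snd

/-- A measure is invariant by a shear as soon as its trigonometric moments are. -/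
theorem map_shear_eq (hH : ContDiff ℝ ∞ H) {m : Measure (PhaseSpace H Λ)} [IsFiniteMeasure m]
    {v : resonantSet H Λ × Compactified Λ → Freq d} (hv : Measurable v)
    (h : ∀ k ζ, ∫ p, trigFun H Λ k ζ p * (phase k (proj (v p.2)) - 1) ∂m = 0) :
    m.map (shear v) = m := by
  refine measure_ext_of_trigFun hH fun k ζ => ?_
  rw [integral_map (measurable_shear hv).aemeasurable
    (trigFun H Λ k ζ).continuous.aestronglyMeasurable, ← sub_eq_zero, ← integral_sub, ← h k ζ]
  · refine integral_congr_ae (Eventually.of_forall fun p => ?_)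
    simp only [trigFun_apply, shear, phase_add_right]
    ring
  · refine Integrable.of_bound (C := 1)
      ((trigFun H Λ k ζ).continuous.measurable.comp (measurable_shear hv)).aestronglyMeasurable
      (Eventually.of_forall fun p => ?_)
    rw [trigFun_apply, norm_mul, norm_phase, norm_expPair, one_mul]
  · exact (trigFun H Λ k ζ).integrable m

end

section


variable {d : ℕ} {H : Freq d → ℝ} {Λ : Submodule ℤ (Fin d → ℤ)} {ξ₀ : Freq d} {r ε : ℝ}
  {a : Torus d × Freq d × realSpan Λ → ℂ}

/-! ### Symbols on the sphere at infinity -/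

theorem IsSymbol.continuous (ha : IsSymbol Λ ξ₀ r a) : Continuous a := by
  have h1 : IsOpenQuotientMap (Prod.map proj id : Freq d × (Freq d × realSpan Λ) →
      Torus d × (Freq d × realSpan Λ)) := isOpenQuotientMap_proj.prodMap .id
  rw [h1.isQuotientMap.continuous_iff]
  exact ha.smooth.continuous

/-- The symbol on the sphere of radius `ρ`. -/
def radialValue (H : Freq d → ℝ) (a : Torus d × Freq d × realSpan Λ → ℂ) (ρ : ℝ)
    (p : PhaseSpace H Λ) : ℂ :=
  a (p.1, p.2.1, ρ • (p.2.2 : realSpan Λ))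

theorem IsSymbol.continuous_radialValue (ha : IsSymbol Λ ξ₀ r a) (ρ : ℝ) :
    Continuous (radialValue H a ρ) :=
  ha.continuous.comp (by fun_prop)

/-- The function whose radial limit is taken is constant beyond `R₀`. Any such radius computes the
extension at infinity, through a globally continuous function. -/
theorem HasExtent.extendSymbol_eq {r' R₀ ρ : ℝ} (ha : HasExtent ξ₀ a r' R₀) (hρ0 : 0 < ρ)
    (hρ : R₀ < ρ) {p : PhaseSpace H Λ} (hp : ‖(p.2.2 : realSpan Λ)‖ = 1) :
    extendSymbol H Λ a p = radialValue H a ρ p := by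
  rw [extendSymbol, if_neg (by rw [hp]; exact lt_irrefl 1)]
  refine Tendsto.limUnder_eq (tendsto_const_nhds.congr' ?_)
  filter_upwards [eventually_gt_atTop R₀, eventually_gt_atTop 0] with ρ' hρ' hρ'0
  have hn : ‖ρ • (p.2.2 : realSpan Λ)‖ = ρ := by
    rw [norm_smul, hp, mul_one, Real.norm_of_nonneg hρ0.le]
  have h1 := ha.homogeneous p.1 p.2.1 (ρ • (p.2.2 : realSpan Λ)) (ρ' / ρ) (by rwa [hn])
    (by rw [hn, div_mul_cancel₀ _ hρ0.ne']; exact hρ')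
  rw [smul_smul, div_mul_cancel₀ _ hρ0.ne'] at h1
  exact h1.symm

theorem HasExtent.exists_sphere_point {r' R₀ : ℝ} (ha : HasExtent ξ₀ a r' R₀) (hR₀ : 0 < R₀)
    (x : Torus d) {ξ : Freq d} (hξ : ξ ∈ resonantSet H Λ) {η : realSpan Λ} (hη : R₀ < ‖η‖) :
    ∃ p : PhaseSpace H Λ, (p.2.1 : Freq d) = ξ ∧ ‖(p.2.2 : realSpan Λ)‖ = 1 ∧
      extendSymbol H Λ a p = a (x, ξ, η) := by
  obtain ⟨ρ, hρ⟩ : ∃ ρ : ℝ, ‖η‖ = ρ := ⟨_, rfl⟩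
  rw [hρ] at hη
  have hρ0 : 0 < ρ := hR₀.trans hη
  have hz : ‖ρ⁻¹ • η‖ = 1 := by
    rw [norm_smul, hρ, norm_inv, Real.norm_of_nonneg hρ0.le, inv_mul_cancel₀ hρ0.ne']
  obtain ⟨p, hp1, hp2, hp3⟩ : ∃ p : PhaseSpace H Λ, p.1 = x ∧ (p.2.1 : Freq d) = ξ ∧
      (p.2.2 : realSpan Λ) = ρ⁻¹ • η :=
    ⟨(x, ⟨ξ, hξ⟩, ⟨ρ⁻¹ • η, mem_closedBall_zero_iff.2 hz.le⟩), rfl, rfl, rfl⟩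
  rw [← hp3] at hz
  refine ⟨p, hp2, hz, ?_⟩
  rw [ha.extendSymbol_eq hρ0 hη hz, radialValue, hp1, hp2, hp3, smul_smul,
    mul_inv_cancel₀ hρ0.ne', one_smul]

/-- The points at infinity over the closed ball `B(ξ₀, r)`. -/
def sphereSet (H : Freq d → ℝ) (Λ : Submodule ℤ (Fin d → ℤ)) (ξ₀ : Freq d) (r : ℝ) :
    Set (PhaseSpace H Λ) :=
  {p | (p.2.1 : Freq d) ∈ Metric.closedBall ξ₀ r ∧ ‖(p.2.2 : realSpan Λ)‖ = 1}

theorem isCompact_sphereSet (hH : ContDiff ℝ ∞ H) : IsCompact (sphereSet H Λ ξ₀ r) := by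
  have h1 : IsClosedEmbedding (Subtype.val : resonantSet H Λ → Freq d) :=
    (isClosed_resonantSet hH).isClosedEmbedding_subtypeVal
  have h2 : IsCompact ((Subtype.val : resonantSet H Λ → Freq d) ⁻¹' Metric.closedBall ξ₀ r) :=
    h1.isCompact_preimage (isCompact_closedBall _ _)
  have h3 : IsClosed {z : Compactified Λ | ‖(z : realSpan Λ)‖ = 1} :=
    isClosed_eq (by fun_prop) continuous_const
  have h4 : sphereSet H Λ ξ₀ r = Set.univ ×ˢ
      (((Subtype.val : resonantSet H Λ → Freq d) ⁻¹' Metric.closedBall ξ₀ r) ×ˢ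
        {z : Compactified Λ | ‖(z : realSpan Λ)‖ = 1}) := by
    ext p
    simp [sphereSet]
  rw [h4]
  exact isCompact_univ.prod (h2.prod h3.isCompact)

theorem IsSymbol.extendSymbol_eventuallyEq (ha : IsSymbol Λ ξ₀ r a) :
    ∀ᶠ ρ in atTop, ∀ p : PhaseSpace H Λ, ‖(p.2.2 : realSpan Λ)‖ = 1 →
      extendSymbol H Λ a p = radialValue H a ρ p := by
  obtain ⟨r', -, R₀, hR₀, ha⟩ := ha.exists_hasExtent
  filter_upwards [eventually_gt_atTop R₀] with ρ hρ p hp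
  exact ha.extendSymbol_eq (hR₀.trans hρ) hρ hp

/-- The real part of the extension of a symbol, as a continuous function at infinity. -/
def sphereRestrict (H : Freq d → ℝ) (Λ : Submodule ℤ (Fin d → ℤ)) (ξ₀ : Freq d) (r : ℝ) :
    SymbolSpace Λ ξ₀ r →ₗ[ℝ] C(sphereSet H Λ ξ₀ r, ℝ) where
  toFun a :=
    { toFun := fun p => (extendSymbol H Λ a.1 p.1).re
      continuous_toFun := by
        obtain ⟨ρ, hρ⟩ := (IsSymbol.extendSymbol_eventuallyEq (H := H) a.2).exists
        simp only [fun p : sphereSet H Λ ξ₀ r => hρ p.1 p.2.2]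
        exact Complex.continuous_re.comp ((IsSymbol.continuous_radialValue a.2 ρ).comp
          continuous_subtype_val) }
  map_add' a b := by
    obtain ⟨ρ, h1, h2, h3⟩ := ((IsSymbol.extendSymbol_eventuallyEq (H := H) a.2).and
      ((IsSymbol.extendSymbol_eventuallyEq (H := H) b.2).and
        (IsSymbol.extendSymbol_eventuallyEq (H := H) (a + b).2))).exists
    ext p
    simp only [ContinuousMap.coe_mk, ContinuousMap.add_apply]
    rw [h1 _ p.2.2, h2 _ p.2.2, h3 _ p.2.2]
    rfl
  map_smul' c a := by
    obtain ⟨ρ, h1, h2⟩ := ((IsSymbol.extendSymbol_eventuallyEq (H := H) a.2).and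
        (IsSymbol.extendSymbol_eventuallyEq (H := H) (c • a).2)).exists
    ext p
    simp only [ContinuousMap.coe_mk, ContinuousMap.smul_apply, RingHom.id_apply]
    rw [h1 _ p.2.2, h2 _ p.2.2]
    change ((c : ℝ) • radialValue H a.1 ρ p.1).re = _
    simp

theorem sphereRestrict_apply (a : SymbolSpace Λ ξ₀ r) (p : sphereSet H Λ ξ₀ r) :
    sphereRestrict H Λ ξ₀ r a p = (extendSymbol H Λ a.1 p.1).re := rfl

/-! ### Symbols with a single mode -/

theorem isSymbol_phase_mul {m : Fin d → ℤ} (hm : m ∈ Λ) {g : Freq d × realSpan Λ → ℂ}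
    (hg : ContDiff ℝ ∞ g) {K : Set (Freq d)} (hK : IsCompact K) (hKr : K ⊆ Metric.ball ξ₀ r)
    (hgK : ∀ ξ η, ξ ∉ K → g (ξ, η) = 0) {R₀ : ℝ} (hR₀ : 0 < R₀)
    {ghom : Freq d × realSpan Λ → ℂ}
    (hghom : ∀ ξ η, R₀ < ‖η‖ → g (ξ, η) = ghom (ξ, ‖η‖⁻¹ • η)) :
    IsSymbol Λ ξ₀ r (fun p => phase m p.1 * g p.2) where
  smooth := by
    have h1 : symbolLift (fun p : Torus d × Freq d × realSpan Λ => phase m p.1 * g p.2) =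
        fun p => Complex.exp (Complex.I * ((inner ℝ (latticeVec m) p.1 : ℝ) : ℂ)) * g p.2 := by
      funext p
      simp only [symbolLift, phase_proj]
    rw [h1]
    have h2 : ContDiff ℝ ∞ fun p : Freq d × Freq d × realSpan Λ =>
        (inner ℝ (latticeVec m) p.1 : ℝ) := contDiff_const.inner ℝ contDiff_fst
    exact ((contDiff_const.mul (Complex.ofRealCLM.contDiff.comp h2)).cexp).mul
      (hg.comp contDiff_snd)
  compactSupport := ⟨K, hK, hKr, fun x ξ η hξ => by simp only [hgK ξ η hξ, mul_zero]⟩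
  homogeneous := ⟨R₀, hR₀, fun p => phase m p.1 * ghom p.2, fun x ξ η hη => by
    simp only [hghom ξ η hη]⟩
  modes := fun k hk ξ η => by
    simp only [fourierCoef_phase_mul]
    rw [if_neg]
    rintro rfl
    exact hk hm

/-- A bump function of `ξ`, as a symbol. -/
def bumpSymbol (Λ : Submodule ℤ (Fin d → ℤ)) {ξ₀ : Freq d} (κ : ContDiffBump ξ₀) {r : ℝ}
    (hκ : κ.rOut < r) : SymbolSpace Λ ξ₀ r :=
  ⟨fun p => phase 0 p.1 * (κ p.2.1 : ℂ), isSymbol_phase_mul (g := fun q => (κ q.1 : ℂ))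
    (ghom := fun q => (κ q.1 : ℂ)) Λ.zero_mem
    (Complex.ofRealCLM.contDiff.comp (κ.contDiff.comp contDiff_fst))
    (isCompact_closedBall ξ₀ κ.rOut) (Metric.closedBall_subset_ball hκ)
    (fun ξ _ hξ => by
      rw [κ.zero_of_le_dist (not_le.1 hξ).le, Complex.ofReal_zero])
    one_pos (fun _ _ _ => rfl)⟩

theorem bumpSymbol_apply {κ : ContDiffBump ξ₀} (hκ : κ.rOut < r) (x : Torus d) (ξ : Freq d)
    (η : realSpan Λ) : (bumpSymbol Λ κ hκ).1 (x, ξ, η) = (κ ξ : ℂ) := by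
  simp [bumpSymbol, phase_zero_left]

/-! ### Positive forms -/

/-- A linear form on symbols that only sees the sphere at infinity over `I_Λ`, where it is
positive, and of bounded mass. -/
structure IsPositiveAtInfinity (H : Freq d → ℝ) (Λ : Submodule ℤ (Fin d → ℤ)) (ξ₀ : Freq d)
    (r C : ℝ) (ℓ : SymbolSpace Λ ξ₀ r →ₗ[ℂ] ℂ) : Prop where
  nonneg : ∀ (a : SymbolSpace Λ ξ₀ r) (R₀ : ℝ), (∀ x ξ η, ξ ∈ resonantSet H Λ →
    ξ ∈ Metric.ball ξ₀ r → R₀ < ‖η‖ → 0 ≤ (a.1 (x, ξ, η)).re) → 0 ≤ (ℓ a).re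
  mass_le : ∀ (a : SymbolSpace Λ ξ₀ r) (f : Freq d × realSpan Λ → ℂ),
    (∀ x ξ η, a.1 (x, ξ, η) = f (ξ, η)) → (∀ p, ‖f p‖ ≤ 1) → (ℓ a).re ≤ C

variable {C : ℝ} {ℓ : SymbolSpace Λ ξ₀ r →ₗ[ℂ] ℂ}

/-- For a bump `κ` equal to `1` on the support of `a`, the symbol `cκ - a` has nonnegative real part
at infinity, so `Re ℓ(a) ≤ c Re ℓ(κ) ≤ C c`. -/
theorem IsPositiveAtInfinity.re_le (hℓ : IsPositiveAtInfinity H Λ ξ₀ r C ℓ) (hr : 0 < r)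
    (a : SymbolSpace Λ ξ₀ r) {c : ℝ} (hc : 0 ≤ c)
    (hac : ∀ p : sphereSet H Λ ξ₀ r, sphereRestrict H Λ ξ₀ r a p ≤ c) : (ℓ a).re ≤ C * c := by
  obtain ⟨r', hr', R₀, hR₀, ha⟩ := IsSymbol.exists_hasExtent a.2
  have h1 : max r' (r / 2) < r := max_lt hr' (by linarith)
  have h2 : 0 < max r' (r / 2) := lt_max_of_lt_right (by linarith)
  -- The maximum with `r/2` is needed because `r'` may be nonpositive.
  let κ : ContDiffBump ξ₀ := ⟨max r' (r / 2), (max r' (r / 2) + r) / 2, h2, by linarith⟩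
  have hκ : κ.rOut < r := by
    change (max r' (r / 2) + r) / 2 < r
    linarith
  have h3 := hℓ.nonneg ((c : ℂ) • bumpSymbol Λ κ hκ - a) R₀ (by
    intro x ξ η hξI hξr hη
    change 0 ≤ ((c : ℂ) * (bumpSymbol Λ κ hκ).1 (x, ξ, η) - a.1 (x, ξ, η)).re
    rw [bumpSymbol_apply, ← Complex.ofReal_mul, Complex.sub_re, Complex.ofReal_re, sub_nonneg]
    by_cases hξ : r' < dist ξ ξ₀
    · rw [ha.eq_zero x ξ η hξ]
      exact mul_nonneg hc κ.nonneg
    · have hκ1 : κ ξ = 1 := κ.one_of_mem_closedBall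
        (Metric.mem_closedBall.2 ((not_lt.1 hξ).trans (le_max_left _ _)))
      obtain ⟨p, hp1, hp2, hp3⟩ := ha.exists_sphere_point hR₀ x hξI hη
      have h4 := hac ⟨p, by rw [hp1]; exact Metric.ball_subset_closedBall hξr, hp2⟩
      rw [sphereRestrict_apply, hp3] at h4
      rw [hκ1, mul_one]
      exact h4)
  have h5 := hℓ.mass_le (bumpSymbol Λ κ hκ) (fun q => (κ q.1 : ℂ))
    (fun x ξ η => bumpSymbol_apply hκ x ξ η) (fun p => by
      rw [Complex.norm_real, Real.norm_of_nonneg κ.nonneg]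
      exact κ.le_one)
  rw [map_sub, map_smul, Complex.sub_re, smul_eq_mul, Complex.re_ofReal_mul] at h3
  nlinarith

theorem IsPositiveAtInfinity.const_nonneg (hℓ : IsPositiveAtInfinity H Λ ξ₀ r C ℓ) : 0 ≤ C := by
  have h1 := hℓ.mass_le 0 0 (fun _ _ _ => rfl) (by simp)
  simpa using h1

/-! ### Representation of a positive form by a measure at infinity. -/

/-- A measure represents a form on symbols when it is concentrated at infinity over the ball and
its integrals against symbols are the values of the form. -/
structure Represents (H : Freq d → ℝ) (m : Measure (PhaseSpace H Λ))
    (ℓ : SymbolSpace Λ ξ₀ r →ₗ[ℂ] ℂ) : Prop where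
  sphere : ∀ᵐ p ∂m, ‖(p.2.2 : realSpan Λ)‖ = 1
  ball : ∀ᵐ p ∂m, (p.2.1 : Freq d) ∈ Metric.ball ξ₀ r
  integral : ∀ a : SymbolSpace Λ ξ₀ r, ∀ᶠ ρ in atTop, ℓ a = ∫ p, radialValue H a.1 ρ p ∂m

theorem IsSymbol.integrable_radialValue (ha : IsSymbol Λ ξ₀ r a) (ρ : ℝ)
    (m : Measure (PhaseSpace H Λ)) [IsFiniteMeasure m] : Integrable (radialValue H a ρ) m := by
  obtain ⟨B, -, hB⟩ := ha.exists_bound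
  exact Integrable.of_bound (ha.continuous_radialValue ρ).aestronglyMeasurable B
    (Eventually.of_forall fun p => hB _)

theorem IsPositiveAtInfinity.exists_represents (hH : ContDiff ℝ ∞ H) (hr : 0 < r)
    (hℓ : IsPositiveAtInfinity H Λ ξ₀ r C ℓ) :
    ∃ m : Measure (PhaseSpace H Λ), IsFiniteMeasure m ∧ Represents H m ℓ := by
  have : CompactSpace (sphereSet H Λ ξ₀ r) := isCompact_iff_compactSpace.1 (isCompact_sphereSet hH)
  obtain ⟨m₀, hm₀, hint⟩ := exists_measure_of_le (sphereRestrict H Λ ξ₀ r)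
    (Complex.reLm ∘ₗ ℓ.restrictScalars ℝ) hℓ.const_nonneg
    (fun a c hc h => hℓ.re_le hr a hc h)
  have hsm : MeasurableSet (sphereSet H Λ ξ₀ r) := (isCompact_sphereSet hH).measurableSet
  have hbm : MeasurableSet {p : PhaseSpace H Λ | (p.2.1 : Freq d) ∈ Metric.ball ξ₀ r} :=
    (Metric.isOpen_ball.preimage (by fun_prop :
      Continuous fun p : PhaseSpace H Λ => (p.2.1 : Freq d))).measurableSet
  -- The closed ball was used for compactness. Restriction to the open ball changes no integral,
  -- since each symbol vanishes beyond some `r' < r`.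
  set m := (m₀.map Subtype.val).restrict {p : PhaseSpace H Λ | (p.2.1 : Freq d) ∈ Metric.ball ξ₀ r}
    with hm
  have hsph : ∀ᵐ p ∂m₀.map Subtype.val, p ∈ sphereSet H Λ ξ₀ r := by
    exact (ae_map_iff measurable_subtype_coe.aemeasurable hsm).2
      (Eventually.of_forall fun p => p.2)
  have hre : ∀ a : SymbolSpace Λ ξ₀ r, ∀ᶠ ρ in atTop,
      (ℓ a).re = ∫ p, (radialValue H a.1 ρ p).re ∂m := by
    intro a
    obtain ⟨r', hr', R₀, hR₀, ha⟩ := IsSymbol.exists_hasExtent a.2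
    filter_upwards [IsSymbol.extendSymbol_eventuallyEq (H := H) a.2] with ρ hρ
    rw [hm, setIntegral_eq_integral_of_forall_compl_eq_zero,
      (MeasurableEmbedding.subtype_coe hsm).integral_map]
    · refine (hint a).trans (integral_congr_ae (Eventually.of_forall fun p => ?_))
      simp only [sphereRestrict_apply, hρ p.1 p.2.2]
    · intro p hp
      rw [radialValue, ha.eq_zero _ _ _ (hr'.trans_le (not_lt.1 hp)), Complex.zero_re]
  refine ⟨m, inferInstance, ?_, ae_restrict_mem hbm, fun a => ?_⟩
  · exact ae_restrict_of_ae (hsph.mono fun p hp => hp.2)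
  -- Riesz is applied to the real part only; the imaginary part of `ℓ a` is the real part of `ℓ (-i
  -- a)`.
  · filter_upwards [hre a, hre ((-Complex.I) • a)] with ρ h1 h2
    have hi := IsSymbol.integrable_radialValue a.2 ρ m
    have h3 : ∫ p, (radialValue H a.1 ρ p).re ∂m = (∫ p, radialValue H a.1 ρ p ∂m).re :=
      integral_re hi
    have h4 : ∫ p, (radialValue H a.1 ρ p).im ∂m = (∫ p, radialValue H a.1 ρ p ∂m).im :=
      integral_im hi
    have h5 : ∀ p, (radialValue H ((-Complex.I) • a).1 ρ p).re = (radialValue H a.1 ρ p).im := by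
      intro p
      change ((-Complex.I) * radialValue H a.1 ρ p).re = _
      simp
    simp only [h5] at h2
    rw [map_smul, h4] at h2
    rw [h3] at h1
    refine Complex.ext h1 ?_
    rw [← h2]
    simp

end

section


variable {d : ℕ} {H : Freq d → ℝ} {Λ : Submodule ℤ (Fin d → ℤ)} {ξ₀ : Freq d} {r ε : ℝ}
  {C : ℝ} {ℓ : SymbolSpace Λ ξ₀ r →ₗ[ℂ] ℂ}

/-! ### Averaging over the annihilator of `Λ` -/

/-- The subgroup of the torus on which all characters of `Λ` are trivial. -/
def annihilator {d : ℕ} (Λ : Submodule ℤ (Fin d → ℤ)) : AddSubgroup (Torus d) where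
  carrier := {g | ∀ k ∈ Λ, phase k g = 1}
  zero_mem' := fun k _ => phase_zero_right k
  add_mem' := fun ha hb k hk => by rw [phase_add_right, ha k hk, hb k hk, one_mul]
  neg_mem' := fun {g} hg k hk => by
    have h1 := phase_add_right k g (-g)
    rw [add_neg_cancel, phase_zero_right, hg k hk, one_mul] at h1
    exact h1.symm

theorem isClosed_annihilator : IsClosed (annihilator Λ : Set (Torus d)) := by
  have h1 : (annihilator Λ : Set (Torus d)) = ⋂ k ∈ Λ, {g | phase k g = 1} := by
    ext g
    simp [annihilator]
  rw [h1]
  exact isClosed_biInter fun k _ => isClosed_eq (continuous_phase k) continuous_const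

instance : CompactSpace (annihilator Λ) := isCompact_iff_compactSpace.1 isClosed_annihilator.isCompact

theorem proj_mem_annihilator {v : Freq d} (hv : IsOrthogonalTo Λ v) : proj v ∈ annihilator Λ := by
  intro k hk
  rw [phase_proj, hv k hk, Complex.ofReal_zero, mul_zero, Complex.exp_zero]

/-- The Haar probability measure on the annihilator of `Λ`. -/
def annihilatorMeasure (Λ : Submodule ℤ (Fin d → ℤ)) : Measure (annihilator Λ) :=
  Measure.addHaarMeasure ⊤

instance : Measure.IsAddHaarMeasure (annihilatorMeasure Λ) :=
  inferInstanceAs (Measure.IsAddHaarMeasure (Measure.addHaarMeasure _))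

instance : IsProbabilityMeasure (annihilatorMeasure Λ) :=
  ⟨Measure.addHaarMeasure_self⟩

/-- The action of the annihilator on the phase space. -/
def act (q : PhaseSpace H Λ × annihilator Λ) : PhaseSpace H Λ := (q.1.1 + q.2, q.1.2)

theorem measurable_act : Measurable (act : PhaseSpace H Λ × annihilator Λ → PhaseSpace H Λ) :=
  ((measurable_fst.comp measurable_fst).add (measurable_subtype_coe.comp measurable_snd)).prodMk
    (measurable_snd.comp measurable_fst)

/-- The average of a measure over the annihilator of `Λ`. -/
def average (m : Measure (PhaseSpace H Λ)) : Measure (PhaseSpace H Λ) :=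
  (m.prod (annihilatorMeasure Λ)).map act

instance (m : Measure (PhaseSpace H Λ)) [IsFiniteMeasure m] : IsFiniteMeasure (average m) :=
  inferInstanceAs (IsFiniteMeasure (Measure.map _ _))

theorem measurable_translate (v : Freq d) : Measurable (translate H Λ v) := by
  unfold translate
  exact Continuous.measurable (by fun_prop)

theorem average_map_translate (m : Measure (PhaseSpace H Λ)) [IsFiniteMeasure m] {v : Freq d}
    (hv : IsOrthogonalTo Λ v) : (average m).map (translate H Λ v) = average m := by
  let g : annihilator Λ := ⟨proj v, proj_mem_annihilator hv⟩
  have h1 : (m.prod (annihilatorMeasure Λ)).map (Prod.map id (· + g)) =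
      m.prod (annihilatorMeasure Λ) := by
    rw [← Measure.map_prod_map _ _ measurable_id (measurable_add_const g), Measure.map_id,
      map_add_right_eq_self]
  rw [average, Measure.map_map (measurable_translate v) measurable_act]
  conv_rhs => rw [← h1]
  rw [Measure.map_map measurable_act (measurable_id.prodMap (measurable_add_const g))]
  congr 1
  funext q
  simp [translate, act, g, add_assoc]

/-- Symbols are invariant under the annihilator, and the action moves only `x`, so neither the
integrals nor the support in `ξ` and `z` change. -/
theorem Represents.average {m : Measure (PhaseSpace H Λ)} [IsFiniteMeasure m]
    (hm : Represents H m ℓ) : Represents H (average m) ℓ where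
  sphere := by
    have h1 : MeasurableSet {p : PhaseSpace H Λ | ‖(p.2.2 : realSpan Λ)‖ = 1} :=
      (isClosed_eq (by fun_prop) continuous_const).measurableSet
    exact (ae_map_iff measurable_act.aemeasurable h1).2
      (Measure.quasiMeasurePreserving_fst.ae hm.sphere)
  ball := by
    have h1 : MeasurableSet {p : PhaseSpace H Λ | (p.2.1 : Freq d) ∈ Metric.ball ξ₀ r} :=
      (Metric.isOpen_ball.preimage (by fun_prop :
        Continuous fun p : PhaseSpace H Λ => (p.2.1 : Freq d))).measurableSet
    exact (ae_map_iff measurable_act.aemeasurable h1).2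
      (Measure.quasiMeasurePreserving_fst.ae hm.ball)
  integral a := by
    filter_upwards [hm.integral a] with ρ hρ
    have h1 : ∀ q : PhaseSpace H Λ × annihilator Λ,
        radialValue H a.1 ρ (act q) = radialValue H a.1 ρ q.1 := fun q =>
      IsSymbol.translate_eq a.2 q.2.2 _ _ _
    rw [hρ, TwoMicrolocal.average, integral_map measurable_act.aemeasurable
      (IsSymbol.continuous_radialValue a.2 ρ).aestronglyMeasurable]
    simp only [h1]
    rw [integral_fun_fst, probReal_univ, one_smul]

/-! ### Invariance -/

/-- Modes outside `Λ` do not contribute. -/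
theorem integral_phase_mul_eq_zero (hΛ : IsPrimitive Λ) {m : Measure (PhaseSpace H Λ)}
    (hm : ∀ v, IsOrthogonalTo Λ v → m.map (translate H Λ v) = m) {k : Fin d → ℤ} (hk : k ∉ Λ)
    {c : resonantSet H Λ × Compactified Λ → ℂ} (hc : Measurable c) :
    ∫ p : PhaseSpace H Λ, phase k p.1 * c p.2 ∂m = 0 := by
  obtain ⟨v, hv, hkv⟩ := hΛ.exists_orthogonal_phase_ne_one hk
  have hf : Measurable fun p : PhaseSpace H Λ => phase k p.1 * c p.2 :=
    ((continuous_phase k).measurable.comp measurable_fst).mul (hc.comp measurable_snd)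
  -- Translation by `v` preserves the measure and changes the sign of the integrand.
  have h1 : ∫ p : PhaseSpace H Λ, phase k p.1 * c p.2 ∂m =
      -∫ p : PhaseSpace H Λ, phase k p.1 * c p.2 ∂m := by
    conv_lhs => rw [← hm v hv]
    rw [integral_map (measurable_translate v).aemeasurable hf.aestronglyMeasurable, ← integral_neg]
    refine integral_congr_ae (Eventually.of_forall fun p => ?_)
    simp only [translate, phase_add_right, hkv]
    ring
  exact self_eq_neg.1 h1

/-- A shear depends on `(ξ, z)` only, so it multiplies each mode by a function of `(ξ, z)`; modes
outside `Λ` integrate to zero by `integral_phase_mul_eq_zero`. -/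
theorem map_shear_eq_of_modes (hH : ContDiff ℝ ∞ H) (hΛ : IsPrimitive Λ)
    {m : Measure (PhaseSpace H Λ)} [IsFiniteMeasure m]
    (hm : ∀ v, IsOrthogonalTo Λ v → m.map (translate H Λ v) = m)
    {v : resonantSet H Λ × Compactified Λ → Freq d} (hv : Measurable v)
    (h : ∀ k ∈ Λ, ∀ ζ, ∫ p, trigFun H Λ k ζ p * (phase k (proj (v p.2)) - 1) ∂m = 0) :
    m.map (shear v) = m := by
  refine map_shear_eq hH hv fun k ζ => ?_
  by_cases hk : k ∈ Λ
  · exact h k hk ζ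
  · simp only [trigFun_apply, mul_assoc]
    refine integral_phase_mul_eq_zero hΛ hm hk
      (c := fun q => expPair ζ (fiberPair q) * (phase k (proj (v q)) - 1)) ?_
    exact ((contDiff_expPair ζ).continuous.comp continuous_fiberPair).measurable.mul
      (((continuous_phase k).comp continuous_proj).measurable.comp hv |>.sub_const 1)

theorem map_flowZero_eq (hH : ContDiff ℝ ∞ H) (hΛ : IsPrimitive Λ)
    {m : Measure (PhaseSpace H Λ)} [IsFiniteMeasure m]
    (hm : ∀ v, IsOrthogonalTo Λ v → m.map (translate H Λ v) = m) (s : ℝ) :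
    m.map (flowZero H Λ s) = m := by
  have hc : Continuous fun q : resonantSet H Λ × Compactified Λ => s • gradient H (q.1 : Freq d) :=
    ((contDiff_gradient hH).continuous.comp (by fun_prop)).const_smul s
  refine map_shear_eq_of_modes hH hΛ hm hc.measurable fun k hk ζ => ?_
  have h1 : ∀ p : PhaseSpace H Λ, phase k (proj (s • gradient H (p.2.1 : Freq d))) = 1 := by
    intro p
    rw [phase_proj, real_inner_smul_right, p.2.1.2 k hk, mul_zero, Complex.ofReal_zero, mul_zero,
      Complex.exp_zero]
  simp [h1]

/-! ### The Hessian flow -/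

/-- Near `0` the factor `1 - β` vanishes identically, and elsewhere the norm is smooth. This extends
a function on the sphere to a symbol homogeneous at infinity. -/
theorem contDiff_cutoff_mul_radial {E F : Type*} [NormedAddCommGroup E] [NormedSpace ℝ E]
    [NormedAddCommGroup F] [InnerProductSpace ℝ F] [FiniteDimensional ℝ F]
    (β : ContDiffBump (0 : F)) {g : E × F → ℂ} (hg : ContDiff ℝ ∞ g) :
    ContDiff ℝ ∞ fun q : E × F => ((1 - β q.2 : ℝ) : ℂ) * g (q.1, ‖q.2‖⁻¹ • q.2) := by
  rw [contDiff_iff_contDiffAt]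
  intro q
  by_cases hq : q.2 = 0
  · have h1 : ∀ᶠ y : E × F in 𝓝 q, β y.2 = 1 := by
      have h2 : Tendsto (fun y : E × F => y.2) (𝓝 q) (𝓝 0) := by
        have := (continuous_snd : Continuous fun y : E × F => y.2).tendsto q
        rwa [hq] at this
      exact h2.eventually β.eventuallyEq_one
    refine (contDiffAt_const (c := (0 : ℂ))).congr_of_eventuallyEq ?_
    filter_upwards [h1] with y hy
    rw [hy, sub_self, Complex.ofReal_zero, zero_mul]
  · have h1 : ContDiffAt ℝ ∞ (fun y : E × F => ‖y.2‖⁻¹) q :=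
      ((contDiffAt_norm ℝ hq).comp q contDiffAt_snd).inv (norm_ne_zero_iff.2 hq)
    have h2 : ContDiffAt ℝ ∞ (fun y : E × F => (1 - β y.2 : ℝ)) q :=
      contDiffAt_const.sub (β.contDiff.contDiffAt.comp q contDiffAt_snd)
    exact (Complex.ofRealCLM.contDiff.contDiffAt.comp q h2).mul
      (hg.contDiffAt.comp q (contDiffAt_fst.prodMk (h1.smul contDiffAt_snd)))

/-- The moments of the increment along the Hessian flow, localized in `ξ`. -/
theorem integral_hessian_increment_bump (hH : ContDiff ℝ ∞ H)
    (hℓ : ∀ (a : SymbolSpace Λ ξ₀ r) (k : Fin d → ℤ), k ∈ Λ → ∀ (F : Freq d × realSpan Λ → ℂ)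
      (CF ρ : ℝ), (∀ p, ‖F p‖ ≤ CF) → (∀ x ξ (η : realSpan Λ), ρ < ‖η‖ →
        a.1 (x, ξ, η) = phase k x *
          (F (ξ, η) * ((inner ℝ (latticeVec k) (hessian H ξ η) / ‖η‖ : ℝ) : ℂ))) → ℓ a = 0)
    {m : Measure (PhaseSpace H Λ)} (hm : Represents H m ℓ) {k : Fin d → ℤ} (hk : k ∈ Λ)
    (ζ : Freq d × realSpan Λ) (s : ℝ) (κ : ContDiffBump ξ₀) (hκ : κ.rOut < r) :
    ∫ p : PhaseSpace H Λ, (κ (p.2.1 : Freq d) : ℂ) * (trigFun H Λ k ζ p *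
      (phase k (proj (s • hessian H (p.2.1 : Freq d) (p.2.2 : realSpan Λ))) - 1)) ∂m = 0 := by
  let θ : Freq d × realSpan Λ → ℝ := fun q => inner ℝ (latticeVec k) (hessian H q.1 q.2)
  have hθ : ContDiff ℝ ∞ θ := contDiff_const.inner ℝ
    (((contDiff_hessian hH).comp contDiff_fst).clm_apply
      ((realSpan Λ).subtypeL.contDiff.comp contDiff_snd))
  -- The localized increment, without its factor `phase k`; its restriction to the sphere becomes a
  -- symbol.
  let g : Freq d × realSpan Λ → ℂ := fun q =>
    (κ q.1 : ℂ) * (expPair ζ q * (Complex.exp (Complex.I * ((s * θ q : ℝ) : ℂ)) - 1))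
  have hg : ContDiff ℝ ∞ g :=
    (Complex.ofRealCLM.contDiff.comp (κ.contDiff.comp contDiff_fst)).mul
      ((contDiff_expPair ζ).mul ((contDiff_const.mul (Complex.ofRealCLM.contDiff.comp
        (contDiff_const.mul hθ))).cexp.sub contDiff_const))
  let β : ContDiffBump (0 : realSpan Λ) := ⟨1, 2, one_pos, one_lt_two⟩
  have hβ : ∀ η : realSpan Λ, 2 < ‖η‖ → β η = 0 := fun η hη =>
    β.zero_of_le_dist (by rw [dist_zero_right]; exact hη.le)
  let G : Freq d × realSpan Λ → ℂ := fun q => ((1 - β q.2 : ℝ) : ℂ) * g (q.1, ‖q.2‖⁻¹ • q.2)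
  have hGβ : ∀ ξ (η : realSpan Λ), 2 < ‖η‖ → G (ξ, η) = g (ξ, ‖η‖⁻¹ • η) := fun ξ η hη => by
    simp only [G]
    rw [hβ η hη, sub_zero, Complex.ofReal_one, one_mul]
  have hGκ : ∀ ξ (η : realSpan Λ), ξ ∉ Metric.closedBall ξ₀ κ.rOut → G (ξ, η) = 0 := by
    intro ξ η hξ
    simp only [G, g]
    rw [κ.zero_of_le_dist (not_le.1 hξ).le, Complex.ofReal_zero, zero_mul, mul_zero]
  have hsym : IsSymbol Λ ξ₀ r (fun p => phase k p.1 * G p.2) :=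
    isSymbol_phase_mul (g := G) hk (contDiff_cutoff_mul_radial β hg)
      (isCompact_closedBall ξ₀ κ.rOut) (Metric.closedBall_subset_ball hκ) hGκ two_pos hGβ
  -- The quotient `(e^{isy} - 1)/y` is bounded by `|s|`, so the increment is a bounded multiple of
  -- `y = k·d²H η/|η|` and lies in the kernel of `ℓ`.
  let F : Freq d × realSpan Λ → ℂ := fun q => (κ q.1 : ℂ) * (expPair ζ (q.1, ‖q.2‖⁻¹ • q.2) *
    ((Complex.exp (Complex.I * ((s * (θ q / ‖q.2‖) : ℝ) : ℂ)) - 1) / ((θ q / ‖q.2‖ : ℝ) : ℂ)))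
  have hF : ∀ q, ‖F q‖ ≤ |s| := by
    intro q
    simp only [F]
    rw [norm_mul, norm_mul, norm_expPair, one_mul, Complex.norm_real, norm_div, Complex.norm_real,
      Real.norm_of_nonneg κ.nonneg]
    have h1 : ‖Complex.exp (Complex.I * ((s * (θ q / ‖q.2‖) : ℝ) : ℂ)) - 1‖ / ‖θ q / ‖q.2‖‖ ≤ |s| := by
      refine div_le_of_le_mul₀ (norm_nonneg _) (abs_nonneg s) ?_
      rw [← Real.norm_eq_abs, ← norm_mul]
      exact Real.norm_exp_I_mul_ofReal_sub_one_le
    exact (mul_le_of_le_one_left (by positivity) κ.le_one).trans h1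
  have hzero := hℓ ⟨_, hsym⟩ k hk F |s| 2 hF (by
    intro x ξ η hη
    change phase k x * G (ξ, η) = _
    rw [hGβ ξ η hη]
    have h1 : θ (ξ, ‖η‖⁻¹ • η) = θ (ξ, η) / ‖η‖ := by
      simp only [θ]
      rw [Submodule.coe_smul, map_smul, real_inner_smul_right, inv_mul_eq_div]
    have h2 : inner ℝ (latticeVec k) (hessian H ξ η) / ‖η‖ = θ (ξ, η) / ‖η‖ := rfl
    simp only [g, F]
    rw [h1, h2]
    -- Where `y = 0` the quotient takes the value `0` by convention, and the increment vanishes as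
    -- well.
    by_cases h3 : ((θ (ξ, η) / ‖η‖ : ℝ) : ℂ) = 0
    · rw [Complex.ofReal_eq_zero.1 h3]
      simp
    · rw [mul_assoc (κ ξ : ℂ), mul_assoc (expPair _ _), div_mul_cancel₀ _ h3])
  obtain ⟨ρ, hρ, hρ2⟩ := ((hm.integral ⟨_, hsym⟩).and (eventually_gt_atTop 2)).exists
  rw [hzero] at hρ
  rw [hρ]
  refine integral_congr_ae ?_
  filter_upwards [hm.sphere] with p hp
  have hρ0 : 0 < ρ := two_pos.trans hρ2
  have hn : ‖ρ • (p.2.2 : realSpan Λ)‖ = ρ := by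
    rw [norm_smul, hp, mul_one, Real.norm_of_nonneg hρ0.le]
  change _ = phase k p.1 * G ((p.2.1 : Freq d), ρ • (p.2.2 : realSpan Λ))
  rw [hGβ _ _ (by rwa [hn]), hn, smul_smul, inv_mul_cancel₀ hρ0.ne', one_smul, trigFun_apply,
    phase_proj, real_inner_smul_right]
  simp only [g, θ, fiberPair]
  ring

theorem exists_bump_sequence (ξ₀ : Freq d) (hr : 0 < r) :
    ∃ κ : ℕ → ContDiffBump ξ₀, (∀ j, (κ j).rOut < r) ∧
      ∀ ξ ∈ Metric.ball ξ₀ r, ∀ᶠ j in atTop, κ j ξ = 1 := by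
  have hj : ∀ j : ℕ, r / ((j : ℝ) + 3) < r / ((j : ℝ) + 2) := fun j =>
    div_lt_div_of_pos_left hr (by positivity) (by linarith)
  have hj2 : ∀ j : ℕ, r / ((j : ℝ) + 2) < r := fun j =>
    div_lt_self hr (by have : (0 : ℝ) ≤ j := j.cast_nonneg; linarith)
  refine ⟨fun j => ⟨r - r / ((j : ℝ) + 2), r - r / ((j : ℝ) + 3), sub_pos.2 (hj2 j),
    sub_lt_sub_left (hj j) r⟩, fun j => ?_, fun ξ hξ => ?_⟩
  · change r - r / ((j : ℝ) + 3) < r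
    have : 0 < r / ((j : ℝ) + 3) := by positivity
    linarith
  · have h1 : Tendsto (fun j : ℕ => r - r / ((j : ℝ) + 2)) atTop (𝓝 (r - 0)) :=
      (tendsto_const_nhds.div_atTop
        (tendsto_atTop_add_const_right _ 2 tendsto_natCast_atTop_atTop)).const_sub r
    rw [sub_zero] at h1
    filter_upwards [h1.eventually (lt_mem_nhds (Metric.mem_ball.1 hξ))] with j hj
    exact ContDiffBump.one_of_mem_closedBall _ (Metric.mem_closedBall.2 hj.le)

/-- The localization is removed by dominated convergence along bumps that exhaust the open ball,
where the measure is concentrated. -/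
theorem integral_hessian_increment (hH : ContDiff ℝ ∞ H) (hr : 0 < r)
    (hℓ : ∀ (a : SymbolSpace Λ ξ₀ r) (k : Fin d → ℤ), k ∈ Λ → ∀ (F : Freq d × realSpan Λ → ℂ)
      (CF ρ : ℝ), (∀ p, ‖F p‖ ≤ CF) → (∀ x ξ (η : realSpan Λ), ρ < ‖η‖ →
        a.1 (x, ξ, η) = phase k x *
          (F (ξ, η) * ((inner ℝ (latticeVec k) (hessian H ξ η) / ‖η‖ : ℝ) : ℂ))) → ℓ a = 0)
    {m : Measure (PhaseSpace H Λ)} [IsFiniteMeasure m] (hm : Represents H m ℓ) {k : Fin d → ℤ}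
    (hk : k ∈ Λ) (ζ : Freq d × realSpan Λ) (s : ℝ) :
    ∫ p : PhaseSpace H Λ, trigFun H Λ k ζ p *
      (phase k (proj (s • hessian H (p.2.1 : Freq d) (p.2.2 : realSpan Λ))) - 1) ∂m = 0 := by
  obtain ⟨κ, hκ, hκ1⟩ := exists_bump_sequence ξ₀ hr
  set f : PhaseSpace H Λ → ℂ := fun p => trigFun H Λ k ζ p *
      (phase k (proj (s • hessian H (p.2.1 : Freq d) (p.2.2 : realSpan Λ))) - 1) with hf
  have hv : Continuous fun p : PhaseSpace H Λ =>
      s • hessian H (p.2.1 : Freq d) ((p.2.2 : realSpan Λ) : Freq d) :=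
    (((contDiff_hessian hH).continuous.comp (by fun_prop : Continuous fun p : PhaseSpace H Λ =>
      (p.2.1 : Freq d))).clm_apply (by fun_prop)).const_smul s
  have hfc : Continuous f := (trigFun H Λ k ζ).continuous.mul
    (((continuous_phase k).comp (continuous_proj.comp hv)).sub continuous_const)
  have hfb : ∀ p, ‖f p‖ ≤ 2 := by
    intro p
    simp only [hf]
    rw [norm_mul, trigFun_apply, norm_mul, norm_phase, norm_expPair, one_mul, one_mul]
    refine (norm_sub_le _ _).trans ?_
    rw [norm_phase, norm_one]
    norm_num
  have hlim : Tendsto (fun j => ∫ p : PhaseSpace H Λ, (κ j (p.2.1 : Freq d) : ℂ) * f p ∂m) atTop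
      (𝓝 (∫ p, f p ∂m)) := by
    refine tendsto_integral_of_dominated_convergence (fun _ => 2) (fun j => ?_)
      (integrable_const _) (fun j => Eventually.of_forall fun p => ?_) ?_
    · exact ((Complex.continuous_ofReal.comp ((κ j).continuous.comp (by fun_prop))).mul
        hfc).aestronglyMeasurable
    · rw [norm_mul, Complex.norm_real, Real.norm_of_nonneg (κ j).nonneg]
      exact (mul_le_of_le_one_left (norm_nonneg _) (κ j).le_one).trans (hfb p)
    · filter_upwards [hm.ball] with p hp
      refine tendsto_const_nhds.congr' ?_
      filter_upwards [hκ1 _ hp] with j hj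
      rw [hj, Complex.ofReal_one, one_mul]
  simp only [fun j => integral_hessian_increment_bump hH hℓ hm hk ζ s (κ j) (hκ j), hf] at hlim
  exact tendsto_nhds_unique hlim tendsto_const_nhds

/-- Almost everywhere `|z| = 1` and `ξ ∈ I_Λ ∩ B(ξ₀, r)`, so `σ(ξ) = ξ` and the flow is a continuous
shear; its singularity at `z = 0` is not charged. -/
theorem map_flowOne_eq (hH : ContDiff ℝ ∞ H) (hΛ : IsPrimitive Λ) (hr : 0 < r) (hrε : r ≤ ε)
    (hdecomp : ∀ ξ ∈ Metric.ball ξ₀ r, ∃! σ, IsBasePoint H Λ ξ₀ ε ξ σ)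
    (hℓ : ∀ (a : SymbolSpace Λ ξ₀ r) (k : Fin d → ℤ), k ∈ Λ → ∀ (F : Freq d × realSpan Λ → ℂ)
      (CF ρ : ℝ), (∀ p, ‖F p‖ ≤ CF) → (∀ x ξ (η : realSpan Λ), ρ < ‖η‖ →
        a.1 (x, ξ, η) = phase k x *
          (F (ξ, η) * ((inner ℝ (latticeVec k) (hessian H ξ η) / ‖η‖ : ℝ) : ℂ))) → ℓ a = 0)
    {m : Measure (PhaseSpace H Λ)} [IsFiniteMeasure m] (hm : Represents H m ℓ)
    (hmv : ∀ v, IsOrthogonalTo Λ v → m.map (translate H Λ v) = m) (s : ℝ) :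
    m.map (flowOne H Λ ξ₀ ε s) = m := by
  have hc : Continuous fun q : resonantSet H Λ × Compactified Λ =>
      s • hessian H (q.1 : Freq d) ((q.2 : realSpan Λ) : Freq d) :=
    (((contDiff_hessian hH).continuous.comp (by fun_prop :
      Continuous fun q : resonantSet H Λ × Compactified Λ => (q.1 : Freq d))).clm_apply
        (by fun_prop)).const_smul s
  have h1 : flowOne H Λ ξ₀ ε s =ᵐ[m] shear fun q : resonantSet H Λ × Compactified Λ =>
      s • hessian H (q.1 : Freq d) ((q.2 : realSpan Λ) : Freq d) := by
    filter_upwards [hm.sphere, hm.ball] with p hp1 hp2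
    rw [flowOne, shear, sigmaMap_of_mem_resonantSet hdecomp hrε hp2 p.2.1.2, hp1, inv_one, one_smul]
  rw [Measure.map_congr h1]
  exact map_shear_eq_of_modes hH hΛ hmv hc.measurable fun k hk ζ =>
    integral_hessian_increment hH hr hℓ hm hk ζ s

end

end TwoMicrolocal

end

/-! ### Assembly of the theorem. -/

theorem mainTheorem7 {d : ℕ}
    (H : TwoMicrolocal.Freq d → ℝ) (hH : ContDiff ℝ ∞ H)
    (Λ : Submodule ℤ (Fin d → ℤ)) (hΛ : TwoMicrolocal.IsPrimitive Λ)
    (ξ₀ : TwoMicrolocal.Freq d) (hξ₀ : ξ₀ ∈ TwoMicrolocal.strictResonantSet H Λ)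
    (r ε : ℝ) (hr : 0 < r) (hrε : r ≤ ε)
    (hdef : ∀ ξ ∈ Metric.ball ξ₀ ε, TwoMicrolocal.DefiniteHessianAt H ξ)
    (hdecomp : ∀ ξ ∈ Metric.ball ξ₀ r, ∃! σ, TwoMicrolocal.IsBasePoint H Λ ξ₀ ε ξ σ)
    (χ : TwoMicrolocal.realSpan Λ → ℝ) (hχ : ContDiff ℝ ∞ χ) (hχc : HasCompactSupport χ)
    (hχ0 : ∀ η, 0 ≤ χ η) (hχ1 : ∀ᶠ η in 𝓝 0, χ η = 1)
    (h τ R δ : ℕ → ℝ)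
    (hh : ∀ n, 0 < h n) (hh0 : Tendsto h atTop (𝓝 0))
    (hτ : ∀ n, 0 < τ n) (hτ_top : Tendsto τ atTop atTop)
    (hhτ : ∃ M : ℝ, ∀ n, h n * τ n ≤ M)
    (hR : ∀ m, 1 < R m) (hR_top : Tendsto R atTop atTop)
    (hδ : ∀ l, 0 < δ l ∧ δ l < 1) (hδ0 : Tendsto δ atTop (𝓝 0))
    (u : ℕ → Lp ℂ 2 (volume : Measure (TwoMicrolocal.Torus d)))
    (hu : ∃ M : ℝ, ∀ n, ‖u n‖ ≤ M)
    (hu_loc : ∀ n (k : Fin d → ℤ), h n • TwoMicrolocal.latticeVec k ∉ Metric.ball ξ₀ r →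
      TwoMicrolocal.fourierCoef (u n) k = 0)
    (μ : ℝ → TwoMicrolocal.SymbolSpace Λ ξ₀ r →ₗ[ℂ] ℂ)
    (hμ : TwoMicrolocal.IsTwoMicrolocalLimit H Λ ξ₀ r ε χ h τ R δ u μ) :
    ∀ᵐ t : ℝ, ∃ m : Measure (TwoMicrolocal.PhaseSpace H Λ),
      IsFiniteMeasure m ∧
      (∀ a : TwoMicrolocal.SymbolSpace Λ ξ₀ r,
        μ t a = ∫ p, TwoMicrolocal.extendSymbol H Λ a.1 p ∂m) ∧
      m {p | ‖(p.2.2 : TwoMicrolocal.realSpan Λ)‖ ≠ 1} = 0 ∧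
      m {p | (p.2.1 : TwoMicrolocal.Freq d) ∉ Metric.ball ξ₀ r} = 0 ∧
      (∀ v, TwoMicrolocal.IsOrthogonalTo Λ v → m.map (TwoMicrolocal.translate H Λ v) = m) ∧
      ∀ s : ℝ, m.map (TwoMicrolocal.flowZero H Λ s) = m ∧
        m.map (TwoMicrolocal.flowOne H Λ ξ₀ ε s) = m := by
  obtain ⟨c₀, C₀, Cχ, hcut⟩ := TwoMicrolocal.exists_isCutoff hχ hχc hχ0 hχ1
  obtain ⟨M₁, hM₁⟩ := hhτ
  obtain ⟨M₂, hM₂⟩ := hu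
  have hfam : TwoMicrolocal.IsLocalizedFamily ξ₀ r h τ u (max M₁ M₂) :=
    ⟨hh, hh0, hτ, fun n => (hM₁ n).trans (le_max_left _ _),
      fun n => (hM₂ n).trans (le_max_right _ _), hu_loc⟩
  -- Positivity, the mass bound and the cancellation along the Hessian flow are closed conditions on
  -- `μ t a`, so each holds for all symbols at once outside a single null set.
  have hpos := TwoMicrolocal.ae_forall_mem_of_isClosed hμ.continuousForm
    {a | ∃ R₀ : ℝ, ∀ x ξ η, ξ ∈ TwoMicrolocal.resonantSet H Λ → ξ ∈ Metric.ball ξ₀ r →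
      R₀ < ‖η‖ → 0 ≤ (a.1 (x, ξ, η)).re}
    (isClosed_le continuous_const Complex.continuous_re : IsClosed {z : ℂ | 0 ≤ z.re})
    (fun a ⟨_, ha⟩ => hμ.ae_re_nonneg hdecomp hcut hfam hR hR_top hδ hδ0 a ha)
  have hmass := TwoMicrolocal.ae_forall_mem_of_isClosed hμ.continuousForm
    {a | ∃ f : TwoMicrolocal.Freq d × TwoMicrolocal.realSpan Λ → ℂ,
      (∀ x ξ η, a.1 (x, ξ, η) = f (ξ, η)) ∧ ∀ p, ‖f p‖ ≤ 1}
    (isClosed_le Complex.continuous_re continuous_const :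
      IsClosed {z : ℂ | z.re ≤ (max M₁ M₂) ^ 2 * ((1 + Cχ) * Cχ)})
    (fun a ⟨_, haf, hf⟩ => hμ.ae_re_le hcut hfam a haf hf)
  have hzero := TwoMicrolocal.ae_forall_mem_of_isClosed hμ.continuousForm
    {a | ∃ k ∈ Λ, ∃ (F : TwoMicrolocal.Freq d × TwoMicrolocal.realSpan Λ → ℂ) (CF ρ : ℝ),
      (∀ p, ‖F p‖ ≤ CF) ∧ ∀ x ξ (η : TwoMicrolocal.realSpan Λ), ρ < ‖η‖ →
        a.1 (x, ξ, η) = TwoMicrolocal.phase k x * (F (ξ, η) *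
          ((inner ℝ (TwoMicrolocal.latticeVec k) (TwoMicrolocal.hessian H ξ η) / ‖η‖ : ℝ) : ℂ))}
    (isClosed_singleton : IsClosed {(0 : ℂ)})
    (fun a ⟨_, hk, _, _, _, hF, ha⟩ =>
      hμ.ae_eq_zero hH hrε hdecomp hcut hfam hR hR_top hδ hδ0 a hk hF ha)
  filter_upwards [hpos, hmass, hzero] with t h1 h2 h3
  have hℓ : TwoMicrolocal.IsPositiveAtInfinity H Λ ξ₀ r ((max M₁ M₂) ^ 2 * ((1 + Cχ) * Cχ)) (μ t) :=
    ⟨fun a R₀ ha => h1 a ⟨R₀, ha⟩, fun a f haf hf => h2 a ⟨f, haf, hf⟩⟩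
  obtain ⟨m₀, _, hm₀⟩ := hℓ.exists_represents hH hr
  -- The measure from Hahn–Banach is not unique and may have modes outside `Λ`; averaging removes
  -- them.
  have hm := hm₀.average
  have hmv := fun v (hv : TwoMicrolocal.IsOrthogonalTo Λ v) =>
    TwoMicrolocal.average_map_translate m₀ hv
  refine ⟨TwoMicrolocal.average m₀, inferInstance, fun a => ?_, hm.sphere, hm.ball, hmv, fun s =>
    ⟨TwoMicrolocal.map_flowZero_eq hH hΛ hmv s,
      TwoMicrolocal.map_flowOne_eq hH hΛ hr hrε hdecomp
        (fun a k hk F CF ρ hF ha => h3 a ⟨k, hk, F, CF, ρ, hF, ha⟩) hm hmv s⟩⟩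
  obtain ⟨ρ, hρ, hext⟩ := ((hm.integral a).and
    (TwoMicrolocal.IsSymbol.extendSymbol_eventuallyEq (H := H) a.2)).exists
  rw [hρ]
  exact integral_congr_ae (hm.sphere.mono fun p hp => (hext p hp).symm)
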